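/- Let $g=\mathrm{diag}(-1,1,1,1)$. A barotropic fluid is given by a smooth function $p:(0,\infty)\to\mathbb R$, the pressure as a function of the temperature $\theta$. Its states are the future-directed timelike vectors $\psi^\alpha$ ($\alpha=0,\dots,3$), with temperature $\theta=(-\psi_\alpha\psi^\alpha)^{-1/2}$, four-velocity $U^\alpha=\theta\psi^\alpha$ and ideal energy-momentum tensor $$T^{\alpha\beta}=\frac{\partial(p(\theta)\psi^\beta)}{\partial\psi_\alpha}=\theta^3p'(\theta)\psi^\alpha\psi^\beta+p(\theta)g^{\alpha\beta}.$$ Assume strict causality: at every state the matrix $\big(T_\beta\,\partial^2(p(\theta)\psi^\beta)/\partial\psi_\alpha\partial\psi_\gamma\big)_{\alpha,\gamma}$ is negative definite for all future-directed non-spacelike covectors $T_\beta\ne0$. Let $\rho=\theta p'(\theta)-p(\theta)$ be the energy and $c_s^2=dp/d\rho$ the squared sound speed (then $0<c_s<1$). Let the coefficients of shear viscosity $\eta>0$, bulk viscosity $\zeta\ge0$ and thermal conductivity $\chi>0$ be smooth functions of $\theta\in(0,\infty)$. Put $$\sigma=\frac{\frac43\eta+\zeta}{1-c_s^2}-c_s^2\chi\theta,\qquad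 \check\zeta=\zeta+c_s^2\sigma-c_s^2(1-c_s^2)\chi\theta,\qquad \Pi^{\alpha\beta}=g^{\alpha\beta}+U^\alpha U^\beta,$$ and assume that $\sigma>0$ for all $\theta>0$. The dissipation tensor is $$\begin{aligned}-\Delta T_\Box^{\alpha\beta}={}&\eta\,\Pi^{\alpha\gamma}\Pi^{\beta\delta}\Big[\frac{\partial U_\gamma}{\partial x^\delta}+\frac{\partial U_\delta}{\partial x^\gamma}-\frac23 g_{\gamma\delta}\frac{\partial U^\epsilon}{\partial x^\epsilon}\Big]+\check\zeta\,\Pi^{\alpha\beta}\frac{\partial U^\gamma}{\partial x^\gamma}\\&+\sigma\Big[U^\alpha U^\beta\frac{\partial U^\gamma}{\partial x^\gamma}-(\Pi^{\alpha\gamma}U^\beta+\Pi^{\beta\gamma}U^\alpha)U^\delta\frac{\partial U_\gamma}{\partial x^\delta}\Big]\\&+\chi\Big[U^\alpha\frac{\partial\theta}{\partial x_\beta}+U^\beta\frac{\partial\theta}{\partial x_\alpha}-g^{\alpha\beta}U^\gamma\frac{\partial\theta}{\partial x^\gamma}\Big].\end{aligned}$$ For $n\in\mathbb R^3$, the characteristic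 speeds at $\psi$ in the direction $n$ are the roots $\lambda_1\le\lambda_2\le\lambda_3\le\lambda_4$ of $\det(n_jA^j-\lambda A^0)=0$, where $A^\beta=(\partial T^{\alpha\beta}/\partial\psi_\gamma)_{\alpha,\gamma}$. Those different from the fluid velocity $n_jU^j/U^0$ are the acoustic ones. Assume that the acoustic mode is genuinely nonlinear: $\nabla\lambda\cdot r\neq0$ for every acoustic characteristic speed $\lambda$ with characteristic vector $r\ne0$, at all states and in all directions $n\ne0$. A Lax shock consists of a covector $\xi_\beta$ and two states $\psi^\mp$ (for $x^\beta\xi_\beta<0$ and $x^\beta\xi_\beta>0$, respectively) such that $\xi_\beta T^{\alpha\beta}(\psi^-)=\xi_\beta T^{\alpha\beta}(\psi^+)=:q^\alpha$ and, with $n=(\xi_1,\xi_2,\xi_3)$ and $s=-\xi_0$, for some $k\in\{1,2,3,4\}$, $$\lambda_{k-1}(\psi^-)<s<\lambda_k(\psi^-),\qquad\lambda_k(\psi^+)<s<\lambda_{k+1}(\psi^+)$$ (inequalities with $\lambda_0$ or $\lambda_5$ being void). Theorem. Every Lax shock, of whatever strength, has a dissipation profile with respect to $\Delta T_\Box$: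 there is a smooth map $\hat\psi$ from $\mathbb R$ to the set of states such that, for $\psi(x)=\hat\psi(x^\beta\xi_\beta)$, $$-\xi_\beta\,\Delta T_\Box^{\alpha\beta}=\xi_\beta T^{\alpha\beta}(\hat\psi)-q^\alpha,\quad\alpha=0,\dots,3,\qquad\hat\psi(-\infty)=\psi^-,\quad\hat\psi(+\infty)=\psi^+ .$$ -/

import Mathlib

open Filter Topology
open scoped ContDiff Matrix

noncomputable section

namespace RelFluid

/-- Contravariant components of a four-vector, or covariant components of a covector. -/
abbrev Vec4 : Type := Fin 4 → ℝ

/-- The Minkowski metric with signature `(-, +, +, +)`; it is its own inverse, so it serves for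
both `g_{αβ}` and `g^{αβ}`. -/
def metric : Matrix (Fin 4) (Fin 4) ℝ := Matrix.diagonal ![-1, 1, 1, 1]

/-- Lowering (equivalently, raising) an index. -/
def flipIndex (v : Vec4) : Vec4 := metric *ᵥ v

/-- The Lorentz product `v^α w_α`. -/
def lorentz (v w : Vec4) : ℝ := v ⬝ᵥ flipIndex w

/-- The states of the fluid: future-directed timelike vectors `ψ^α`. -/
def stateSpace : Set Vec4 := {ψ | lorentz ψ ψ < 0 ∧ 0 < ψ 0}

/-- The temperature `θ = (-ψ_α ψ^α)^{-1/2}`. -/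
def temperature (ψ : Vec4) : ℝ := (Real.sqrt (-lorentz ψ ψ))⁻¹

/-- The four-velocity `U^α = θ ψ^α`. -/
def velocity (ψ : Vec4) : Vec4 := temperature ψ • ψ

/-- The energy density `ρ = θ p'(θ) - p(θ)` as a function of the temperature. -/
def energy (p : ℝ → ℝ) (θ : ℝ) : ℝ := θ * deriv p θ - p θ

/-- The square of the sound speed, `c_s² = dp/dρ`, as a function of the temperature. -/
def soundSq (p : ℝ → ℝ) (θ : ℝ) : ℝ := deriv p θ / deriv (energy p) θ

/-- The ideal energy-momentum tensor `T^{αβ} = θ³ p'(θ) ψ^α ψ^β + p(θ) g^{αβ}`. -/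
def idealT (p : ℝ → ℝ) (ψ : Vec4) (α β : Fin 4) : ℝ :=
  temperature ψ ^ 3 * deriv p (temperature ψ) * ψ α * ψ β + p (temperature ψ) * metric α β

/-- The flux `ξ_β T^{αβ}(ψ)` in the direction of the covector `ξ`. -/
def idealFlux (p : ℝ → ℝ) (ξ : Vec4) (ψ : Vec4) (α : Fin 4) : ℝ := ∑ β, ξ β * idealT p ψ α β

/-- `∂T^{αβ}/∂ψ_γ = ∂²(p ψ^β)/∂ψ_α ∂ψ_γ`. The derivative is with respect to the covariant
component `ψ_γ`, whence the factor `g_{γγ}`. -/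
def dT (p : ℝ → ℝ) (ψ : Vec4) (α β γ : Fin 4) : ℝ :=
  metric γ γ * fderiv ℝ (fun φ : Vec4 => idealT p φ α β) ψ (Pi.single γ 1)

/-- The symbol `(N_β ∂T^{αβ}/∂ψ_γ)_{α,γ}` of the Euler equations at the covector `N`. -/
def symbol (p : ℝ → ℝ) (N : Vec4) (ψ : Vec4) : Matrix (Fin 4) (Fin 4) ℝ :=
  Matrix.of fun α γ => ∑ β, N β * dT p ψ α β γ

/-- Strict causality of the ideal fluid: the symbol is negative definite at each
future-directed non-spacelike (nonzero) covector `T_β`. -/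
def StrictlyCausal (p : ℝ → ℝ) : Prop :=
  ∀ ψ ∈ stateSpace, ∀ T : Vec4, lorentz T T ≤ 0 → 0 < flipIndex T 0 →
    ∀ w : Vec4, w ≠ 0 → w ⬝ᵥ (symbol p T ψ *ᵥ w) < 0

/-- The covector `(-μ, n)`, with `x^β ξ_β = n · x - μ t`. -/
def front (n : Fin 3 → ℝ) (μ : ℝ) : Vec4 := Fin.cons (-μ) n

/-- `μ` is a characteristic speed in the direction `n`: `det (n_j A^j - μ A^0) = 0`, where
`A^β = (∂T^{αβ}/∂ψ_γ)_{α,γ}`. (For `n` not of length one, all speeds are scaled by `|n|`.) -/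
def IsCharSpeed (p : ℝ → ℝ) (n : Fin 3 → ℝ) (ψ : Vec4) (μ : ℝ) : Prop :=
  (symbol p (front n μ) ψ).det = 0

/-- `lam 0 ≤ lam 1 ≤ lam 2 ≤ lam 3` is the complete list of the characteristic speeds in the
direction `n`, with multiplicities: `det (n_j A^j - μ A^0) = det A^0 · ∏ (lam i - μ)`. -/
def IsCharSpeedList (p : ℝ → ℝ) (n : Fin 3 → ℝ) (ψ : Vec4) (lam : Fin 4 → ℝ) : Prop :=
  Monotone lam ∧ ∀ μ : ℝ,
    (symbol p (front n μ) ψ).det = (symbol p (Pi.single 0 1) ψ).det * ∏ i, (lam i - μ)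

/-- The velocity of the fluid in the direction `n`; it is the characteristic speed of the
non-acoustic modes. -/
def fluidSpeed (n : Fin 3 → ℝ) (ψ : Vec4) : ℝ := (∑ j : Fin 3, n j * ψ j.succ) / ψ 0

/-- Genuine nonlinearity of the acoustic mode: `∇lam · r ≠ 0` for each acoustic characteristic
speed `lam` with characteristic vector `r`, in all directions and at all states.
Here `∇lam · r` is the derivative at `t = 0` of the characteristic speed along `ψ + t r`. -/
def AcousticGenuinelyNonlinear (p : ℝ → ℝ) : Prop :=
  ∀ ψ ∈ stateSpace, ∀ n : Fin 3 → ℝ, n ≠ 0 → ∀ (lam : ℝ → ℝ) (lam' : ℝ) (r : Vec4),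
    lam 0 ≠ fluidSpeed n ψ →
    r ≠ 0 → symbol p (front n (lam 0)) ψ *ᵥ flipIndex r = 0 →
    (∀ᶠ t in 𝓝 (0 : ℝ), IsCharSpeed p n (ψ + t • r) (lam t)) →
    HasDerivAt lam lam' 0 → lam' ≠ 0

/-- The two states `ψm` (for `x^β ξ_β < 0`) and `ψp` (for `x^β ξ_β > 0`) form a Lax shock:
the Rankine-Hugoniot conditions hold, and for some `k` the speed `s = -ξ_0` of the front, which
moves in the direction `n = (ξ_1, ξ_2, ξ_3)`, satisfies
`lam_{k-1}(ψm) < s < lam_k(ψm)` and `lam_k(ψp) < s < lam_{k+1}(ψp)`. -/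
def IsLaxShock (p : ℝ → ℝ) (ξ ψm ψp : Vec4) : Prop :=
  ψm ∈ stateSpace ∧ ψp ∈ stateSpace ∧
  (∀ α, idealFlux p ξ ψm α = idealFlux p ξ ψp α) ∧
  ∃ (lm lp : Fin 4 → ℝ) (k : Fin 4),
    IsCharSpeedList p (Fin.tail ξ) ψm lm ∧ IsCharSpeedList p (Fin.tail ξ) ψp lp ∧
    (∀ i, i < k → lm i < -ξ 0) ∧ (∀ i, k ≤ i → -ξ 0 < lm i) ∧
    (∀ i, i ≤ k → lp i < -ξ 0) ∧ (∀ i, k < i → -ξ 0 < lp i)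

/-- The coefficient `σ = ((4/3) η + ζ) / (1 - c_s²) - c_s² χ θ`. -/
def sigmaCoeff (p η ζ χ : ℝ → ℝ) (θ : ℝ) : ℝ :=
  (4 / 3 * η θ + ζ θ) / (1 - soundSq p θ) - soundSq p θ * χ θ * θ

/-- The coefficient `ζ + c_s² σ - c_s² (1 - c_s²) χ θ`. -/
def zetaCheck (p η ζ χ : ℝ → ℝ) (θ : ℝ) : ℝ :=
  ζ θ + soundSq p θ * sigmaCoeff p η ζ χ θ - soundSq p θ * (1 - soundSq p θ) * χ θ * θ

/-- The projector `g^{αβ} + U^α U^β`. -/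
def proj (U : Vec4) (α β : Fin 4) : ℝ := metric α β + U α * U β

/-- The tensor `-ΔT^{αβ}` for viscosity and heat conduction, at a point where the state is `ψ` and
the gradients are `dU γ δ = ∂U_γ/∂x^δ` (lower index `γ`) and `dθ δ = ∂θ/∂x^δ`. -/
def negDeltaT (p η ζ χ : ℝ → ℝ) (ψ : Vec4) (dU : Fin 4 → Fin 4 → ℝ) (dθ : Fin 4 → ℝ)
    (α β : Fin 4) : ℝ :=
  let θ := temperature ψ
  let U := velocity ψ
  let divU := ∑ γ, ∑ δ, metric γ δ * dU γ δ
  η θ * (∑ γ, ∑ δ, proj U α γ * proj U β δ * (dU γ δ + dU δ γ - 2 / 3 * metric γ δ * divU))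
    + zetaCheck p η ζ χ θ * proj U α β * divU
    + sigmaCoeff p η ζ χ θ * (U α * U β * divU
        - ∑ γ, ∑ δ, (proj U α γ * U β + proj U β γ * U α) * U δ * dU γ δ)
    + χ θ * ((U α * flipIndex dθ β + U β * flipIndex dθ α) - metric α β * ∑ γ, U γ * dθ γ)

/-- `-ΔT^{αβ}` evaluated at the plane wave `x ↦ Ψ(x^β ξ_β)`, as a function of `y = x^β ξ_β`. -/
def waveNegDeltaT (p η ζ χ : ℝ → ℝ) (ξ : Vec4) (Ψ : ℝ → Vec4) (y : ℝ) (α β : Fin 4) : ℝ :=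
  negDeltaT p η ζ χ (Ψ y)
    (fun γ δ => ξ δ * deriv (fun z => flipIndex (velocity (Ψ z)) γ) y)
    (fun δ => ξ δ * deriv (fun z => temperature (Ψ z)) y) α β

/-- `Ψ` is a dissipation profile of the shock `(ψm, ψp)` with normal `ξ`: a smooth solution
on `ℝ`, with values in the state space, of the profile equation
`-ξ_β ΔT^{αβ} = ξ_β T^{αβ}(Ψ) - q^α`, `q^α = ξ_β T^{αβ}(ψm)`, with `Ψ(-∞) = ψm`, `Ψ(∞) = ψp`. -/
def IsDissipationProfile (p η ζ χ : ℝ → ℝ) (ξ ψm ψp : Vec4) (Ψ : ℝ → Vec4) : Prop :=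
  ContDiff ℝ ∞ Ψ ∧ (∀ y, Ψ y ∈ stateSpace) ∧
  (∀ y α, ∑ β, ξ β * waveNegDeltaT p η ζ χ ξ Ψ y α β
    = idealFlux p ξ (Ψ y) α - idealFlux p ξ ψm α) ∧
  Tendsto Ψ atBot (𝓝 ψm) ∧ Tendsto Ψ atTop (𝓝 ψp)

end RelFluid

end

/-! A profile stays in the timelike plane spanned by the normal of the front and the flux vector
`q`. In an orthonormal frame `e`, `x` of this plane, with `ξ = l · flipIndex x`, a state is given by
its temperature `θ` and its normal velocity `T` with `|T| < 1`. The coefficients are tuned so that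
the longitudinal viscosity `4/3 η + ζ̌` equals `σ` (`longitudinal_viscosity`). The component of the
dissipation along `U` is then a multiple of `χ θ'` alone, the one along the normal to `U` a multiple
of `σ T'` alone, and with `q = l (q₀ e + q₁ x)` the profile equation becomes the planar system
`planarField`: `θ'` has the sign of `T (q₁ + ρ) - q₀` and `T'` that of `p + q₀ T - q₁`.

Its nullclines are the graphs `T = (q₁ - p)/q₀` and `T = q₀/(q₁ + ρ)`, both decreasing in `θ`. They
cross at the zeros of the Hugoniot function `G(θ) = (q₁ - p)(q₁ + ρ) - q₀²`, whose sign tells which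
graph is higher. Genuine nonlinearity amounts to `θ (c_s²)' + 2 (1 - c_s²) ≠ 0`, an expression of
constant sign, and this makes all critical points of `G` nondegenerate maxima, or all of them
nondegenerate minima (`hugoniotDeriv₂_of_critical`). The Lax conditions say that the flow is
supersonic at one state and subsonic at the other, which fixes the signs of `G'` there. Hence `G`
has no zero between the two temperatures (`hugoniot_sign`), and the nullclines bound a lens with the
two states as corners and no other equilibrium.

Up to a reflection, the field in the lens points right and down and leaves it through both graphs,
so the lens is invariant backwards in time. Nested compactness yields an orbit that stays in the
lens for all times. It is monotone in both coordinates, so it converges at both ends, necessarily to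
equilibria, and it joins the two corners (`LensField.exists_heteroclinic`). The strength of the
shock plays no role.

That Lax shocks are acoustic (`IsLaxShock.acoustic`) comes from the determinant of the symbol: the
fluid speed is a double root, enclosed by the two roots of a convex quadratic. A front which the
fluid crosses against `ξ` is treated by reversing `ξ`. -/

noncomputable section

/-! ### Planar dynamics: global flows and heteroclinic orbits in a lens -/

namespace PlanarFlow

open Set
open scoped NNReal

/-- A bounded Lipschitz vector field on a Banach space has a global flow. -/
theorem exists_flow {E : Type*} [NormedAddCommGroup E] [NormedSpace ℝ E] [CompleteSpace E]
    {F : E → E} {K : ℝ≥0} (hF : LipschitzWith K F) {M : ℝ≥0} (hM : ∀ x, ‖F x‖ ≤ M) :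
    ∃ Φ : E → ℝ → E, (∀ x, Φ x 0 = x) ∧ ∀ x t, HasDerivAt (Φ x) (F (Φ x t)) t := by
  have key : ∀ (x : E) (n : ℕ), ∃ α : ℝ → E, α 0 = x ∧
      ∀ t ∈ Ioo (-((n : ℝ) + 1)) ((n : ℝ) + 1), HasDerivAt α (F (α t)) t := by
    intro x n
    have hn : (0 : ℝ) ≤ (n : ℝ) + 1 := by positivity
    -- A curve of speed at most `M` cannot leave the ball of radius `M (n + 1)` within time `n + 1`,
    -- so one application of Picard-Lindelöf covers the whole interval.
    have hpl : IsPicardLindelof (fun _ => F) (tmin := -((n : ℝ) + 1)) (tmax := (n : ℝ) + 1)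
        ⟨0, by constructor <;> linarith⟩ x (M * ((n : ℝ≥0) + 1)) 0 M K :=
      { lipschitzOnWith := fun t _ => hF.lipschitzOnWith
        continuousOn := fun x _ => continuousOn_const
        norm_le := fun t _ x _ => hM x
        mul_max_le := by simp }
    obtain ⟨α, h0, hα⟩ := hpl.exists_eq_forall_mem_Icc_hasDerivWithinAt₀
    exact ⟨α, h0, fun t ht => (hα t (Ioo_subset_Icc_self ht)).hasDerivAt (Icc_mem_nhds ht.1 ht.2)⟩
  choose α h0 hα using key
  have agree : ∀ x (m n : ℕ), m ≤ n → EqOn (α x m) (α x n) (Ioo (-((m : ℝ) + 1)) ((m : ℝ) + 1)) := by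
    intro x m n hmn
    have hmn' : (m : ℝ) ≤ n := by exact_mod_cast hmn
    have hm : (0 : ℝ) ≤ m := by positivity
    refine ODE_solution_unique_of_mem_Ioo (v := fun _ => F) (s := fun _ => univ) (t₀ := 0) (K := K)
      (fun t _ => hF.lipschitzOnWith) ⟨by linarith, by linarith⟩
      (fun t ht => ⟨hα x m t ht, mem_univ _⟩)
      (fun t ht => ⟨hα x n t ⟨by linarith [ht.1], by linarith [ht.2]⟩, mem_univ _⟩) ?_
    rw [h0, h0]
  -- The solutions on growing intervals are glued by using at time `t` the one of index `⌈|t|⌉₊`;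
  -- its interval has half-length `⌈|t|⌉₊ + 1`, so that `t` is an interior point.
  refine ⟨fun x t => α x ⌈|t|⌉₊ t, fun x => h0 x _, fun x t => ?_⟩
  have habs : |t| < (⌈|t|⌉₊ : ℝ) + 1 := by linarith [Nat.le_ceil |t|]
  have ht : t ∈ Ioo (-((⌈|t|⌉₊ : ℝ) + 1)) ((⌈|t|⌉₊ : ℝ) + 1) := abs_lt.mp habs
  refine (hα x ⌈|t|⌉₊ t ht).congr_of_eventuallyEq ?_
  filter_upwards [Ioo_mem_nhds ht.1 ht.2] with s hs
  have hs' : s ∈ Ioo (-((⌈|s|⌉₊ : ℝ) + 1)) ((⌈|s|⌉₊ : ℝ) + 1) :=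
    abs_lt.mp (by linarith [Nat.le_ceil |s|])
  rcases le_total ⌈|s|⌉₊ ⌈|t|⌉₊ with h | h
  · exact agree x _ _ h hs'
  · exact (agree x _ _ h hs).symm

/-- The limit of the derivative of a convergent function vanishes. -/
theorem eq_zero_of_tendsto_deriv {f f' : ℝ → ℝ} {l c : ℝ} {φ : Filter ℝ} [NeBot φ]
    (hd : ∀ t, HasDerivAt f (f' t) t) (hf : Tendsto f φ (𝓝 l)) (hf' : Tendsto f' φ (𝓝 c))
    (h1 : Tendsto (fun t => t + 1) φ φ)
    (hb : ∀ s : ℝ → ℝ, (∀ t, t ≤ s t ∧ s t ≤ t + 1) → Tendsto s φ φ) : c = 0 := by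
  -- By the mean value theorem the increment over `[t, t + 1]`, which tends to zero, is a value of
  -- the derivative in that interval. The hypotheses on `φ` are those which `atBot` and `atTop`
  -- share.
  have : ∀ t : ℝ, ∃ s, (t ≤ s ∧ s ≤ t + 1) ∧ f' s = f (t + 1) - f t := by
    intro t
    obtain ⟨s, hs, h⟩ := exists_hasDerivAt_eq_slope f f' (show t < t + 1 by linarith)
      (fun x _ => (hd x).continuousAt.continuousWithinAt) (fun x _ => hd x)
    exact ⟨s, ⟨hs.1.le, hs.2.le⟩, by rw [h]; simp⟩
  choose s hs hfs using this
  have e1 : Tendsto (fun t => f' (s t)) φ (𝓝 c) := hf'.comp (hb s hs)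
  have e2 : Tendsto (fun t => f (t + 1) - f t) φ (𝓝 (l - l)) := (hf.comp h1).sub hf
  rw [sub_self] at e2
  exact tendsto_nhds_unique e1 (e2.congr fun t => (hfs t).symm)

/-- The region between the graphs of `f₂` and `f₁` over `[a, b]`. -/
def lens (f₁ f₂ : ℝ → ℝ) (a b : ℝ) : Set (ℝ × ℝ) :=
  {z | z.1 ∈ Icc a b ∧ f₂ z.1 ≤ z.2 ∧ z.2 ≤ f₁ z.1}

/-- Clamping to `[a, b]`. -/
def clamp (a b x : ℝ) : ℝ := max a (min b x)

theorem clamp_mem {a b : ℝ} (h : a ≤ b) (x : ℝ) : clamp a b x ∈ Icc a b := by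
  unfold clamp; simp [h]

theorem clamp_eq {a b x : ℝ} (h : x ∈ Icc a b) : clamp a b x = x := by
  unfold clamp; simp [h.1, h.2]

/-- A retraction of the plane onto the lens. -/
def retract (f₁ f₂ : ℝ → ℝ) (a b : ℝ) (z : ℝ × ℝ) : ℝ × ℝ :=
  (clamp a b z.1, clamp (f₂ (clamp a b z.1)) (f₁ (clamp a b z.1)) z.2)

theorem retract_eq {f₁ f₂ : ℝ → ℝ} {a b : ℝ} {z : ℝ × ℝ} (hz : z ∈ lens f₁ f₂ a b) :
    retract f₁ f₂ a b z = z := by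
  obtain ⟨h1, h2⟩ := hz
  unfold retract
  rw [clamp_eq h1, clamp_eq (show z.2 ∈ Icc _ _ from h2)]

theorem retract_mem {f₁ f₂ : ℝ → ℝ} {a b : ℝ} (hab : a ≤ b) (hle : ∀ x ∈ Icc a b, f₂ x ≤ f₁ x)
    (z : ℝ × ℝ) : retract f₁ f₂ a b z ∈ lens f₁ f₂ a b :=
  ⟨clamp_mem hab _, clamp_mem (hle _ (clamp_mem hab _)) _⟩

theorem lipschitzWith_clamp (a b : ℝ) : LipschitzWith 1 (clamp a b) :=
  (LipschitzWith.id.const_min b).const_max a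

theorem exists_lipschitzWith_retract {f₁ f₂ : ℝ → ℝ} {a b : ℝ} (hab : a ≤ b) {K₁ K₂ : ℝ≥0}
    (h₁ : LipschitzOnWith K₁ f₁ (Icc a b)) (h₂ : LipschitzOnWith K₂ f₂ (Icc a b)) :
    ∃ K, LipschitzWith K (retract f₁ f₂ a b) := by
  have hc : LipschitzWith (1 * 1) (fun z : ℝ × ℝ => clamp a b z.1) :=
    (lipschitzWith_clamp a b).comp LipschitzWith.prod_fst
  have comp : ∀ {f : ℝ → ℝ} {K : ℝ≥0}, LipschitzOnWith K f (Icc a b) →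
      LipschitzWith (K * (1 * 1)) (fun z : ℝ × ℝ => f (clamp a b z.1)) := fun hf =>
    lipschitzOnWith_univ.mp
      (hf.comp hc.lipschitzOnWith fun z _ => clamp_mem hab _)
  exact ⟨_, hc.prodMk ((comp h₂).max ((comp h₁).min LipschitzWith.prod_snd))⟩

theorem hasDerivAt_fst_comp {γ : ℝ → ℝ × ℝ} {v : ℝ × ℝ} {t : ℝ} (h : HasDerivAt γ v t) :
    HasDerivAt (fun s => (γ s).1) v.1 t :=
  (ContinuousLinearMap.fst ℝ ℝ ℝ).hasFDerivAt.comp_hasDerivAt t h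

theorem hasDerivAt_snd_comp {γ : ℝ → ℝ × ℝ} {v : ℝ × ℝ} {t : ℝ} (h : HasDerivAt γ v t) :
    HasDerivAt (fun s => (γ s).2) v.2 t :=
  (ContinuousLinearMap.snd ℝ ℝ ℝ).hasFDerivAt.comp_hasDerivAt t h

theorem exists_first_nonpos {u : ℝ → ℝ} (hu : Continuous u) {t₁ t₀ : ℝ} (h1 : t₁ ≤ t₀)
    (h0 : u t₀ ≤ 0) :
    ∃ τ, t₁ ≤ τ ∧ u τ ≤ 0 ∧ ∀ t, t₁ ≤ t → t < τ → 0 < u t := by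
  have hc : IsCompact (Icc t₁ t₀ ∩ {t | u t ≤ 0}) :=
    isCompact_Icc.inter_right (isClosed_le hu continuous_const)
  obtain ⟨τ, ⟨hτ, hτu⟩, hmin⟩ := hc.exists_isLeast ⟨t₀, ⟨h1, le_rfl⟩, h0⟩
  refine ⟨τ, hτ.1, hτu, fun t ht htτ => ?_⟩
  by_contra hneg
  exact absurd (hmin ⟨⟨ht, htτ.le.trans hτ.2⟩, not_lt.mp hneg⟩) (not_le.mpr htτ)

theorem le_of_hasDerivAt_nonneg {f f' : ℝ → ℝ} (hf : ∀ t, HasDerivAt f (f' t) t) {s t : ℝ}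
    (hst : s ≤ t) (h : ∀ r, s ≤ r → r < t → 0 ≤ f' r) : f s ≤ f t := by
  refine monotoneOn_of_deriv_nonneg (convex_Icc s t)
    (fun x _ => (hf x).continuousAt.continuousWithinAt)
    (fun x _ => (hf x).differentiableAt.differentiableWithinAt) (fun x hx => ?_)
    (left_mem_Icc.2 hst) (right_mem_Icc.2 hst) hst
  rw [interior_Icc] at hx
  rw [(hf x).deriv]
  exact h x hx.1.le hx.2

/-- As the image of a rectangle under the retraction, the lens inherits compactness and
connectedness. -/
theorem lens_eq_image {f₁ f₂ : ℝ → ℝ} {a b : ℝ} (hab : a ≤ b) (a₁ : AntitoneOn f₁ (Icc a b))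
    (a₂ : AntitoneOn f₂ (Icc a b)) (hle : ∀ x ∈ Icc a b, f₂ x ≤ f₁ x) :
    lens f₁ f₂ a b = retract f₁ f₂ a b '' (Icc a b ×ˢ Icc (f₂ b) (f₁ a)) := by
  apply Subset.antisymm
  · intro z hz
    refine ⟨z, ⟨hz.1, ?_, ?_⟩, retract_eq hz⟩
    · exact (a₂ hz.1 (right_mem_Icc.2 hab) hz.1.2).trans hz.2.1
    · exact hz.2.2.trans (a₁ (left_mem_Icc.2 hab) hz.1 hz.1.1)
  · rintro _ ⟨z, -, rfl⟩
    exact retract_mem hab hle z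

theorem isCompact_lens {f₁ f₂ : ℝ → ℝ} {a b : ℝ} (hab : a ≤ b) {K₁ K₂ : ℝ≥0}
    (h₁ : LipschitzOnWith K₁ f₁ (Icc a b)) (h₂ : LipschitzOnWith K₂ f₂ (Icc a b))
    (a₁ : AntitoneOn f₁ (Icc a b)) (a₂ : AntitoneOn f₂ (Icc a b))
    (hle : ∀ x ∈ Icc a b, f₂ x ≤ f₁ x) : IsCompact (lens f₁ f₂ a b) := by
  obtain ⟨K, hK⟩ := exists_lipschitzWith_retract hab h₁ h₂
  rw [lens_eq_image hab a₁ a₂ hle]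
  exact (isCompact_Icc.prod isCompact_Icc).image hK.continuous

/-- A planar vector field on a lens between two antitone graphs which meet over `a` and `b`. The
field points to the right and downwards; it is vertical on the lower graph `f₂`, horizontal on the
upper graph `f₁`, and vanishes only at the two corners. -/
structure LensField (F : ℝ × ℝ → ℝ × ℝ) (f₁ f₂ : ℝ → ℝ) (a b : ℝ) : Prop where
  lt : a < b
  lipschitz : ∃ K, LipschitzOnWith K F (lens f₁ f₂ a b)
  upper_lipschitz : ∃ K, LipschitzOnWith K f₁ (Icc a b)
  lower_lipschitz : ∃ K, LipschitzOnWith K f₂ (Icc a b)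
  upper_antitone : AntitoneOn f₁ (Icc a b)
  lower_antitone : AntitoneOn f₂ (Icc a b)
  le : ∀ x ∈ Icc a b, f₂ x ≤ f₁ x
  left : f₂ a = f₁ a
  right : f₂ b = f₁ b
  fst_nonneg : ∀ z ∈ lens f₁ f₂ a b, 0 ≤ (F z).1
  snd_nonpos : ∀ z ∈ lens f₁ f₂ a b, (F z).2 ≤ 0
  fst_lower : ∀ x ∈ Icc a b, (F (x, f₂ x)).1 = 0
  snd_upper : ∀ x ∈ Icc a b, (F (x, f₁ x)).2 = 0
  zero : ∀ z ∈ lens f₁ f₂ a b, F z = 0 → z.1 = a ∨ z.1 = b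

namespace LensField

variable {F : ℝ × ℝ → ℝ × ℝ} {f₁ f₂ : ℝ → ℝ} {a b : ℝ}

theorem zero_left (h : LensField F f₁ f₂ a b) : F (a, f₁ a) = 0 :=
  Prod.ext (by rw [← h.left]; exact h.fst_lower a (left_mem_Icc.2 h.lt.le))
    (h.snd_upper a (left_mem_Icc.2 h.lt.le))

theorem zero_right (h : LensField F f₁ f₂ a b) : F (b, f₁ b) = 0 :=
  Prod.ext (by rw [← h.right]; exact h.fst_lower b (right_mem_Icc.2 h.lt.le))
    (h.snd_upper b (right_mem_Icc.2 h.lt.le))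

theorem isCompact (h : LensField F f₁ f₂ a b) : IsCompact (lens f₁ f₂ a b) := by
  obtain ⟨K₁, h₁⟩ := h.upper_lipschitz
  obtain ⟨K₂, h₂⟩ := h.lower_lipschitz
  exact isCompact_lens h.lt.le h₁ h₂ h.upper_antitone h.lower_antitone h.le

theorem isPreconnected (h : LensField F f₁ f₂ a b) : IsPreconnected (lens f₁ f₂ a b) := by
  obtain ⟨K₁, h₁⟩ := h.upper_lipschitz
  obtain ⟨K₂, h₂⟩ := h.lower_lipschitz
  obtain ⟨K, hK⟩ := exists_lipschitzWith_retract h.lt.le h₁ h₂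
  rw [lens_eq_image h.lt.le h.upper_antitone h.lower_antitone h.le]
  exact (isPreconnected_Icc.prod isPreconnected_Icc).image _ hK.continuous.continuousOn

/-- The graphs meet over `a`, so everything to the left is retracted onto the corner, an
equilibrium. The extended field thus vanishes there, and no orbit can leave through the sides. -/
theorem retract_of_lt (h : LensField F f₁ f₂ a b) {z : ℝ × ℝ} (hz : z.1 < a) :
    F (retract f₁ f₂ a b z) = 0 := by
  have h1 : clamp a b z.1 = a := by
    unfold clamp; simp [hz.le]
  unfold retract
  rw [h1, h.left]
  have : clamp (f₁ a) (f₁ a) z.2 = f₁ a := by unfold clamp; simp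
  rw [this, h.zero_left]

theorem retract_of_gt (h : LensField F f₁ f₂ a b) {z : ℝ × ℝ} (hz : b < z.1) :
    F (retract f₁ f₂ a b z) = 0 := by
  have h1 : clamp a b z.1 = b := by
    unfold clamp; rw [min_eq_left hz.le, max_eq_right h.lt.le]
  unfold retract
  rw [h1, h.right]
  have : clamp (f₁ b) (f₁ b) z.2 = f₁ b := by unfold clamp; simp
  rw [this, h.zero_right]

/-- The lens is invariant under the backward flow. -/
theorem mem_of_nonpos (h : LensField F f₁ f₂ a b) {γ : ℝ → ℝ × ℝ} {K : ℝ≥0}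
    (hK : LipschitzWith K fun z => F (retract f₁ f₂ a b z))
    (hγ : ∀ t, HasDerivAt γ (F (retract f₁ f₂ a b (γ t))) t) (h0 : γ 0 ∈ lens f₁ f₂ a b)
    {t : ℝ} (ht : t ≤ 0) : γ t ∈ lens f₁ f₂ a b := by
  -- Uniqueness: an orbit which meets a zero of the extended field is constant.
  have stat : ∀ s, F (retract f₁ f₂ a b (γ s)) = 0 → γ 0 = γ s := fun s hs =>
    congrFun (ODE_solution_unique_univ (v := fun _ z => F (retract f₁ f₂ a b z))
      (s := fun _ => univ) (K := K) (t₀ := s) (f := γ) (g := fun _ => γ s)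
      (fun _ => hK.lipschitzOnWith) (fun t => ⟨hγ t, trivial⟩)
      (fun t => ⟨by rw [hs]; exact hasDerivAt_const _ _, trivial⟩) rfl) 0
  have hx : ∀ s, (γ s).1 ∈ Icc a b := by
    intro s
    constructor
    · by_contra hlt
      have := stat s (h.retract_of_lt (not_le.mp hlt))
      rw [← this] at hlt
      exact hlt h0.1.1
    · by_contra hlt
      have := stat s (h.retract_of_gt (not_le.mp hlt))
      rw [← this] at hlt
      exact hlt h0.1.2
  have hcont : Continuous γ := continuous_iff_continuousAt.2 fun s => (hγ s).continuousAt
  have hx' : ∀ s, HasDerivAt (fun s => (γ s).1) (F (retract f₁ f₂ a b (γ s))).1 s := fun s =>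
    hasDerivAt_fst_comp (hγ s)
  have hy' : ∀ s, HasDerivAt (fun s => (γ s).2) (F (retract f₁ f₂ a b (γ s))).2 s := fun s =>
    hasDerivAt_snd_comp (hγ s)
  have hcf : ∀ f : ℝ → ℝ, (∃ K, LipschitzOnWith K f (Icc a b)) → Continuous fun s => f (γ s).1 := by
    rintro f ⟨K', hf⟩
    exact hf.continuousOn.comp_continuous (continuous_fst.comp hcont) hx
  have hr : ∀ s, clamp a b (γ s).1 = (γ s).1 := fun s => clamp_eq (hx s)
  refine ⟨hx t, ?_, ?_⟩
  · by_contra hneg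
    -- Below the lens the extended field is that of the lower graph, hence vertical and downward: up
    -- to the first return time `τ` the abscissa does not increase and the ordinate does not either,
    -- while `f₂` is antitone. So the orbit is still below at `τ`.
    obtain ⟨τ, htτ, hτ, hpos⟩ := exists_first_nonpos (u := fun s => f₂ (γ s).1 - (γ s).2)
      ((hcf f₂ h.lower_lipschitz).sub (continuous_snd.comp hcont)) ht (sub_nonpos.2 h0.2.1)
    have hval : ∀ s, t ≤ s → s < τ → retract f₁ f₂ a b (γ s) = ((γ s).1, f₂ (γ s).1) := by
      intro s hs hsτ
      have h1 : (γ s).2 ≤ f₂ (γ s).1 := by linarith [hpos s hs hsτ]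
      unfold retract
      rw [hr]
      unfold clamp
      rw [max_eq_left ((min_le_right _ _).trans h1)]
    have e1 : (γ τ).1 ≤ (γ t).1 := by
      have := le_of_hasDerivAt_nonneg (fun s => (hx' s).neg) htτ (fun s hs hsτ => by
        rw [hval s hs hsτ, h.fst_lower _ (hx s)]; simp)
      simpa using this
    have e2 : (γ τ).2 ≤ (γ t).2 := by
      have := le_of_hasDerivAt_nonneg (fun s => (hy' s).neg) htτ (fun s hs hsτ => by
        have := h.snd_nonpos _ (retract_mem h.lt.le h.le (γ s)); linarith)
      simpa using this
    have e3 := h.lower_antitone (hx τ) (hx t) e1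
    linarith
  · by_contra hneg
    -- Above the lens the extended field is horizontal and points to the right, where `f₁` is no
    -- higher; again the orbit cannot return.
    obtain ⟨τ, htτ, hτ, hpos⟩ := exists_first_nonpos (u := fun s => (γ s).2 - f₁ (γ s).1)
      ((continuous_snd.comp hcont).sub (hcf f₁ h.upper_lipschitz)) ht (sub_nonpos.2 h0.2.2)
    have hval : ∀ s, t ≤ s → s < τ → retract f₁ f₂ a b (γ s) = ((γ s).1, f₁ (γ s).1) := by
      intro s hs hsτ
      have h1 : f₁ (γ s).1 ≤ (γ s).2 := by linarith [hpos s hs hsτ]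
      unfold retract
      rw [hr]
      unfold clamp
      rw [min_eq_left h1, max_eq_right (h.le _ (hx s))]
    have e1 : (γ t).1 ≤ (γ τ).1 :=
      le_of_hasDerivAt_nonneg hx' htτ (fun s hs hsτ =>
        h.fst_nonneg _ (retract_mem h.lt.le h.le (γ s)))
    have e2 : (γ t).2 ≤ (γ τ).2 :=
      le_of_hasDerivAt_nonneg hy' htτ (fun s hs hsτ => by
        rw [hval s hs hsτ, h.snd_upper _ (hx s)])
    have e3 := h.upper_antitone (hx t) (hx τ) e1
    linarith

/-- The flow of a lens field has an entire orbit which stays in the lens and crosses a given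
vertical line. -/
theorem exists_entire_orbit (h : LensField F f₁ f₂ a b) {m : ℝ} (hm : m ∈ Icc a b) :
    ∃ γ : ℝ → ℝ × ℝ, (∀ t, HasDerivAt γ (F (γ t)) t) ∧ (∀ t, γ t ∈ lens f₁ f₂ a b) ∧
      (γ 0).1 = m := by
  obtain ⟨K₁, h₁⟩ := h.upper_lipschitz
  obtain ⟨K₂, h₂⟩ := h.lower_lipschitz
  obtain ⟨KF, hF⟩ := h.lipschitz
  obtain ⟨Kr, hKr⟩ := exists_lipschitzWith_retract h.lt.le h₁ h₂
  have hret := retract_mem h.lt.le h.le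
  have hK : LipschitzWith (KF * Kr) fun z => F (retract f₁ f₂ a b z) :=
    lipschitzOnWith_univ.mp (hF.comp hKr.lipschitzOnWith fun z _ => hret z)
  obtain ⟨M, hM⟩ := h.isCompact.exists_bound_of_continuousOn hF.continuousOn
  have hM' : ∀ z, ‖F (retract f₁ f₂ a b z)‖ ≤ M.toNNReal := fun z =>
    (hM _ (hret z)).trans (Real.le_coe_toNNReal M)
  obtain ⟨Φ, hΦ0, hΦ⟩ := exists_flow hK hM'
  have huniq : ∀ {γ δ : ℝ → ℝ × ℝ} (t₀ : ℝ), (∀ t, HasDerivAt γ (F (retract f₁ f₂ a b (γ t))) t) →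
      (∀ t, HasDerivAt δ (F (retract f₁ f₂ a b (δ t))) t) → γ t₀ = δ t₀ → γ = δ :=
    fun t₀ hγ hδ heq => ODE_solution_unique_univ (v := fun _ z => F (retract f₁ f₂ a b z))
      (s := fun _ => univ) (K := KF * Kr) (t₀ := t₀)
      (fun _ => hK.lipschitzOnWith) (fun t => ⟨hγ t, trivial⟩) (fun t => ⟨hδ t, trivial⟩) heq
  have hadd : ∀ z s t, Φ (Φ z s) t = Φ z (t + s) := by
    intro z s t
    refine congrFun (huniq (γ := Φ (Φ z s)) (δ := fun t => Φ z (t + s)) 0 (hΦ _) (fun t => ?_)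
      (by simp [hΦ0])) t
    exact (hΦ z (t + s)).comp_add_const t s
  have hinv : ∀ z ∈ lens f₁ f₂ a b, ∀ t ≤ 0, Φ z t ∈ lens f₁ f₂ a b := fun z hz t ht =>
    h.mem_of_nonpos hK (hΦ z) (by rwa [hΦ0]) ht
  -- Continuous dependence on the initial point, from Grönwall's inequality for the time-reversed
  -- equation; only backward times are needed.
  have hcont : ∀ t ≤ (0 : ℝ), Continuous fun z => Φ z t := by
    intro t ht
    have hL : LipschitzWith (Real.exp ((KF * Kr : ℝ≥0) * -t)).toNNReal fun z => Φ z t := by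
      refine LipschitzWith.of_dist_le_mul fun z w => ?_
      have hrev : ∀ z s, HasDerivAt (fun s => Φ z (-s)) (-(F (retract f₁ f₂ a b (Φ z (-s))))) s := by
        intro z s
        have := HasDerivAt.scomp s (hΦ z (-s)) (hasDerivAt_neg s)
        rwa [neg_one_smul] at this
      have := dist_le_of_trajectories_ODE (v := fun _ z => -(F (retract f₁ f₂ a b z)))
        (K := KF * Kr) (f := fun s => Φ z (-s)) (g := fun s => Φ w (-s)) (a := 0) (b := -t)
        (δ := dist z w) (fun _ => hK.neg)
        (fun s _ => (hrev z s).continuousAt.continuousWithinAt)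
        (fun s _ => (hrev z s).hasDerivWithinAt)
        (fun s _ => (hrev w s).continuousAt.continuousWithinAt)
        (fun s _ => (hrev w s).hasDerivWithinAt) (by simp [hΦ0]) (-t) ⟨by linarith, le_rfl⟩
      rw [Real.coe_toNNReal _ (Real.exp_pos _).le, mul_comm]
      simpa using this
    exact hL.continuous
  have hfix : ∀ z, F (retract f₁ f₂ a b z) = 0 → ∀ t, Φ z t = z := fun z hz t =>
    congrFun (huniq (γ := Φ z) (δ := fun _ => z) 0 (hΦ z)
      (fun t => by rw [hz]; exact hasDerivAt_const _ _) (hΦ0 z)) t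
  have hamem : (a, f₁ a) ∈ lens f₁ f₂ a b := ⟨left_mem_Icc.2 h.lt.le, h.left.le, le_rfl⟩
  have hbmem : (b, f₁ b) ∈ lens f₁ f₂ a b := ⟨right_mem_Icc.2 h.lt.le, h.right.le, le_rfl⟩
  -- A point of the `n`-th set lies on the line over `m` and its orbit is in the lens up to time
  -- `n`. Backward invariance makes these compact sets decrease. None is empty: the backward image
  -- of the lens is connected and contains both corners, which are fixed. A common point has the
  -- required orbit.
  let A : ℕ → Set (ℝ × ℝ) := fun n =>
    ((fun z => Φ z (-(n : ℝ))) '' lens f₁ f₂ a b) ∩ {z | z.1 = m}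
  have hcomp : ∀ n, IsCompact (A n) := fun n =>
    (h.isCompact.image (hcont _ (by simp))).inter_right
      (isClosed_eq continuous_fst continuous_const)
  obtain ⟨z, hz⟩ : (⋂ n, A n).Nonempty := by
    refine IsCompact.nonempty_iInter_of_sequence_nonempty_isCompact_isClosed A ?_ ?_ (hcomp 0)
      fun n => (hcomp n).isClosed
    · rintro n _ ⟨⟨w, hw, rfl⟩, hwm⟩
      refine ⟨⟨Φ w (-1), hinv w hw _ (by norm_num), ?_⟩, hwm⟩
      simp only [hadd]
      congr 1
      push_cast
      ring
    · intro n
      have hc : ContinuousOn (fun z => (Φ z (-(n : ℝ))).1) (lens f₁ f₂ a b) :=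
        (continuous_fst.comp (hcont _ (by simp))).continuousOn
      have := h.isPreconnected.intermediate_value hamem hbmem hc
      rw [hfix _ (by rw [retract_eq hamem, h.zero_left]),
        hfix _ (by rw [retract_eq hbmem, h.zero_right])] at this
      obtain ⟨w, hw, hwm⟩ := this hm
      exact ⟨_, ⟨w, hw, rfl⟩, hwm⟩
  rw [mem_iInter] at hz
  have hmem : ∀ t, Φ z t ∈ lens f₁ f₂ a b := by
    intro t
    obtain ⟨w, hw, hwz⟩ := (hz ⌈t⌉₊).1
    rw [← hwz]
    simp only [hadd]
    exact hinv w hw _ (by linarith [Nat.le_ceil t])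
  refine ⟨Φ z, fun t => ?_, hmem, ?_⟩
  · have := hΦ z t
    rwa [retract_eq (hmem t)] at this
  · rw [hΦ0]; exact (hz 0).2

/-- A lens field has an orbit which connects the two corners of the lens. -/
theorem exists_heteroclinic (h : LensField F f₁ f₂ a b) :
    ∃ γ : ℝ → ℝ × ℝ, (∀ t, HasDerivAt γ (F (γ t)) t) ∧ (∀ t, γ t ∈ lens f₁ f₂ a b) ∧
      Tendsto γ atBot (𝓝 (a, f₁ a)) ∧ Tendsto γ atTop (𝓝 (b, f₁ b)) := by
  have hab := h.lt
  obtain ⟨γ, hγ, hmem, hm⟩ := h.exists_entire_orbit (m := (a + b) / 2)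
    ⟨by linarith, by linarith⟩
  have hx' : ∀ s, HasDerivAt (fun s => (γ s).1) (F (γ s)).1 s := fun s =>
    hasDerivAt_fst_comp (hγ s)
  have hy' : ∀ s, HasDerivAt (fun s => (γ s).2) (F (γ s)).2 s := fun s =>
    hasDerivAt_snd_comp (hγ s)
  have hxm : Monotone fun s => (γ s).1 := fun s t hst =>
    le_of_hasDerivAt_nonneg hx' hst fun r _ _ => h.fst_nonneg _ (hmem r)
  have hym : Antitone fun s => (γ s).2 := fun s t hst => by
    have := le_of_hasDerivAt_nonneg (fun s => (hy' s).neg) hst fun r _ _ =>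
      neg_nonneg.2 (h.snd_nonpos _ (hmem r))
    simpa using this
  have hyl : ∀ t, f₂ b ≤ (γ t).2 := fun t =>
    (h.lower_antitone (hmem t).1 (right_mem_Icc.2 hab.le) (hmem t).1.2).trans (hmem t).2.1
  have hyu : ∀ t, (γ t).2 ≤ f₁ a := fun t =>
    (hmem t).2.2.trans (h.upper_antitone (left_mem_Icc.2 hab.le) (hmem t).1 (hmem t).1.1)
  obtain ⟨KF, hF⟩ := h.lipschitz
  -- A limit of the orbit at either end is a zero of the field, hence a corner. Monotonicity and the
  -- passage through the midpoint of `[a, b]` decide below which corner it is.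
  have equilibrium : ∀ {φ : Filter ℝ} [NeBot φ] {z : ℝ × ℝ}, Tendsto γ φ (𝓝 z) →
      Tendsto (fun t : ℝ => t + 1) φ φ →
      (∀ s : ℝ → ℝ, (∀ t, t ≤ s t ∧ s t ≤ t + 1) → Tendsto s φ φ) →
      z = (a, f₁ a) ∨ z = (b, f₁ b) := by
    intro φ _ z hz h1 hb
    have hzm : z ∈ lens f₁ f₂ a b :=
      h.isCompact.isClosed.mem_of_tendsto hz (Eventually.of_forall hmem)
    have hFz : Tendsto (fun t => F (γ t)) φ (𝓝 (F z)) :=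
      (hF.continuousOn z hzm).tendsto.comp
        (tendsto_nhdsWithin_iff.2 ⟨hz, Eventually.of_forall hmem⟩)
    have e1 := eq_zero_of_tendsto_deriv hx' ((continuous_fst.tendsto z).comp hz)
      ((continuous_fst.tendsto _).comp hFz) h1 hb
    have e2 := eq_zero_of_tendsto_deriv hy' ((continuous_snd.tendsto z).comp hz)
      ((continuous_snd.tendsto _).comp hFz) h1 hb
    rcases h.zero z hzm (Prod.ext e1 e2) with hza | hzb
    · left
      have := hzm.2
      rw [hza, h.left] at this
      exact Prod.ext hza (le_antisymm this.2 this.1)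
    · right
      have := hzm.2
      rw [hzb, h.right] at this
      exact Prod.ext hzb (le_antisymm this.2 this.1)
  refine ⟨γ, hγ, hmem, ?_, ?_⟩
  · have t1 := tendsto_atBot_ciInf hxm ⟨a, by rintro _ ⟨t, rfl⟩; exact (hmem t).1.1⟩
    have t2 := tendsto_atBot_ciSup hym ⟨f₁ a, by rintro _ ⟨t, rfl⟩; exact hyu t⟩
    have t3 := t1.prodMk_nhds t2
    rcases equilibrium t3 (tendsto_atBot_add_const_right _ _ tendsto_id) (fun s hs =>
      tendsto_atBot_mono (fun t => (hs t).2) (tendsto_atBot_add_const_right _ _ tendsto_id)) with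
      e | e
    · rwa [← e]
    · exfalso
      have := ciInf_le ⟨a, by rintro _ ⟨t, rfl⟩; exact (hmem t).1.1⟩ (0 : ℝ)
        (f := fun s => (γ s).1)
      have e' := congrArg Prod.fst e
      simp only at e' this
      rw [e', hm] at this
      linarith
  · have t1 := tendsto_atTop_ciSup hxm ⟨b, by rintro _ ⟨t, rfl⟩; exact (hmem t).1.2⟩
    have t2 := tendsto_atTop_ciInf hym ⟨f₂ b, by rintro _ ⟨t, rfl⟩; exact hyl t⟩
    have t3 := t1.prodMk_nhds t2
    rcases equilibrium t3 (tendsto_atTop_add_const_right _ _ tendsto_id) (fun s hs =>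
      tendsto_atTop_mono (fun t => (hs t).1) tendsto_id) with e | e
    · exfalso
      have := le_ciSup (f := fun s => (γ s).1) ⟨b, by rintro _ ⟨t, rfl⟩; exact (hmem t).1.2⟩
        (0 : ℝ)
      have e' := congrArg Prod.fst e
      simp only at e' this
      rw [e', hm] at this
      linarith
    · rwa [← e]

end LensField

/-- An integral curve of a smooth vector field is smooth. -/
theorem contDiff_of_hasDerivAt {E : Type*} [NormedAddCommGroup E] [NormedSpace ℝ E] {F : E → E}
    {s : Set E} (hF : ContDiffOn ℝ ∞ F s) {γ : ℝ → E} (hγ : ∀ t, HasDerivAt γ (F (γ t)) t)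
    (hs : ∀ t, γ t ∈ s) : ContDiff ℝ ∞ γ := by
  rw [contDiff_infty]
  intro n
  induction n with
  | zero => exact contDiff_zero.2 (continuous_iff_continuousAt.2 fun t => (hγ t).continuousAt)
  | succ n ih =>
    have : deriv γ = fun t => F (γ t) := funext fun t => (hγ t).deriv
    push_cast
    rw [contDiff_succ_iff_deriv]
    refine ⟨fun t => (hγ t).differentiableAt, by simp, ?_⟩
    rw [this]
    exact contDiffOn_univ.1
      ((hF.of_le (by exact_mod_cast le_top)).comp ih.contDiffOn fun t _ => hs t)

end PlanarFlow

/-! ### The symbol of the Euler equations and its determinant -/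

namespace RelFluid

open Set

theorem flipIndex_apply (v : Vec4) (α : Fin 4) : flipIndex v α = metric α α * v α := by
  unfold flipIndex metric
  rw [Matrix.mulVec_diagonal, Matrix.diagonal_apply_eq]

theorem flipIndex_zero (v : Vec4) : flipIndex v 0 = -v 0 := by
  simp [flipIndex_apply, metric]

theorem flipIndex_one (v : Vec4) : flipIndex v 1 = v 1 := by
  simp [flipIndex_apply, metric]

theorem flipIndex_two (v : Vec4) : flipIndex v 2 = v 2 := by
  simp [flipIndex_apply, metric]

theorem flipIndex_three (v : Vec4) : flipIndex v 3 = v 3 := by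
  simp [flipIndex_apply, metric]

theorem lorentz_eq (v w : Vec4) :
    lorentz v w = -(v 0 * w 0) + v 1 * w 1 + v 2 * w 2 + v 3 * w 3 := by
  simp [lorentz, dotProduct, Fin.sum_univ_four, flipIndex_zero, flipIndex_one, flipIndex_two,
    flipIndex_three]

theorem dotProduct_eq (v w : Vec4) : v ⬝ᵥ w = v 0 * w 0 + v 1 * w 1 + v 2 * w 2 + v 3 * w 3 := by
  simp [dotProduct, Fin.sum_univ_four]

theorem metric_mul_self (α : Fin 4) : metric α α * metric α α = 1 := by
  fin_cases α <;> simp [metric]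

/-- The linear form `w ↦ v^α w_α`. -/
def lorentzForm (v : Vec4) : Vec4 →L[ℝ] ℝ :=
  ∑ β, flipIndex v β • ContinuousLinearMap.proj (R := ℝ) (φ := fun _ : Fin 4 => ℝ) β

theorem lorentzForm_apply (v w : Vec4) : lorentzForm v w = lorentz v w := by
  simp [lorentzForm, Fin.sum_univ_four, lorentz_eq, flipIndex_zero, flipIndex_one, flipIndex_two,
    flipIndex_three]

theorem lorentz_single (v : Vec4) (γ : Fin 4) :
    lorentz v (Pi.single γ 1) = metric γ γ * v γ := by
  rw [← flipIndex_apply, lorentz_eq]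
  fin_cases γ <;> simp [flipIndex_zero, flipIndex_one, flipIndex_two, flipIndex_three]

theorem hasFDerivAt_coord (α : Fin 4) (ψ : Vec4) :
    HasFDerivAt (fun φ : Vec4 => φ α)
      (ContinuousLinearMap.proj (R := ℝ) (φ := fun _ : Fin 4 => ℝ) α) ψ :=
  hasFDerivAt_apply α ψ

theorem hasFDerivAt_lorentz_self (ψ : Vec4) :
    HasFDerivAt (fun φ => lorentz φ φ) ((2 : ℝ) • lorentzForm ψ) ψ := by
  have hc := fun α => hasFDerivAt_coord α ψ
  have := (((((hc 0).mul (hc 0)).neg).add ((hc 1).mul (hc 1))).add ((hc 2).mul (hc 2))).add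
    ((hc 3).mul (hc 3))
  refine (this.congr_of_eventuallyEq (Eventually.of_forall fun φ => ?_)).congr_fderiv ?_
  · simp [lorentz_eq]
  · ext w
    simp [lorentzForm_apply, lorentz_eq]
    ring

theorem temperature_pos {ψ : Vec4} (h : ψ ∈ stateSpace) : 0 < temperature ψ :=
  inv_pos.2 (Real.sqrt_pos.2 (neg_pos.2 h.1))

theorem temperature_sq {ψ : Vec4} (h : ψ ∈ stateSpace) :
    temperature ψ ^ 2 * lorentz ψ ψ = -1 := by
  have h1 := h.1
  unfold temperature
  rw [inv_pow, Real.sq_sqrt (by linarith)]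
  have := h1.ne
  field_simp

theorem hasFDerivAt_temperature {ψ : Vec4} (h : ψ ∈ stateSpace) :
    HasFDerivAt temperature (temperature ψ ^ 3 • lorentzForm ψ) ψ := by
  have h1 : 0 < -lorentz ψ ψ := neg_pos.2 h.1
  have h2 := (hasDerivAt_inv (Real.sqrt_pos.2 h1).ne').comp_hasFDerivAt ψ
    ((hasFDerivAt_lorentz_self ψ).neg.sqrt h1.ne')
  refine (h2.congr_of_eventuallyEq (Eventually.of_forall fun φ => ?_)).congr_fderiv ?_
  · simp [temperature]
  · have h3 := (Real.sqrt_pos.2 h1).ne'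
    ext w
    simp [temperature, lorentzForm_apply]
    field_simp

theorem hasDerivAt_of_contDiffOn {f : ℝ → ℝ} (hf : ContDiffOn ℝ ∞ f (Ioi 0)) {θ : ℝ} (hθ : 0 < θ) :
    HasDerivAt f (deriv f θ) θ :=
  ((hf.differentiableOn (by simp)).differentiableAt (Ioi_mem_nhds hθ)).hasDerivAt

theorem contDiffOn_deriv {f : ℝ → ℝ} (hf : ContDiffOn ℝ ∞ f (Ioi 0)) :
    ContDiffOn ℝ ∞ (deriv f) (Ioi 0) :=
  hf.deriv_of_isOpen isOpen_Ioi (by simp)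

variable {p : ℝ → ℝ}

/-- Chain rule with `∂θ/∂ψ_γ = θ³ ψ^γ`. The result is symmetric in all three indices, since `T^{αβ}`
is itself a derivative of `p ψ^β`. -/
theorem dT_eq (hp : ContDiffOn ℝ ∞ p (Ioi 0)) {ψ : Vec4} (h : ψ ∈ stateSpace) (α β γ : Fin 4) :
    dT p ψ α β γ =
      (3 * temperature ψ ^ 2 * deriv p (temperature ψ)
          + temperature ψ ^ 3 * deriv (deriv p) (temperature ψ)) * temperature ψ ^ 3
        * (ψ γ * ψ α * ψ β)
      + temperature ψ ^ 3 * deriv p (temperature ψ)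
        * (metric α γ * ψ β + ψ α * metric β γ + ψ γ * metric α β) := by
  have hθ := temperature_pos h
  have hT := hasFDerivAt_temperature h
  have hp1 := (hasDerivAt_of_contDiffOn hp hθ).comp_hasFDerivAt ψ hT
  have hk := (((hasDerivAt_pow 3 (temperature ψ)).mul
    (hasDerivAt_of_contDiffOn (contDiffOn_deriv hp) hθ))).comp_hasFDerivAt ψ hT
  have hc := fun α => hasFDerivAt_coord α ψ
  have hT' := (((hk.mul (hc α)).mul (hc β))).add (hp1.mul_const (metric α β))
  have hfd := (hT'.congr_of_eventuallyEq (f₁ := fun φ : Vec4 => idealT p φ α β)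
    (Eventually.of_forall fun φ => by simp [idealT])).fderiv
  unfold dT
  rw [hfd]
  have hs : ∀ α γ : Fin 4, metric γ γ * (Pi.single γ (1 : ℝ) : Vec4) α = metric α γ := by
    intro α γ
    by_cases hαγ : α = γ
    · subst hαγ; simp
    · simp [hαγ, metric]
  have hm := metric_mul_self γ
  simp [lorentzForm_apply, lorentz_single]
  rw [← hs α γ, ← hs β γ]
  linear_combination (temperature ψ ^ 3 * deriv p (temperature ψ) * ψ γ * metric α β
   + (3 * temperature ψ ^ 2 * deriv p (temperature ψ)
          + temperature ψ ^ 3 * deriv (deriv p) (temperature ψ)) * temperature ψ ^ 3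
        * (ψ γ * ψ α * ψ β)) * hm

theorem symbol_apply (hp : ContDiffOn ℝ ∞ p (Ioi 0)) {ψ : Vec4} (h : ψ ∈ stateSpace) (N : Vec4)
    (α γ : Fin 4) :
    symbol p N ψ α γ =
      (3 * temperature ψ ^ 2 * deriv p (temperature ψ)
          + temperature ψ ^ 3 * deriv (deriv p) (temperature ψ)) * temperature ψ ^ 3 * (N ⬝ᵥ ψ)
        * (ψ α * ψ γ)
      + temperature ψ ^ 3 * deriv p (temperature ψ)
        * (metric α γ * (N ⬝ᵥ ψ) + ψ α * flipIndex N γ + ψ γ * flipIndex N α) := by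
  have e1 : flipIndex N γ = ∑ β, N β * metric β γ := by
    rw [flipIndex_apply, Finset.sum_eq_single γ]
    · ring
    · intro β _ hβ; simp [metric, hβ]
    · simp
  have e2 : flipIndex N α = ∑ β, N β * metric α β := by
    rw [flipIndex_apply, Finset.sum_eq_single α]
    · ring
    · intro β _ hβ; simp [metric, hβ.symm]
    · simp
  rw [e1, e2, symbol, Matrix.of_apply]
  simp only [dT_eq hp h, dotProduct, Fin.sum_univ_four]
  ring

/-- `M` is `D` times the metric plus a form which involves only `u` and `v`. The directions
transversal to their plane contribute `D²`, the metric contributes the sign, and the bracket is a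
determinant of size two. -/
theorem det_four (M : Matrix (Fin 4) (Fin 4) ℝ) (A D E : ℝ) (u v : Vec4)
    (hM : ∀ α γ, M α γ = A * (u α * u γ) + D * metric α γ + E * (u α * v γ + u γ * v α)) :
    M.det = -D ^ 2 * ((D + A * lorentz u u + E * lorentz u v) * (D + E * lorentz u v)
      - E * lorentz u u * (A * lorentz u v + E * lorentz v v)) := by
  have m00 : metric 0 0 = -1 := by simp [metric]
  have m11 : metric 1 1 = 1 := by simp [metric]
  have m22 : metric 2 2 = 1 := by simp [metric]
  have m33 : metric 3 3 = 1 := by simp [metric]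
  have mo : ∀ i j : Fin 4, i ≠ j → metric i j = 0 := fun i j hij => by simp [metric, hij]
  rw [lorentz_eq, lorentz_eq, lorentz_eq, Matrix.det_succ_row_zero]
  simp only [Fin.sum_univ_four, Matrix.det_fin_three, Matrix.submatrix_apply, hM]
  simp [Fin.succAbove, Fin.lt_def, m00, m11, m22, m33, mo]
  ring

/-- The factor of `det (N_β ∂T^{αβ}/∂ψ_γ)` which vanishes at the acoustic characteristic
covectors `N`. -/
def acousticForm (p : ℝ → ℝ) (N ψ : Vec4) : ℝ :=
  temperature ψ ^ 3 * deriv (deriv p) (temperature ψ) * (N ⬝ᵥ ψ) ^ 2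
    - deriv p (temperature ψ) * (temperature ψ ^ 2 * (N ⬝ᵥ ψ) ^ 2 + lorentz N N)

theorem lorentz_flipIndex (v w : Vec4) : lorentz v (flipIndex w) = w ⬝ᵥ v := by
  rw [lorentz_eq, flipIndex_zero, flipIndex_one, flipIndex_two, flipIndex_three, dotProduct_eq]
  ring

theorem lorentz_flipIndex_self (v : Vec4) : lorentz (flipIndex v) (flipIndex v) = lorentz v v := by
  rw [lorentz_eq, flipIndex_zero, flipIndex_one, flipIndex_two, flipIndex_three, lorentz_eq]
  ring

/-- The factor `(N ⬝ᵥ ψ)²` belongs to the two modes which travel with the fluid; `acousticForm` is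
the equation of the sound cone. -/
theorem det_symbol (hp : ContDiffOn ℝ ∞ p (Ioi 0)) {ψ : Vec4} (h : ψ ∈ stateSpace) (N : Vec4) :
    (symbol p N ψ).det = temperature ψ ^ 10 * deriv p (temperature ψ) ^ 3 * (N ⬝ᵥ ψ) ^ 2
      * acousticForm p N ψ := by
  have hd := det_four (symbol p N ψ)
    ((3 * temperature ψ ^ 2 * deriv p (temperature ψ)
          + temperature ψ ^ 3 * deriv (deriv p) (temperature ψ)) * temperature ψ ^ 3 * (N ⬝ᵥ ψ))
    (temperature ψ ^ 3 * deriv p (temperature ψ) * (N ⬝ᵥ ψ))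
    (temperature ψ ^ 3 * deriv p (temperature ψ)) ψ (flipIndex N)
    (fun α γ => by rw [symbol_apply hp h]; ring)
  rw [hd, lorentz_flipIndex, lorentz_flipIndex_self, acousticForm]
  have hs := temperature_sq h
  have hs' : temperature ψ ^ 2 * lorentz ψ ψ + 1 = 0 := by linarith
  generalize temperature ψ = θ at *
  generalize N ⬝ᵥ ψ = m at *
  generalize lorentz N N = l at *
  generalize lorentz ψ ψ = L at *
  generalize deriv p θ = p1
  generalize deriv (deriv p) θ = p2
  linear_combination
    (-(θ ^ 3 * p1 * m) ^ 2 * (θ ^ 3 * p1) * (θ * ((3 * θ ^ 2 * p1 + θ ^ 3 * p2) * m ^ 2 - p1 * l)))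
     * hs'

/-! ### Causality and genuine nonlinearity in terms of the pressure -/

/-- The state of temperature `θ` at rest. -/
def restState (θ : ℝ) : Vec4 := ![θ⁻¹, 0, 0, 0]

theorem restState_mem {θ : ℝ} (hθ : 0 < θ) : restState θ ∈ stateSpace := by
  have := inv_pos.2 hθ
  constructor
  · rw [lorentz_eq]; simp [restState]; positivity
  · simpa [restState] using hθ

theorem temperature_restState {θ : ℝ} (hθ : 0 < θ) : temperature (restState θ) = θ := by
  unfold temperature
  rw [lorentz_eq]
  simp only [restState, Matrix.cons_val_zero, Matrix.cons_val_one, Matrix.cons_val]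
  rw [show -(-(θ⁻¹ * θ⁻¹) + 0 * 0 + 0 * 0 + 0 * 0) = θ⁻¹ * θ⁻¹ by ring,
    Real.sqrt_mul_self (inv_pos.2 hθ).le, inv_inv]

/-- Strict causality means `0 < p' < θ p''`, that is, `0 < c_s² < 1`. -/
theorem StrictlyCausal.deriv_bounds (hc : StrictlyCausal p) (hp : ContDiffOn ℝ ∞ p (Ioi 0)) {θ : ℝ}
    (hθ : 0 < θ) : 0 < deriv p θ ∧ deriv p θ < θ * deriv (deriv p) θ := by
  have hmem := restState_mem hθ
  have hT := temperature_restState hθ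
  have key : ∀ T w : Vec4, w ⬝ᵥ (symbol p T (restState θ) *ᵥ w) =
      ∑ α, ∑ γ, w α * symbol p T (restState θ) α γ * w γ := by
    intro T w
    simp [Matrix.mulVec, dotProduct, Finset.mul_sum, mul_assoc]
  have m11 : metric 1 1 = 1 := by simp [metric]
  have m00 : metric 0 0 = -1 := by simp [metric]
  have m01 : metric 0 1 = 0 := by simp [metric]
  have m10 : metric 1 0 = 0 := by simp [metric]
  constructor
  -- Along the time direction, a spatial vector isolates the entry `-θ² p'`.
  · have h := hc _ hmem ![-1, 0, 0, 0] (by rw [lorentz_eq]; simp) (by rw [flipIndex_zero]; simp)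
      ![0, 1, 0, 0] (fun h => by simpa using congrFun h 1)
    rw [key] at h
    simp only [symbol_apply hp hmem, hT, Fin.sum_univ_four, dotProduct_eq] at h
    simp [restState, m11, m00, m01, m10, flipIndex_zero, flipIndex_one] at h
    have : θ ^ 3 * deriv p θ * θ⁻¹ = θ ^ 2 * deriv p θ := by field_simp
    rw [this] at h
    exact (pos_iff_pos_of_mul_pos h).1 (by positivity)
  -- A null covector is the extreme case of causality; on this vector the form equals `θ² (p' - θ
  -- p'')`.
  · have h := hc _ hmem ![-1, 1, 0, 0] (by rw [lorentz_eq]; simp) (by rw [flipIndex_zero]; simp)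
      ![1, 1, 0, 0] (fun h => by simpa using congrFun h 1)
    rw [key] at h
    simp only [symbol_apply hp hmem, hT, Fin.sum_univ_four, dotProduct_eq] at h
    simp [restState, m11, m00, m01, m10, flipIndex_zero, flipIndex_one] at h
    field_simp at h
    nlinarith [sq_nonneg θ]

theorem deriv_energy (hp : ContDiffOn ℝ ∞ p (Ioi 0)) {θ : ℝ} (hθ : 0 < θ) :
    HasDerivAt (energy p) (θ * deriv (deriv p) θ) θ := by
  have h1 := hasDerivAt_of_contDiffOn hp hθ
  have h2 := hasDerivAt_of_contDiffOn (contDiffOn_deriv hp) hθ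
  have := ((hasDerivAt_id θ).mul h2).sub h1
  refine (this.congr_of_eventuallyEq (Eventually.of_forall fun φ => ?_)).congr_deriv ?_
  · simp [energy]
  · simp

theorem soundSq_eq (hp : ContDiffOn ℝ ∞ p (Ioi 0)) {θ : ℝ} (hθ : 0 < θ) :
    soundSq p θ = deriv p θ / (θ * deriv (deriv p) θ) := by
  rw [soundSq, (deriv_energy hp hθ).deriv]

theorem contDiffOn_energy (hp : ContDiffOn ℝ ∞ p (Ioi 0)) : ContDiffOn ℝ ∞ (energy p) (Ioi 0) :=
  (contDiffOn_id.mul (contDiffOn_deriv hp)).sub hp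

theorem contDiffOn_soundSq (hp : ContDiffOn ℝ ∞ p (Ioi 0)) (hc : StrictlyCausal p) :
    ContDiffOn ℝ ∞ (soundSq p) (Ioi 0) := by
  refine (contDiffOn_deriv hp).div (contDiffOn_deriv (contDiffOn_energy hp)) fun θ hθ => ?_
  rw [(deriv_energy hp hθ).deriv]
  have := hc.deriv_bounds hp hθ
  exact (this.1.trans this.2).ne'

theorem soundSq_bounds (hp : ContDiffOn ℝ ∞ p (Ioi 0)) (hc : StrictlyCausal p) {θ : ℝ}
    (hθ : 0 < θ) : 0 < soundSq p θ ∧ soundSq p θ < 1 := by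
  have := hc.deriv_bounds hp hθ
  rw [soundSq_eq hp hθ]
  exact ⟨div_pos this.1 (this.1.trans this.2), (div_lt_one (this.1.trans this.2)).2 this.2⟩

/-- Genuine nonlinearity of the acoustic mode in terms of the sound speed. -/
theorem AcousticGenuinelyNonlinear.soundSq_ne (hg : AcousticGenuinelyNonlinear p)
    (hp : ContDiffOn ℝ ∞ p (Ioi 0)) (hc : StrictlyCausal p) {θ : ℝ} (hθ : 0 < θ) :
    θ * deriv (soundSq p) θ + 2 * (1 - soundSq p θ) ≠ 0 := by
  have hmem := restState_mem hθ
  have hT := temperature_restState hθ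
  obtain ⟨hp1, hp2⟩ := hc.deriv_bounds hp hθ
  obtain ⟨hs0, hs1⟩ := soundSq_bounds hp hc hθ
  set c : ℝ := Real.sqrt (soundSq p θ) with hcdef
  have hcsq : c ^ 2 = soundSq p θ := Real.sq_sqrt hs0.le
  have hc0 : 0 < c := Real.sqrt_pos.2 hs0
  -- The characteristic vector of the sound wave which runs in the first direction at speed `c`
  -- through the fluid at rest.
  set r : Vec4 := ![-c, 1, 0, 0] with hr
  have hline : HasDerivAt (fun t : ℝ => restState θ + t • r) r 0 := by
    have := ((hasDerivAt_id (0 : ℝ)).smul_const r).const_add (restState θ)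
    simpa using this
  have hmem0 : restState θ + (0 : ℝ) • r ∈ stateSpace := by simpa using hmem
  have hτ : HasDerivAt (fun t : ℝ => temperature (restState θ + t • r)) (θ ^ 2 * c) 0 := by
    have h1 := (hasFDerivAt_temperature hmem0).comp_hasDerivAt (0 : ℝ) hline
    refine h1.congr_deriv ?_
    simp only [zero_smul, add_zero, hT, smul_apply, lorentzForm_apply,
      lorentz_eq, hr]
    simp [restState]
    field_simp
  have hcs : HasDerivAt (fun t : ℝ => Real.sqrt (soundSq p (temperature (restState θ + t • r))))
      (deriv (soundSq p) θ * (θ ^ 2 * c) / (2 * c)) 0 := by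
    have h1 : HasDerivAt (soundSq p) (deriv (soundSq p) θ)
        (temperature (restState θ + (0 : ℝ) • r)) := by
      simpa [hT] using hasDerivAt_of_contDiffOn (contDiffOn_soundSq hp hc) hθ
    have h2 := (h1.comp (0 : ℝ) hτ).sqrt (by simp [hT, hs0.ne'])
    refine h2.congr_deriv ?_
    simp [hT, hcdef]
  set cs : ℝ → ℝ := fun t => Real.sqrt (soundSq p (temperature (restState θ + t • r))) with hcsd
  have hcs0 : cs 0 = c := by simp [hcsd, hT, hcdef]
  have ha : HasDerivAt (fun t : ℝ => θ⁻¹ - c * t) (-c) 0 := by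
    simpa using ((hasDerivAt_id (0 : ℝ)).const_mul c).const_sub θ⁻¹
  -- Along `ψ + t r` the acoustic speed is the relativistic sum of the fluid velocity `t / (θ⁻¹ - c
  -- t)` and the local sound speed.
  have hlam : HasDerivAt (fun t => (t + (θ⁻¹ - c * t) * cs t) / ((θ⁻¹ - c * t) + t * cs t))
      (θ / 2 * (θ * deriv (soundSq p) θ + 2 * (1 - soundSq p θ))) 0 := by
    have h1 := ((hasDerivAt_id (0 : ℝ)).add (ha.mul hcs)).div
      (ha.add ((hasDerivAt_id (0 : ℝ)).mul hcs)) (by simp [hθ.ne'])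
    refine h1.congr_deriv ?_
    simp only [hcs0, ← hcsq, Pi.add_apply, Pi.mul_apply, id]
    field_simp
    ring
  have hne := hg (restState θ) hmem ![1, 0, 0] (fun h => by simpa using congrFun h 0) _ _ r
    (by simp [hcs0, fluidSpeed, restState, Fin.sum_univ_three, hθ.ne', hc0.ne'])
    (fun h => by simpa [hr] using congrFun h 1) ?_ ?_ hlam
  · intro h
    rw [h, mul_zero] at hne
    exact hne rfl
  · have e0 : (0 + (θ⁻¹ - c * 0) * cs 0) / ((θ⁻¹ - c * 0) + 0 * cs 0) = c := by
      rw [hcs0]; field_simp; ring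
    rw [e0]
    have hrel : c ^ 2 * (θ * deriv (deriv p) θ) = deriv p θ := by
      rw [hcsq, soundSq_eq hp hθ, div_mul_cancel₀ _ (hp1.trans hp2).ne']
    have m11 : metric 1 1 = 1 := by simp [metric]
    have m00 : metric 0 0 = -1 := by simp [metric]
    have m01 : metric 0 1 = 0 := by simp [metric]
    have m10 : metric 1 0 = 0 := by simp [metric]
    have n0 : front ![1, 0, 0] c 0 = -c := rfl
    have n1 : front ![1, 0, 0] c 1 = 1 := rfl
    have n2 : front ![1, 0, 0] c 2 = 0 := rfl
    have n3 : front ![1, 0, 0] c 3 = 0 := rfl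
    have r0 : flipIndex r 0 = c := by rw [flipIndex_zero]; simp [hr]
    have r1 : flipIndex r 1 = 1 := by rw [flipIndex_one]; simp [hr]
    have r2 : flipIndex r 2 = 0 := by rw [flipIndex_two]; simp [hr]
    have r3 : flipIndex r 3 = 0 := by rw [flipIndex_three]; simp [hr]
    ext α
    simp only [Matrix.mulVec, dotProduct, Fin.sum_univ_four, symbol_apply hp hmem, hT, r0, r1, r2,
      r3, n0, n1, n2, n3]
    fin_cases α
    · simp [restState, m00, m01, flipIndex_zero, flipIndex_one, n0, n1]
      field_simp
      linear_combination (-θ ^ 2) * hrel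
    · simp [restState, m11, m10, flipIndex_zero, flipIndex_one, n0, n1]
      field_simp
      ring
    · have : metric 2 0 = 0 ∧ metric 2 1 = 0 := by simp [metric]
      simp [restState, this, flipIndex_two, n2]
    · have : metric 3 0 = 0 ∧ metric 3 1 = 0 := by simp [metric]
      simp [restState, this, flipIndex_three, n3]
  · have hopen : ∀ᶠ t in 𝓝 (0 : ℝ), restState θ + t • r ∈ stateSpace := by
      have h1 : ∀ᶠ t in 𝓝 (0 : ℝ), lorentz (restState θ + t • r) (restState θ + t • r) < 0 :=
        ((hasFDerivAt_lorentz_self _).comp_hasDerivAt (0 : ℝ) hline).continuousAt.eventually_lt_const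
          hmem0.1
      have h2 : ∀ᶠ t in 𝓝 (0 : ℝ), 0 < (restState θ + t • r) 0 :=
        ((hasFDerivAt_coord 0 _).comp_hasDerivAt (0 : ℝ) hline).continuousAt.eventually_const_lt
          hmem0.2
      exact h1.and h2
    filter_upwards [hopen] with t ht
    have hτpos := temperature_pos ht
    have hsq := temperature_sq ht
    have hrel := soundSq_eq hp hτpos
    obtain ⟨q0, q1⟩ := soundSq_bounds hp hc hτpos
    obtain ⟨b0, b1⟩ := hc.deriv_bounds hp hτpos
    have hcst : cs t ^ 2 = soundSq p (temperature (restState θ + t • r)) := Real.sq_sqrt q0.le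
    have hcs1 : cs t < 1 := by nlinarith [Real.sqrt_nonneg (soundSq p (temperature (restState θ + t • r)))]
    have hcs2 : 0 < cs t := Real.sqrt_pos.2 q0
    have ψ0 : (restState θ + t • r) 0 = θ⁻¹ - c * t := by simp [restState, hr]; ring
    have ψ1 : (restState θ + t • r) 1 = t := by simp [restState, hr]
    have ψ2 : (restState θ + t • r) 2 = 0 := by simp [restState, hr]
    have ψ3 : (restState θ + t • r) 3 = 0 := by simp [restState, hr]
    have hpos : 0 < θ⁻¹ - c * t := ψ0 ▸ ht.2
    have hlor := ht.1
    unfold IsCharSpeed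
    rw [det_symbol hp ht, acousticForm, dotProduct_eq, lorentz_eq (front _ _) (front _ _)]
    rw [lorentz_eq] at hsq hlor
    have n0 : ∀ μ, front ![1, 0, 0] μ 0 = -μ := fun _ => rfl
    have n1 : ∀ μ, front ![1, 0, 0] μ 1 = 1 := fun _ => rfl
    have n2 : ∀ μ, front ![1, 0, 0] μ 2 = 0 := fun _ => rfl
    have n3 : ∀ μ, front ![1, 0, 0] μ 3 = 0 := fun _ => rfl
    rw [n0, n1, n2, n3, ψ0, ψ1, ψ2, ψ3]
    rw [ψ0, ψ1, ψ2, ψ3] at hsq hlor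
    rw [← hcst, eq_div_iff (b0.trans b1).ne'] at hrel
    generalize cs t = k at *
    generalize temperature (restState θ + t • r) = τ at *
    generalize θ⁻¹ - c * t = a at *
    have habs : |t| < a := abs_lt_of_sq_lt_sq (by nlinarith) hpos.le
    have hden : 0 < a + t * k := by
      have := neg_abs_le t
      nlinarith [abs_nonneg t]
    rw [← hrel]
    have hm : -((t + a * k) / (a + t * k)) * a + 1 * t + 0 * 0 + 0 * 0
        = k * (t ^ 2 - a ^ 2) / (a + t * k) := by
      field_simp; ring
    have hl : -(-((t + a * k) / (a + t * k)) * -((t + a * k) / (a + t * k))) + 1 * 1 + 0 * 0 + 0 * 0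
        = (a ^ 2 - t ^ 2) * (1 - k ^ 2) / (a + t * k) ^ 2 := by
      field_simp; ring
    rw [hm, hl]
    have hz : τ ^ 3 * deriv (deriv p) τ * (k * (t ^ 2 - a ^ 2) / (a + t * k)) ^ 2
        - k ^ 2 * (τ * deriv (deriv p) τ) * (τ ^ 2 * (k * (t ^ 2 - a ^ 2) / (a + t * k)) ^ 2
          + (a ^ 2 - t ^ 2) * (1 - k ^ 2) / (a + t * k) ^ 2) = 0 := by
      have h1 : τ ^ 2 * (a ^ 2 - t ^ 2) - 1 = 0 := by linear_combination -hsq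
      have h2 : ∀ P : ℝ, τ ^ 3 * P * (k * (t ^ 2 - a ^ 2) / (a + t * k)) ^ 2
        - k ^ 2 * (τ * P) * (τ ^ 2 * (k * (t ^ 2 - a ^ 2) / (a + t * k)) ^ 2
          + (a ^ 2 - t ^ 2) * (1 - k ^ 2) / (a + t * k) ^ 2) =
          τ * P * k ^ 2 * (1 - k ^ 2) * (a ^ 2 - t ^ 2) / (a + t * k) ^ 2
            * (τ ^ 2 * (a ^ 2 - t ^ 2) - 1) := by
        intro P
        rw [div_pow]
        generalize (a + t * k) ^ 2 = D
        ring
      rw [h2, h1, mul_zero]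
    rw [hz, mul_zero]

/-! ### The Hugoniot function between the two states -/

/-- If all critical points of `G` are nondegenerate maxima, then `G` is positive between its
zeros. -/
theorem pos_between_zeros {G G' G'' : ℝ → ℝ} (h1 : ∀ x, 0 < x → HasDerivAt G (G' x) x)
    (h2 : ∀ x, 0 < x → HasDerivAt G' (G'' x) x) (hcrit : ∀ x, 0 < x → G' x = 0 → G'' x < 0)
    {u v : ℝ} (hu : 0 < u) (hGu : G u = 0) (hGv : G v = 0) {x : ℝ} (hx : x ∈ Ioo u v) :
    0 < G x := by
  have nomin : ∀ y, 0 < y → ¬ IsLocalMin G y := by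
    intro y hy hmin
    have hd0 : G' y = 0 := hmin.hasDerivAt_eq_zero (h1 y hy)
    have hev : deriv G =ᶠ[𝓝 y] G' := by
      filter_upwards [Ioi_mem_nhds hy] with z hz using (h1 z hz).deriv
    have hdd : deriv (deriv G) y = G'' y := by rw [hev.deriv_eq, (h2 y hy).deriv]
    have hmax := isLocalMax_of_deriv_deriv_neg (f := G) (x₀ := y)
      (by rw [hdd]; exact hcrit y hy hd0) (by rw [(h1 y hy).deriv, hd0])
      (h1 y hy).continuousAt
    -- A point which is both a local minimum and a local maximum has a neighbourhood where `G` is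
    -- constant, contrary to `G'' < 0`.
    have hconst : G =ᶠ[𝓝 y] fun _ => G y := by
      filter_upwards [hmin, hmax] with z hz1 hz2 using le_antisymm hz2 hz1
    have : deriv (deriv G) y = 0 := by
      have h3 : deriv G =ᶠ[𝓝 y] deriv fun _ => G y := hconst.deriv
      rw [h3.deriv_eq]
      simp
    have h4 := hcrit y hy hd0
    rw [← hdd, this] at h4
    exact lt_irrefl _ h4
  by_contra hneg
  obtain ⟨y, hy, hymin⟩ := isCompact_Icc.exists_isMinOn (nonempty_Icc.2 (hx.1.trans hx.2).le)
    (fun z hz => (h1 z (hu.trans_le hz.1)).continuousAt.continuousWithinAt :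
      ContinuousOn G (Icc u v))
  have hxI : x ∈ Icc u v := Ioo_subset_Icc_self hx
  have interior : ∀ z ∈ Ioo u v, IsMinOn G (Icc u v) z → False := fun z hz hzm =>
    nomin z (hu.trans hz.1) (hzm.isLocalMin (Icc_mem_nhds hz.1 hz.2))
  by_cases hyI : y ∈ Ioo u v
  · exact interior y hyI hymin
  -- If the minimum is attained only at the ends it is zero, so a point `x` inside with `G x ≤ 0` is
  -- an interior minimum after all.
  · have hGy : G y = 0 := by
      rcases hy.1.eq_or_lt with h | h
      · rw [← h, hGu]
      · rcases hy.2.eq_or_lt with h' | h'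
        · rw [h', hGv]
        · exact absurd ⟨h, h'⟩ hyI
    refine interior x hx fun z hz => ?_
    have := hymin hz
    simp only [mem_ofPred_eq] at this ⊢
    linarith

/-- If `v < u`, then `G` would be positive between these zeros, whereas `G' v < 0` makes it negative
just to the right of `v`. -/
theorem zeros_ordered {G G' G'' : ℝ → ℝ} (h1 : ∀ x, 0 < x → HasDerivAt G (G' x) x)
    (h2 : ∀ x, 0 < x → HasDerivAt G' (G'' x) x) (hcrit : ∀ x, 0 < x → G' x = 0 → G'' x < 0)
    {u v : ℝ} (hu : 0 < u) (hv : 0 < v) (hGu : G u = 0) (hGv : G v = 0) (hu' : 0 < G' u)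
    (hv' : G' v < 0) : u < v ∧ ∀ x ∈ Ioo u v, 0 < G x := by
  refine ⟨?_, fun x hx => pos_between_zeros h1 h2 hcrit hu hGu hGv hx⟩
  rcases lt_trichotomy u v with h | h | h
  · exact h
  · rw [h] at hu'; linarith
  · exfalso
    have hslope := hasDerivAt_iff_tendsto_slope.1 (h1 v hv)
    have hev : ∀ᶠ x in 𝓝[>] v, slope G v x < 0 :=
      (hslope.mono_left (nhdsWithin_mono _ fun x hx => (ne_of_gt hx : x ≠ v))).eventually_lt_const hv'
    have hI : ∀ᶠ x in 𝓝[>] v, x ∈ Ioo v u := Ioo_mem_nhdsGT h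
    obtain ⟨x, hx1, hx2⟩ := (hev.and hI).exists
    have hpos := pos_between_zeros h1 h2 hcrit hv hGv hGu hx2
    rw [slope_def_field, hGv, sub_zero] at hx1
    exact absurd hx1 (not_lt.2 (div_pos hpos (sub_pos.2 hx2.1)).le)

/-- The Hugoniot function of the flux constants `q₀`, `q₁`; it vanishes at the states with these
fluxes. -/
def hugoniot (p : ℝ → ℝ) (q₀ q₁ θ : ℝ) : ℝ := (q₁ - p θ) * (q₁ + energy p θ) - q₀ ^ 2

/-- The derivative of the Hugoniot function. -/
def hugoniotDeriv (p : ℝ → ℝ) (q₁ θ : ℝ) : ℝ :=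
  -deriv p θ * (q₁ + energy p θ) + (q₁ - p θ) * (θ * deriv (deriv p) θ)

/-- The second derivative of the Hugoniot function. -/
def hugoniotDeriv₂ (p : ℝ → ℝ) (q₁ θ : ℝ) : ℝ :=
  -deriv (deriv p) θ * (q₁ + energy p θ) - 2 * deriv p θ * (θ * deriv (deriv p) θ)
    + (q₁ - p θ) * (deriv (deriv p) θ + θ * deriv (deriv (deriv p)) θ)

theorem hasDerivAt_hugoniot (hp : ContDiffOn ℝ ∞ p (Ioi 0)) (q₀ q₁ : ℝ) {θ : ℝ} (hθ : 0 < θ) :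
    HasDerivAt (hugoniot p q₀ q₁) (hugoniotDeriv p q₁ θ) θ := by
  have h1 := hasDerivAt_of_contDiffOn hp hθ
  have h2 := deriv_energy hp hθ
  refine (((h1.const_sub q₁).mul (h2.const_add q₁)).sub_const (q₀ ^ 2)).congr_deriv ?_
  unfold hugoniotDeriv
  ring

theorem hasDerivAt_hugoniotDeriv (hp : ContDiffOn ℝ ∞ p (Ioi 0)) (q₁ : ℝ) {θ : ℝ} (hθ : 0 < θ) :
    HasDerivAt (hugoniotDeriv p q₁) (hugoniotDeriv₂ p q₁ θ) θ := by
  have h1 := hasDerivAt_of_contDiffOn hp hθ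
  have h2 := hasDerivAt_of_contDiffOn (contDiffOn_deriv hp) hθ
  have h3 := hasDerivAt_of_contDiffOn (contDiffOn_deriv (contDiffOn_deriv hp)) hθ
  have h4 := deriv_energy hp hθ
  refine ((h2.neg.mul (h4.const_add q₁)).add
    ((h1.const_sub q₁).mul ((hasDerivAt_id θ).mul h3))).congr_deriv ?_
  unfold hugoniotDeriv₂
  simp only [Pi.mul_apply, Pi.neg_apply, id]
  ring

/-- At a critical point of the Hugoniot function, its second derivative has the sign opposite to
that of the coefficient of genuine nonlinearity. -/
theorem hugoniotDeriv₂_of_critical (hp : ContDiffOn ℝ ∞ p (Ioi 0)) (hc : StrictlyCausal p)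
    {q₁ θ : ℝ} (hθ : 0 < θ) (hcrit : hugoniotDeriv p q₁ θ = 0) :
    hugoniotDeriv₂ p q₁ θ * (1 - soundSq p θ) =
      -(θ * deriv (deriv p) θ * deriv p θ)
        * (θ * deriv (soundSq p) θ + 2 * (1 - soundSq p θ)) := by
  obtain ⟨b1, b2⟩ := hc.deriv_bounds hp hθ
  have hs := hasDerivAt_of_contDiffOn (contDiffOn_soundSq hp hc) hθ
  have h2 := hasDerivAt_of_contDiffOn (contDiffOn_deriv hp) hθ
  have h3 := hasDerivAt_of_contDiffOn (contDiffOn_deriv (contDiffOn_deriv hp)) hθ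
  have hprod := hs.mul ((hasDerivAt_id θ).mul h3)
  -- Differentiating the identity `p' = c_s² θ p''` eliminates the third derivative of `p` in favour
  -- of that of `c_s²`.
  have heq : deriv p =ᶠ[𝓝 θ] soundSq p * (id * deriv (deriv p)) := by
    filter_upwards [Ioi_mem_nhds hθ] with x hx
    obtain ⟨a1, a2⟩ := hc.deriv_bounds hp hx
    simp only [Pi.mul_apply, id, soundSq_eq hp hx]
    rw [div_mul_cancel₀ _ (a1.trans a2).ne']
  have e1 := (hprod.congr_of_eventuallyEq heq).unique h2
  have e2 := heq.self_of_nhds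
  simp only [Pi.mul_apply, id] at e1 e2
  have hpos := b1.trans b2
  unfold hugoniotDeriv at hcrit
  unfold hugoniotDeriv₂
  unfold energy at *
  generalize soundSq p θ = c at *
  generalize deriv (soundSq p) θ = c' at *
  generalize deriv (deriv (deriv p)) θ = p3 at *
  generalize deriv (deriv p) θ = p2 at *
  generalize deriv p θ = p1 at *
  generalize p θ = p0 at *
  -- Criticality of the Hugoniot function means `q₁ - p = c_s² (q₁ + ρ)`.
  have e3 : q₁ - p0 = c * (q₁ + (θ * p1 - p0)) := by
    have : (θ * p2) * ((q₁ - p0) - c * (q₁ + (θ * p1 - p0))) = 0 := by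
      linear_combination hcrit + (q₁ + (θ * p1 - p0)) * e2
    rcases mul_eq_zero.1 this with h | h
    · exact absurd h hpos.ne'
    · linarith
  have e4 : (1 - c) * (q₁ + (θ * p1 - p0)) = θ * p1 := by linear_combination e3
  rw [e3]
  linear_combination (1 - c) * (q₁ + (θ * p1 - p0)) * e1 - c' * θ * p2 * e4

/-- The order of the two states of a shock and the sign of the Hugoniot function between them. -/
theorem hugoniot_sign (hp : ContDiffOn ℝ ∞ p (Ioi 0)) (hc : StrictlyCausal p)
    (hg : AcousticGenuinelyNonlinear p) {q₀ q₁ u v : ℝ} (hu : 0 < u) (hv : 0 < v)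
    (hGu : hugoniot p q₀ q₁ u = 0) (hGv : hugoniot p q₀ q₁ v = 0) (hu' : 0 < hugoniotDeriv p q₁ u)
    (hv' : hugoniotDeriv p q₁ v < 0) :
    (u < v ∧ ∀ θ ∈ Ioo u v, 0 < hugoniot p q₀ q₁ θ) ∨
      (v < u ∧ ∀ θ ∈ Ioo v u, hugoniot p q₀ q₁ θ < 0) := by
  set Γ : ℝ → ℝ := fun θ => θ * deriv (soundSq p) θ + 2 * (1 - soundSq p θ) with hΓ
  have hs := contDiffOn_soundSq hp hc
  have hcont : ContinuousOn Γ (Ioi 0) :=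
    (continuousOn_id.mul (contDiffOn_deriv hs).continuousOn).add
      (continuousOn_const.mul (continuousOn_const.sub hs.continuousOn))
  have hne : ∀ θ, 0 < θ → Γ θ ≠ 0 := fun θ hθ => hg.soundSq_ne hp hc hθ
  -- A continuous function without zeros on the half-line has one sign.
  have same : ∀ x y, 0 < x → 0 < y → 0 < Γ x → 0 < Γ y := by
    intro x y hx hy hxp
    by_contra hneg
    have := isPreconnected_Ioi.intermediate_value (a := y) (b := x) hy hx hcont
    obtain ⟨z, hz, hz0⟩ := this ⟨not_lt.1 hneg, hxp.le⟩
    exact hne z hz hz0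
  have hcrit : ∀ θ, 0 < θ → hugoniotDeriv p q₁ θ = 0 →
      0 < θ * deriv (deriv p) θ * deriv p θ ∧ 0 < 1 - soundSq p θ ∧
      hugoniotDeriv₂ p q₁ θ * (1 - soundSq p θ) = -(θ * deriv (deriv p) θ * deriv p θ) * Γ θ := by
    intro θ hθ h
    obtain ⟨b1, b2⟩ := hc.deriv_bounds hp hθ
    exact ⟨mul_pos (b1.trans b2) b1, by linarith [(soundSq_bounds hp hc hθ).2],
      hugoniotDeriv₂_of_critical hp hc hθ h⟩
  rcases (hne u hu).lt_or_gt with hneg | hpos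
  · right
    have hall : ∀ θ, 0 < θ → Γ θ < 0 := fun θ hθ =>
      (hne θ hθ).lt_or_gt.resolve_right fun h => absurd (same θ u hθ hu h) (not_lt.2 hneg.le)
    have := zeros_ordered (G := fun θ => -hugoniot p q₀ q₁ θ)
      (fun x hx => (hasDerivAt_hugoniot hp q₀ q₁ hx).neg)
      (fun x hx => (hasDerivAt_hugoniotDeriv hp q₁ hx).neg)
      (fun θ hθ h => by
        obtain ⟨c1, c2, c3⟩ := hcrit θ hθ (neg_eq_zero.1 h)
        have := hall θ hθ
        by_contra hcon
        nlinarith [mul_pos c1 (neg_pos.2 this)])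
      hv hu (by simp [hGv]) (by simp [hGu]) (by linarith) (by linarith)
    exact ⟨this.1, fun θ hθ => neg_pos.1 (this.2 θ hθ)⟩
  · left
    refine zeros_ordered (fun x hx => hasDerivAt_hugoniot hp q₀ q₁ hx)
      (fun x hx => hasDerivAt_hugoniotDeriv hp q₁ hx) (fun θ hθ h => ?_) hu hv hGu hGv hu' hv'
    obtain ⟨c1, c2, c3⟩ := hcrit θ hθ h
    have := mul_pos c1 (same u θ hu hθ hpos)
    by_contra hcon
    nlinarith

/-! ### Characteristic speeds and the Lax conditions -/

/-- Strict convexity in exact form: for `A > 0` and `x < y < z` the value at `y` lies below the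
chord. -/
theorem quadratic_chord {A B C x y z : ℝ} :
    (z - x) * (A * y ^ 2 + B * y + C) = (z - y) * (A * x ^ 2 + B * x + C)
      + (y - x) * (A * z ^ 2 + B * z + C) - A * ((z - y) * (y - x) * (z - x)) := by
  ring

/-- The ordered roots `lam` of the quartic `κ (w - μ u)² q(μ)`, where `q` is a convex quadratic
polynomial which is negative at the double root `w / u`. -/
structure AcousticRoots (lam : Fin 4 → ℝ) (κ w u A B C : ℝ) : Prop where
  mono : Monotone lam
  κ_pos : 0 < κ
  u_pos : 0 < u
  A_pos : 0 < A
  neg : A * (w / u) ^ 2 + B * (w / u) + C < 0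
  prod : ∀ μ, ∏ i, (lam i - μ) = κ * (w - μ * u) ^ 2 * (A * μ ^ 2 + B * μ + C)

namespace AcousticRoots

variable {lam : Fin 4 → ℝ} {κ w u A B C : ℝ}

theorem exists_index (h : AcousticRoots lam κ w u A B C) {μ : ℝ}
    (hμ : (w - μ * u) ^ 2 * (A * μ ^ 2 + B * μ + C) = 0) : ∃ i, lam i = μ := by
  have := h.prod μ
  rw [mul_assoc, hμ, mul_zero, Finset.prod_eq_zero_iff] at this
  obtain ⟨i, -, hi⟩ := this
  exact ⟨i, sub_eq_zero.1 hi⟩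

theorem exists_index_speed (h : AcousticRoots lam κ w u A B C) : ∃ i, lam i = w / u :=
  h.exists_index (by rw [div_mul_cancel₀ _ h.u_pos.ne']; ring)

theorem quadratic_large (h : AcousticRoots lam κ w u A B C) :
    ∃ R, ∀ μ, R ≤ |μ| → 0 < A * μ ^ 2 + B * μ + C := by
  have hA := h.A_pos
  refine ⟨(|B| + |C|) / A + 1, fun μ hμ => ?_⟩
  have h1 : (|B| + |C|) + A ≤ A * |μ| := by
    have := mul_le_mul_of_nonneg_left hμ hA.le
    rw [mul_add, mul_div_cancel₀ _ hA.ne'] at this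
    linarith
  have h2 : 1 ≤ |μ| := by
    have : 0 ≤ (|B| + |C|) / A := by positivity
    linarith
  have h3 : -(|B| * |μ|) ≤ B * μ := by rw [← abs_mul]; exact neg_abs_le _
  have h4 := neg_abs_le C
  have h5 : A * μ ^ 2 = A * |μ| * |μ| := by rw [mul_assoc, ← pow_two, sq_abs]
  have h6 : 0 ≤ |C| := abs_nonneg C
  nlinarith [mul_le_mul_of_nonneg_right h1 (abs_nonneg μ)]

/-- The convex quadratic is negative at the fluid speed and positive far to the left. -/
theorem exists_root_lt (h : AcousticRoots lam κ w u A B C) : ∃ i, lam i < w / u := by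
  obtain ⟨R, hR⟩ := h.quadratic_large
  set x := min (-|R|) (w / u) with hx
  have hx1 : R ≤ |x| := by
    have h1 : x ≤ -|R| := min_le_left _ _
    have h2 := neg_le_abs x
    have h3 := le_abs_self R
    linarith
  have hc : ContinuousOn (fun μ : ℝ => A * μ ^ 2 + B * μ + C) (Icc x (w / u)) := by fun_prop
  obtain ⟨μ, hμ, hμ0⟩ := intermediate_value_Icc' (min_le_right _ _) hc ⟨h.neg.le, (hR x hx1).le⟩
  simp only at hμ0
  obtain ⟨i, hi⟩ := h.exists_index (μ := μ) (by rw [hμ0, mul_zero])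
  refine ⟨i, hi ▸ lt_of_le_of_ne hμ.2 ?_⟩
  rintro rfl
  exact h.neg.ne hμ0

theorem exists_root_gt (h : AcousticRoots lam κ w u A B C) : ∃ i, w / u < lam i := by
  obtain ⟨R, hR⟩ := h.quadratic_large
  set x := max |R| (w / u) with hx
  have hx1 : R ≤ |x| := by
    have h1 : |R| ≤ x := le_max_left _ _
    have h2 := le_abs_self x
    have h3 := le_abs_self R
    linarith
  have hc : ContinuousOn (fun μ : ℝ => A * μ ^ 2 + B * μ + C) (Icc (w / u) x) := by fun_prop
  obtain ⟨μ, hμ, hμ0⟩ := intermediate_value_Icc (le_max_right _ _) hc ⟨h.neg.le, (hR x hx1).le⟩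
  simp only at hμ0
  obtain ⟨i, hi⟩ := h.exists_index (μ := μ) (by rw [hμ0, mul_zero])
  refine ⟨i, hi ▸ lt_of_le_of_ne hμ.1 ?_⟩
  rintro rfl
  exact h.neg.ne hμ0

theorem prod_four (h : AcousticRoots lam κ w u A B C) (s : ℝ) :
    (lam 0 - s) * (lam 1 - s) * (lam 2 - s) * (lam 3 - s)
      = κ * (w - s * u) ^ 2 * (A * s ^ 2 + B * s + C) := by
  rw [← h.prod s, Fin.prod_univ_four]

theorem sign_of_prod_pos (h : AcousticRoots lam κ w u A B C) {s : ℝ}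
    (hs : 0 < (lam 0 - s) * (lam 1 - s) * (lam 2 - s) * (lam 3 - s)) :
    s ≠ w / u ∧ 0 < A * s ^ 2 + B * s + C := by
  rw [h.prod_four] at hs
  have h0 : 0 ≤ κ * (w - s * u) ^ 2 := mul_nonneg h.κ_pos.le (sq_nonneg _)
  refine ⟨?_, pos_of_mul_pos_right hs h0⟩
  rintro rfl
  rw [div_mul_cancel₀ _ h.u_pos.ne'] at hs
  simp at hs

theorem sign_of_prod_neg (h : AcousticRoots lam κ w u A B C) {s : ℝ}
    (hs : (lam 0 - s) * (lam 1 - s) * (lam 2 - s) * (lam 3 - s) < 0) :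
    s ≠ w / u ∧ A * s ^ 2 + B * s + C < 0 := by
  rw [h.prod_four] at hs
  have h0 : 0 ≤ κ * (w - s * u) ^ 2 := mul_nonneg h.κ_pos.le (sq_nonneg _)
  refine ⟨?_, neg_of_mul_neg_right hs h0⟩
  rintro rfl
  rw [div_mul_cancel₀ _ h.u_pos.ne'] at hs
  simp at hs

/-- The front is slower than all characteristic speeds. -/
theorem of_all_gt (h : AcousticRoots lam κ w u A B C) {s : ℝ} (hs : ∀ i, s < lam i) :
    s < w / u ∧ 0 < A * s ^ 2 + B * s + C := by
  obtain ⟨i, hi⟩ := h.exists_index_speed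
  have hp := fun i => sub_pos.2 (hs i)
  exact ⟨hi ▸ hs i, (h.sign_of_prod_pos
    (mul_pos (mul_pos (mul_pos (hp 0) (hp 1)) (hp 2)) (hp 3))).2⟩

/-- The front is faster than all characteristic speeds. -/
theorem of_all_lt (h : AcousticRoots lam κ w u A B C) {s : ℝ} (hs : ∀ i, lam i < s) :
    w / u < s ∧ 0 < A * s ^ 2 + B * s + C := by
  obtain ⟨i, hi⟩ := h.exists_index_speed
  have hp := fun i => sub_neg.2 (hs i)
  exact ⟨hi ▸ hs i, (h.sign_of_prod_pos
    (mul_pos_of_neg_of_neg (mul_neg_of_pos_of_neg (mul_pos_of_neg_of_neg (hp 0) (hp 1)) (hp 2))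
      (hp 3))).2⟩

/-- The front is faster than precisely one characteristic speed. -/
theorem of_one_lt (h : AcousticRoots lam κ w u A B C) {s : ℝ} (h0 : lam 0 < s)
    (hs : ∀ i, 0 < i → s < lam i) : s < w / u ∧ A * s ^ 2 + B * s + C < 0 := by
  have hp := fun i hi => sub_pos.2 (hs i hi)
  obtain ⟨hne, hq⟩ := h.sign_of_prod_neg (s := s)
    (mul_neg_of_neg_of_pos (mul_neg_of_neg_of_pos (mul_neg_of_neg_of_pos (sub_neg.2 h0)
      (hp 1 (by decide))) (hp 2 (by decide))) (hp 3 (by decide)))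
  refine ⟨lt_of_le_of_ne ?_ hne, hq⟩
  by_contra hlt
  -- Were the front faster than the fluid, the fluid speed and a smaller acoustic speed would both
  -- lie below it, but only index `0` is available.
  obtain ⟨i, hi⟩ := h.exists_root_lt
  obtain ⟨j, hj⟩ := h.exists_index_speed
  have zero : ∀ i, lam i < s → i = 0 := fun i hi => by
    by_contra hne
    exact absurd (hs i (Fin.pos_of_ne_zero hne)) (not_lt.2 hi.le)
  rw [zero i (by linarith), ← hj, zero j (by linarith)] at hi
  exact lt_irrefl _ hi

/-- The front is slower than precisely one characteristic speed. -/
theorem of_one_gt (h : AcousticRoots lam κ w u A B C) {s : ℝ} (h3 : s < lam 3)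
    (hs : ∀ i, i < 3 → lam i < s) : w / u < s ∧ A * s ^ 2 + B * s + C < 0 := by
  have hp := fun i hi => sub_neg.2 (hs i hi)
  obtain ⟨hne, hq⟩ := h.sign_of_prod_neg (s := s)
    (mul_neg_of_neg_of_pos (mul_neg_of_pos_of_neg (mul_pos_of_neg_of_neg
      (hp 0 (by decide)) (hp 1 (by decide))) (hp 2 (by decide))) (sub_pos.2 h3))
  refine ⟨lt_of_le_of_ne ?_ hne.symm, hq⟩
  by_contra hlt
  obtain ⟨i, hi⟩ := h.exists_root_gt
  obtain ⟨j, hj⟩ := h.exists_index_speed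
  have three : ∀ i, s < lam i → i = 3 := fun i hi => by
    by_contra hne
    exact absurd (hs i (lt_of_le_of_ne (Fin.le_last i) hne)) (not_lt.2 hi.le)
  rw [three i (by linarith), ← hj, three j (by linarith)] at hi
  exact lt_irrefl _ hi

/-- The front cannot be faster than precisely two characteristic speeds. -/
theorem not_two_lt (h : AcousticRoots lam κ w u A B C) {s : ℝ} (h1 : lam 1 < s)
    (h2 : s < lam 2) : False := by
  have h0 : lam 0 < s := (h.mono (by decide : (0 : Fin 4) ≤ 1)).trans_lt h1
  have h3 : s < lam 3 := h2.trans_le (h.mono (by decide : (2 : Fin 4) ≤ 3))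
  obtain ⟨hne, hq⟩ := h.sign_of_prod_pos (s := s)
    (mul_pos (mul_pos (mul_pos_of_neg_of_neg (sub_neg.2 h0) (sub_neg.2 h1)) (sub_pos.2 h2))
      (sub_pos.2 h3))
  -- The sign of the product makes the quadratic positive at `s`. Yet `s` lies between the fluid
  -- speed, where it is negative, and an extreme speed, where it vanishes; this contradicts
  -- convexity.
  have root : ∀ i, lam i ≠ w / u → A * lam i ^ 2 + B * lam i + C = 0 := by
    intro i hi
    have h1 := h.prod (lam i)
    rw [Finset.prod_eq_zero (Finset.mem_univ i) (sub_self _)] at h1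
    have h2 : w - lam i * u ≠ 0 := fun h0 => hi (by
      rw [eq_div_iff h.u_pos.ne']; linarith)
    rcases mul_eq_zero.1 h1.symm with h' | h'
    · exact absurd h' (mul_ne_zero h.κ_pos.ne' (pow_ne_zero 2 h2))
    · exact h'
  have hA := h.A_pos
  have hneg := h.neg
  rcases hne.lt_or_gt with hlt | hgt
  · have e := quadratic_chord (A := A) (B := B) (C := C) (x := lam 0) (y := s) (z := w / u)
    rw [root 0 (by linarith)] at e
    have p1 : 0 < (w / u - lam 0) * (A * s ^ 2 + B * s + C) := mul_pos (by linarith) hq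
    have p2 : (s - lam 0) * (A * (w / u) ^ 2 + B * (w / u) + C) < 0 :=
      mul_neg_of_pos_of_neg (by linarith) hneg
    have p3 : 0 < A * ((w / u - s) * (s - lam 0) * (w / u - lam 0)) :=
      mul_pos hA (mul_pos (mul_pos (by linarith) (by linarith)) (by linarith))
    linarith
  · have e := quadratic_chord (A := A) (B := B) (C := C) (x := w / u) (y := s) (z := lam 3)
    rw [root 3 (by linarith)] at e
    have p1 : 0 < (lam 3 - w / u) * (A * s ^ 2 + B * s + C) := mul_pos (by linarith) hq
    have p2 : (lam 3 - s) * (A * (w / u) ^ 2 + B * (w / u) + C) < 0 :=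
      mul_neg_of_pos_of_neg (by linarith) hneg
    have p3 : 0 < A * ((lam 3 - s) * (s - w / u) * (lam 3 - w / u)) :=
      mul_pos hA (mul_pos (mul_pos (by linarith) (by linarith)) (by linarith))
    linarith

end AcousticRoots

theorem front_tail (ξ : Vec4) : front (Fin.tail ξ) (-ξ 0) = ξ := by
  unfold front
  rw [neg_neg, Fin.cons_self_tail]

theorem front_dotProduct (n : Fin 3 → ℝ) (μ : ℝ) (ψ : Vec4) :
    front n μ ⬝ᵥ ψ = (∑ j : Fin 3, n j * ψ j.succ) - μ * ψ 0 := by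
  rw [dotProduct, Fin.sum_univ_succ]
  simp [front]
  ring

theorem lorentz_front (n : Fin 3 → ℝ) (μ : ℝ) :
    lorentz (front n μ) (front n μ) = (∑ j : Fin 3, n j ^ 2) - μ ^ 2 := by
  rw [lorentz_eq, Fin.sum_univ_three]
  have h1 : front n μ 1 = n 0 := rfl
  have h2 : front n μ 2 = n 1 := rfl
  have h3 : front n μ 3 = n 2 := rfl
  have h0 : front n μ 0 = -μ := rfl
  rw [h0, h1, h2, h3]
  ring

theorem acousticForm_front (p : ℝ → ℝ) (n : Fin 3 → ℝ) (μ : ℝ) (ψ : Vec4) :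
    acousticForm p (front n μ) ψ =
      (temperature ψ ^ 2 * (temperature ψ * deriv (deriv p) (temperature ψ)
          - deriv p (temperature ψ)) * ψ 0 ^ 2 + deriv p (temperature ψ)) * μ ^ 2
        + (-2 * (temperature ψ ^ 2 * (temperature ψ * deriv (deriv p) (temperature ψ)
          - deriv p (temperature ψ))) * (∑ j : Fin 3, n j * ψ j.succ) * ψ 0) * μ
        + (temperature ψ ^ 2 * (temperature ψ * deriv (deriv p) (temperature ψ)
          - deriv p (temperature ψ)) * (∑ j : Fin 3, n j * ψ j.succ) ^ 2
          - deriv p (temperature ψ) * ∑ j : Fin 3, n j ^ 2) := by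
  unfold acousticForm
  rw [front_dotProduct, lorentz_front]
  ring

theorem det_symbol_time_pos (hp : ContDiffOn ℝ ∞ p (Ioi 0)) (hc : StrictlyCausal p) {ψ : Vec4}
    (h : ψ ∈ stateSpace) : 0 < (symbol p (Pi.single 0 1) ψ).det := by
  have hθ := temperature_pos h
  obtain ⟨b1, b2⟩ := hc.deriv_bounds hp hθ
  have h0 := h.2
  rw [det_symbol hp h, acousticForm, lorentz_eq]
  simp only [single_dotProduct, one_mul]
  have e : temperature ψ ^ 3 * deriv (deriv p) (temperature ψ) * ψ 0 ^ 2 -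
      deriv p (temperature ψ) * (temperature ψ ^ 2 * ψ 0 ^ 2 + -1) =
      temperature ψ ^ 2 * ψ 0 ^ 2 * (temperature ψ * deriv (deriv p) (temperature ψ)
        - deriv p (temperature ψ)) + deriv p (temperature ψ) := by ring
  simp
  rw [e]
  have := sub_pos.2 b2
  positivity

/-- The characteristic speeds in a direction `n ≠ 0`. -/
theorem IsCharSpeedList.acousticRoots (hp : ContDiffOn ℝ ∞ p (Ioi 0)) (hc : StrictlyCausal p)
    {ψ : Vec4} (h : ψ ∈ stateSpace) {n : Fin 3 → ℝ} (hn : 0 < ∑ j, n j ^ 2) {lam : Fin 4 → ℝ}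
    (hl : IsCharSpeedList p n ψ lam) :
    ∃ κ A B C, AcousticRoots lam κ (∑ j : Fin 3, n j * ψ j.succ) (ψ 0) A B C ∧
      ∀ μ, acousticForm p (front n μ) ψ = A * μ ^ 2 + B * μ + C := by
  have hθ := temperature_pos h
  obtain ⟨b1, b2⟩ := hc.deriv_bounds hp hθ
  have h0 := h.2
  have hd := det_symbol_time_pos hp hc h
  have hb := sub_pos.2 b2
  refine ⟨temperature ψ ^ 10 * deriv p (temperature ψ) ^ 3 / (symbol p (Pi.single 0 1) ψ).det,
    _, _, _, ⟨hl.1, by positivity, h0, by positivity, ?_, fun μ => ?_⟩,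
    fun μ => acousticForm_front p n μ ψ⟩
  -- Cauchy-Schwarz and the timelikeness of `ψ`: the fluid is slower than light.
  · have hlt : (∑ j : Fin 3, n j * ψ j.succ) ^ 2 < (∑ j : Fin 3, n j ^ 2) * ψ 0 ^ 2 := by
      have hcs := Finset.sum_mul_sq_le_sq_mul_sq Finset.univ n (fun j => ψ j.succ)
      have hψ := h.1
      have : ∑ j : Fin 3, ψ j.succ ^ 2 < ψ 0 ^ 2 := by
        rw [lorentz_eq] at hψ
        rw [Fin.sum_univ_three]
        have e1 : (Fin.succ 0 : Fin 4) = 1 := rfl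
        have e2 : (Fin.succ 1 : Fin 4) = 2 := rfl
        have e3 : (Fin.succ 2 : Fin 4) = 3 := rfl
        rw [e1, e2, e3]
        linarith
      exact hcs.trans_lt (mul_lt_mul_of_pos_left this hn)
    generalize (∑ j : Fin 3, n j * ψ j.succ) = w at *
    generalize (∑ j : Fin 3, n j ^ 2) = S at *
    rw [show ∀ D P : ℝ, (D * ψ 0 ^ 2 + P) * (w / ψ 0) ^ 2 + -2 * D * w * ψ 0 * (w / ψ 0)
      + (D * w ^ 2 - P * S) = P * (w ^ 2 - S * ψ 0 ^ 2) / ψ 0 ^ 2 by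
        intro D P; field_simp; ring]
    exact div_neg_of_neg_of_pos (mul_neg_of_pos_of_neg b1 (by linarith)) (by positivity)
  · have h1 := hl.2 μ
    rw [det_symbol hp h, front_dotProduct] at h1
    rw [← acousticForm_front]
    field_simp
    linarith

theorem front_speed_lt {ψ : Vec4} (h : ψ ∈ stateSpace) {ξ : Vec4}
    (hs : -ξ 0 < (∑ j : Fin 3, Fin.tail ξ j * ψ j.succ) / ψ 0) : 0 < ξ ⬝ᵥ ψ := by
  rw [lt_div_iff₀ h.2] at hs
  rw [← front_tail ξ, front_dotProduct]
  linarith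

theorem front_speed_gt {ψ : Vec4} (h : ψ ∈ stateSpace) {ξ : Vec4}
    (hs : (∑ j : Fin 3, Fin.tail ξ j * ψ j.succ) / ψ 0 < -ξ 0) : ξ ⬝ᵥ ψ < 0 := by
  rw [div_lt_iff₀ h.2] at hs
  rw [← front_tail ξ, front_dotProduct]
  linarith

/-- For `n = 0` the determinant is a nonzero multiple of `μ⁴`. The Lax inequalities would then
require `s < 0 < s`, so a Lax shock has `n ≠ 0`. -/
theorem charSpeed_zero_direction (hp : ContDiffOn ℝ ∞ p (Ioi 0)) (hc : StrictlyCausal p)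
    {ψ : Vec4} (h : ψ ∈ stateSpace) {n : Fin 3 → ℝ} (hn : ∑ j, n j ^ 2 = 0) {lam : Fin 4 → ℝ}
    (hl : IsCharSpeedList p n ψ lam) (i : Fin 4) : lam i = 0 := by
  have hθ := temperature_pos h
  obtain ⟨b1, b2⟩ := hc.deriv_bounds hp hθ
  have h0 := h.2
  have hb := sub_pos.2 b2
  have hw : ∀ j, n j = 0 := fun j => by
    have := (Finset.sum_eq_zero_iff_of_nonneg (fun j _ => sq_nonneg (n j))).1 hn j
      (Finset.mem_univ j)
    exact pow_eq_zero_iff two_ne_zero |>.1 this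
  have h1 := hl.2 (lam i)
  rw [Finset.prod_eq_zero (Finset.mem_univ i) (sub_self _), mul_zero, det_symbol hp h,
    acousticForm_front, front_dotProduct] at h1
  simp [hw] at h1
  rcases h1 with (h1 | h1) | h1
  · rcases h1 with h1 | h1
    · exact absurd h1 hθ.ne'
    · exact absurd h1 b1.ne'
  · exact h1.resolve_right h0.ne'
  · rcases h1 with h1 | h1
    · have : 0 < temperature ψ ^ 2 * (temperature ψ * deriv (deriv p) (temperature ψ)
          - deriv p (temperature ψ)) * ψ 0 ^ 2 + deriv p (temperature ψ) := by positivity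
      exact absurd h1 this.ne'
    · exact h1

/-- A Lax shock is acoustic: the fluid crosses it from the supersonic to the subsonic side. -/
theorem IsLaxShock.acoustic (hp : ContDiffOn ℝ ∞ p (Ioi 0)) (hc : StrictlyCausal p)
    {ξ ψm ψp : Vec4} (h : IsLaxShock p ξ ψm ψp) :
    (0 < ξ ⬝ᵥ ψm ∧ 0 < acousticForm p ξ ψm ∧ 0 < ξ ⬝ᵥ ψp ∧ acousticForm p ξ ψp < 0) ∨
    (ξ ⬝ᵥ ψm < 0 ∧ acousticForm p ξ ψm < 0 ∧ ξ ⬝ᵥ ψp < 0 ∧ 0 < acousticForm p ξ ψp) := by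
  obtain ⟨hm, hp', -, lm, lp, k, hlm, hlp, h1, h2, h3, h4⟩ := h
  rcases (Finset.sum_nonneg fun j _ => sq_nonneg (Fin.tail ξ j) :
    0 ≤ ∑ j : Fin 3, Fin.tail ξ j ^ 2).eq_or_lt with hn | hn
  · exfalso
    have e1 := h2 k le_rfl
    have e2 := h3 k le_rfl
    rw [charSpeed_zero_direction hp hc hm hn.symm hlm] at e1
    rw [charSpeed_zero_direction hp hc hp' hn.symm hlp] at e2
    linarith
  obtain ⟨κm, Am, Bm, Cm, rm, fm⟩ := hlm.acousticRoots hp hc hm hn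
  obtain ⟨κp, Ap, Bp, Cp, rp, fp⟩ := hlp.acousticRoots hp hc hp' hn
  have fm := fm (-ξ 0)
  have fp := fp (-ξ 0)
  rw [front_tail] at fm fp
  rw [fm, fp]
  fin_cases k
  · left
    have a := rm.of_all_gt (s := -ξ 0) fun i => h2 i (Fin.zero_le i)
    have b := rp.of_one_lt (s := -ξ 0) (h3 0 le_rfl) fun i hi => h4 i hi
    exact ⟨front_speed_lt hm a.1, a.2, front_speed_lt hp' b.1, b.2⟩
  -- The two middle values of `k` would be shocks of the modes which travel with the fluid; they
  -- would put `s` between the second and the third speed at one of the states.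
  · exact (rp.not_two_lt (s := -ξ 0) (h3 1 le_rfl) (h4 2 (by decide))).elim
  · exact (rm.not_two_lt (s := -ξ 0) (h1 1 (by decide)) (h2 2 le_rfl)).elim
  · right
    have a := rm.of_one_gt (s := -ξ 0) (h2 3 le_rfl) fun i hi => h1 i hi
    have b := rp.of_all_lt (s := -ξ 0) fun i => h3 i (Fin.le_last i)
    exact ⟨front_speed_gt hm a.1, a.2, front_speed_gt hp' b.1, b.2⟩

end RelFluid

/-! ### Lipschitz bounds on compact sets and reflected lenses -/

namespace PlanarFlow

open Set
open scoped NNReal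

/-- A map of class `C¹` is locally Lipschitz, and compactness makes the constant uniform. No
convexity is needed, which a lens need not have. -/
theorem exists_lipschitzOnWith_of_contDiffOn {E F : Type*} [NormedAddCommGroup E] [NormedSpace ℝ E]
    [NormedAddCommGroup F] [NormedSpace ℝ F] {f : E → F} {s t : Set E} (hs : IsOpen s)
    (hf : ContDiffOn ℝ ∞ f s) (ht : IsCompact t) (hts : t ⊆ s) :
    ∃ K, LipschitzOnWith K f t := by
  refine LocallyLipschitzOn.exists_lipschitzOnWith_of_compact ht fun x hx => ?_
  have h1 : ContDiffAt ℝ 1 f x :=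
    (hf.contDiffAt (hs.mem_nhds (hts hx))).of_le (by exact_mod_cast le_top)
  obtain ⟨K, u, hu, hK⟩ := h1.exists_lipschitzOnWith
  exact ⟨K, u, mem_nhdsWithin_of_mem_nhds hu, hK⟩

theorem lipschitzOnWith_reflect {E F : Type*} [NormedAddCommGroup E] [NormedAddCommGroup F]
    {f : E → F} {s t : Set E} {K : ℝ≥0} (hf : LipschitzOnWith K f s) (hst : ∀ x ∈ t, -x ∈ s) :
    LipschitzOnWith K (fun x => -f (-x)) t := by
  refine LipschitzOnWith.of_dist_le_mul fun x hx y hy => ?_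
  have := hf.dist_le_mul _ (hst x hx) _ (hst y hy)
  rw [dist_neg_neg] at this ⊢
  exact this

/-- The lens field whose field and graphs are reflected at the origin. -/
theorem lensField_reflect {F : ℝ × ℝ → ℝ × ℝ} {f₁ f₂ : ℝ → ℝ} {a b : ℝ} (hab : a < b)
    (lipschitz : ∃ K, LipschitzOnWith K F (lens f₂ f₁ a b))
    (h₁ : ∃ K, LipschitzOnWith K f₁ (Icc a b)) (h₂ : ∃ K, LipschitzOnWith K f₂ (Icc a b))
    (a₁ : AntitoneOn f₁ (Icc a b)) (a₂ : AntitoneOn f₂ (Icc a b))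
    (le : ∀ x ∈ Icc a b, f₁ x ≤ f₂ x) (left : f₂ a = f₁ a) (right : f₂ b = f₁ b)
    (fst : ∀ z ∈ lens f₂ f₁ a b, (F z).1 ≤ 0) (snd : ∀ z ∈ lens f₂ f₁ a b, 0 ≤ (F z).2)
    (fst_zero : ∀ x ∈ Icc a b, (F (x, f₂ x)).1 = 0) (snd_zero : ∀ x ∈ Icc a b, (F (x, f₁ x)).2 = 0)
    (zero : ∀ z ∈ lens f₂ f₁ a b, F z = 0 → z.1 = a ∨ z.1 = b) :
    LensField (fun z => -F (-z)) (fun x => -f₁ (-x)) (fun x => -f₂ (-x)) (-b) (-a) := by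
  have hI : ∀ x ∈ Icc (-b) (-a), -x ∈ Icc a b := fun x hx =>
    ⟨by linarith [hx.2], by linarith [hx.1]⟩
  have hL : ∀ z ∈ lens (fun x => -f₁ (-x)) (fun x => -f₂ (-x)) (-b) (-a), -z ∈ lens f₂ f₁ a b :=
    fun z hz => ⟨hI _ hz.1, le_neg_of_le_neg hz.2.2, neg_le_of_neg_le hz.2.1⟩
  have anti : ∀ f : ℝ → ℝ, AntitoneOn f (Icc a b) →
      AntitoneOn (fun x => -f (-x)) (Icc (-b) (-a)) := fun f hf x hx y hy hxy =>
    neg_le_neg (hf (hI y hy) (hI x hx) (neg_le_neg hxy))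
  obtain ⟨K, hK⟩ := lipschitz
  obtain ⟨K₁, hK₁⟩ := h₁
  obtain ⟨K₂, hK₂⟩ := h₂
  refine ⟨by linarith, ⟨K, lipschitzOnWith_reflect hK hL⟩, ⟨K₁, lipschitzOnWith_reflect hK₁ hI⟩,
    ⟨K₂, lipschitzOnWith_reflect hK₂ hI⟩, anti _ a₁, anti _ a₂, fun x hx => neg_le_neg (le _ (hI x hx)),
    by simp [right], by simp [left], fun z hz => neg_nonneg.2 (fst _ (hL z hz)),
    fun z hz => neg_nonpos.2 (snd _ (hL z hz)), fun x hx => ?_, fun x hx => ?_, fun z hz h0 => ?_⟩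
  · have := fst_zero _ (hI x hx)
    simpa using this
  · have := snd_zero _ (hI x hx)
    simpa using this
  · rcases zero _ (hL z hz) (neg_eq_zero.1 h0) with h | h
    · right; rw [Prod.fst_neg] at h; linarith
    · left; rw [Prod.fst_neg] at h; linarith

end PlanarFlow

/-! ### The planar profile system -/

namespace RelFluid

open Set PlanarFlow

variable {p : ℝ → ℝ}

/-- The planar system of the profile equations for the temperature `θ` and the velocity `T`
normal to the front. -/
def planarField (p κ₁ κ₂ : ℝ → ℝ) (q₀ q₁ : ℝ) (z : ℝ × ℝ) : ℝ × ℝ :=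
  ((z.2 * (q₁ + energy p z.1) - q₀) / (Real.sqrt (1 - z.2 ^ 2) * κ₁ z.1),
    Real.sqrt (1 - z.2 ^ 2) * (p z.1 + q₀ * z.2 - q₁) / κ₂ z.1)

theorem contDiffOn_planarField {κ₁ κ₂ : ℝ → ℝ} (hp : ContDiffOn ℝ ∞ p (Ioi 0))
    (h₁ : ContDiffOn ℝ ∞ κ₁ (Ioi 0)) (h₂ : ContDiffOn ℝ ∞ κ₂ (Ioi 0))
    (hκ₁ : ∀ θ, 0 < θ → 0 < κ₁ θ) (hκ₂ : ∀ θ, 0 < θ → 0 < κ₂ θ) (q₀ q₁ : ℝ) :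
    ContDiffOn ℝ ∞ (planarField p κ₁ κ₂ q₀ q₁) (Ioi 0 ×ˢ Ioo (-1) 1) := by
  have fst : ∀ {f : ℝ → ℝ}, ContDiffOn ℝ ∞ f (Ioi 0) →
      ContDiffOn ℝ ∞ (fun z : ℝ × ℝ => f z.1) (Ioi 0 ×ˢ Ioo (-1) 1) := fun hf =>
    hf.comp contDiffOn_fst fun z hz => hz.1
  have pos : ∀ z ∈ (Ioi 0 ×ˢ Ioo (-1) 1 : Set (ℝ × ℝ)), 0 < 1 - z.2 ^ 2 := fun z hz => by
    nlinarith [hz.2.1, hz.2.2]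
  have snd : ContDiffOn ℝ ∞ (fun z : ℝ × ℝ => z.2) (Ioi 0 ×ˢ Ioo (-1) 1) := contDiffOn_snd
  have root : ContDiffOn ℝ ∞ (fun z : ℝ × ℝ => Real.sqrt (1 - z.2 ^ 2)) (Ioi 0 ×ˢ Ioo (-1) 1) :=
    (contDiffOn_const.sub (snd.pow 2)).sqrt fun z hz => (pos z hz).ne'
  refine ContDiffOn.prodMk ?_ ?_
  · exact ((snd.mul (contDiffOn_const.add (fst (contDiffOn_energy hp)))).sub contDiffOn_const).div
      (root.mul (fst h₁)) fun z hz =>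
        (mul_pos (Real.sqrt_pos.2 (pos z hz)) (hκ₁ _ hz.1)).ne'
  · exact (root.mul (((fst hp).add (contDiffOn_const.mul snd)).sub contDiffOn_const)).div
      (fst h₂) fun z hz => (hκ₂ _ hz.1).ne'

theorem strictMonoOn_of_deriv {f f' : ℝ → ℝ} (h : ∀ x, 0 < x → HasDerivAt f (f' x) x)
    (hpos : ∀ x, 0 < x → 0 < f' x) : StrictMonoOn f (Ioi 0) := by
  refine strictMonoOn_of_deriv_pos (convex_Ioi 0)
    (fun x hx => (h x hx).continuousAt.continuousWithinAt) fun x hx => ?_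
  rw [interior_Ioi] at hx
  rw [(h x hx).deriv]
  exact hpos x hx

/-- The velocities at which the temperature, respectively the velocity, is stationary. -/
theorem nullclines (hp : ContDiffOn ℝ ∞ p (Ioi 0)) (hc : StrictlyCausal p) {q₀ q₁ a b : ℝ}
    (hq₀ : 0 < q₀) (ha : 0 < a) (hqa : 0 < q₁ + energy p a) :
    (∀ θ ∈ Icc a b, 0 < q₁ + energy p θ) ∧
    AntitoneOn (fun θ => (q₁ - p θ) / q₀) (Icc a b) ∧
    AntitoneOn (fun θ => q₀ / (q₁ + energy p θ)) (Icc a b) ∧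
    (∃ K, LipschitzOnWith K (fun θ => (q₁ - p θ) / q₀) (Icc a b)) ∧
    (∃ K, LipschitzOnWith K (fun θ => q₀ / (q₁ + energy p θ)) (Icc a b)) := by
  have hsub : Icc a b ⊆ Ioi 0 := fun x hx => ha.trans_le hx.1
  have hpm := strictMonoOn_of_deriv (fun x hx => hasDerivAt_of_contDiffOn hp hx)
    fun x hx => (hc.deriv_bounds hp hx).1
  have hem := strictMonoOn_of_deriv (fun x hx => deriv_energy hp hx) fun x hx =>
    (hc.deriv_bounds hp hx).1.trans (hc.deriv_bounds hp hx).2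
  have hpos : ∀ θ ∈ Ioi (0 : ℝ) ∩ Ici a, 0 < q₁ + energy p θ := fun θ hθ => by
    have := hem.monotoneOn ha hθ.1 hθ.2
    linarith
  have hE := contDiffOn_energy hp
  refine ⟨fun θ hθ => hpos θ ⟨hsub hθ, hθ.1⟩, fun x hx y hy hxy => ?_, fun x hx y hy hxy => ?_,
    ?_, ?_⟩
  · have := hpm.monotoneOn (hsub hx) (hsub hy) hxy
    exact div_le_div_of_nonneg_right (by linarith) hq₀.le
  · have := hem.monotoneOn (hsub hx) (hsub hy) hxy
    exact div_le_div_of_nonneg_left hq₀.le (hpos x ⟨hsub hx, hx.1⟩) (by linarith)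
  · exact exists_lipschitzOnWith_of_contDiffOn isOpen_Ioi
      ((contDiffOn_const.sub hp).div_const q₀) isCompact_Icc hsub
  · have hopen : IsOpen (Ioi (0 : ℝ) ∩ (fun θ => q₁ + energy p θ) ⁻¹' Ioi 0) :=
      (continuousOn_const.add hE.continuousOn).isOpen_inter_preimage isOpen_Ioi isOpen_Ioi
    refine exists_lipschitzOnWith_of_contDiffOn hopen ?_ isCompact_Icc
      fun x hx => ⟨hsub hx, hpos x ⟨hsub hx, hx.1⟩⟩
    exact contDiffOn_const.div (contDiffOn_const.add (hE.mono inter_subset_left))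
      fun x hx => (ne_of_gt hx.2)

/-- A heteroclinic orbit of the planar system. -/
theorem exists_planar_profile {κ₁ κ₂ : ℝ → ℝ} (hp : ContDiffOn ℝ ∞ p (Ioi 0))
    (hc : StrictlyCausal p) (hg : AcousticGenuinelyNonlinear p)
    (h₁ : ContDiffOn ℝ ∞ κ₁ (Ioi 0)) (h₂ : ContDiffOn ℝ ∞ κ₂ (Ioi 0))
    (hκ₁ : ∀ θ, 0 < θ → 0 < κ₁ θ) (hκ₂ : ∀ θ, 0 < θ → 0 < κ₂ θ) {q₀ q₁ θm θp Tm Tp : ℝ}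
    (hq₀ : 0 < q₀) (hθm : 0 < θm) (hθp : 0 < θp) (hTm : Tm ∈ Ioo 0 1) (hTp : Tp ∈ Ioo 0 1)
    (hm0 : q₀ * Tm = q₁ - p θm) (hm1 : Tm * (q₁ + energy p θm) = q₀)
    (hp0 : q₀ * Tp = q₁ - p θp) (hp1 : Tp * (q₁ + energy p θp) = q₀)
    (hm' : 0 < hugoniotDeriv p q₁ θm) (hp' : hugoniotDeriv p q₁ θp < 0) :
    ∃ γ : ℝ → ℝ × ℝ, (∀ t, HasDerivAt γ (planarField p κ₁ κ₂ q₀ q₁ (γ t)) t) ∧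
      (∀ t, γ t ∈ Ioi (0 : ℝ) ×ˢ Ioo (-1 : ℝ) 1) ∧
      Tendsto γ atBot (𝓝 (θm, Tm)) ∧ Tendsto γ atTop (𝓝 (θp, Tp)) := by
  set f₁ : ℝ → ℝ := fun θ => (q₁ - p θ) / q₀ with hf₁
  set f₂ : ℝ → ℝ := fun θ => q₀ / (q₁ + energy p θ) with hf₂
  have hEm : 0 < q₁ + energy p θm := pos_of_mul_pos_right (hm1 ▸ hq₀) hTm.1.le
  have hEp : 0 < q₁ + energy p θp := pos_of_mul_pos_right (hp1 ▸ hq₀) hTp.1.le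
  have e1m : f₁ θm = Tm := by rw [hf₁]; simp only; rw [← hm0]; field_simp
  have e1p : f₁ θp = Tp := by rw [hf₁]; simp only; rw [← hp0]; field_simp
  have e2m : f₂ θm = Tm := by rw [hf₂]; simp only; rw [div_eq_iff hEm.ne', hm1]
  have e2p : f₂ θp = Tp := by rw [hf₂]; simp only; rw [div_eq_iff hEp.ne', hp1]
  have gm : hugoniot p q₀ q₁ θm = 0 := by
    unfold hugoniot; rw [← hm0]; linear_combination q₀ * hm1
  have gp : hugoniot p q₀ q₁ θp = 0 := by
    unfold hugoniot; rw [← hp0]; linear_combination q₀ * hp1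
  -- The sign of the Hugoniot function decides which nullcline is the higher one.
  have diff : ∀ θ, 0 < q₁ + energy p θ →
      f₁ θ - f₂ θ = hugoniot p q₀ q₁ θ / (q₀ * (q₁ + energy p θ)) := by
    intro θ hθ
    simp only [hf₁, hf₂, hugoniot]
    field_simp
  have hsmooth := contDiffOn_planarField hp h₁ h₂ hκ₁ hκ₂ q₀ q₁
  have hopen : IsOpen (Ioi (0 : ℝ) ×ˢ Ioo (-1 : ℝ) 1) := isOpen_Ioi.prod isOpen_Ioo
  have fst_zero : ∀ θ, 0 < q₁ + energy p θ → (planarField p κ₁ κ₂ q₀ q₁ (θ, f₂ θ)).1 = 0 := by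
    intro θ hθ
    simp only [planarField, hf₂]
    rw [div_mul_cancel₀ _ hθ.ne', sub_self, zero_div]
  have snd_zero : ∀ θ, (planarField p κ₁ κ₂ q₀ q₁ (θ, f₁ θ)).2 = 0 := by
    intro θ
    simp only [planarField, hf₁]
    rw [mul_div_cancel₀ _ hq₀.ne']
    simp
  have sq : ∀ z ∈ Ioi (0 : ℝ) ×ˢ Ioo (-1 : ℝ) 1, 0 < Real.sqrt (1 - z.2 ^ 2) := fun z hz =>
    Real.sqrt_pos.2 (by nlinarith [hz.2.1, hz.2.2])
  -- Eliminating the velocity from the two equilibrium conditions leaves the Hugoniot equation for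
  -- the temperature.
  have zeros : ∀ z ∈ Ioi (0 : ℝ) ×ˢ Ioo (-1 : ℝ) 1, 0 < q₁ + energy p z.1 →
      planarField p κ₁ κ₂ q₀ q₁ z = 0 → hugoniot p q₀ q₁ z.1 = 0 := by
    intro z hz hE h0
    have a1 := congrArg Prod.fst h0
    have a2 := congrArg Prod.snd h0
    simp only [planarField, Prod.fst_zero, Prod.snd_zero] at a1 a2
    rw [div_eq_zero_iff] at a1 a2
    have b1 := a1.resolve_right (mul_pos (sq z hz) (hκ₁ _ hz.1)).ne'
    have b2 := (mul_eq_zero.1 (a2.resolve_right (hκ₂ _ hz.1).ne')).resolve_left (sq z hz).ne'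
    unfold hugoniot
    linear_combination q₀ * b1 - (q₁ + energy p z.1) * b2
  rcases hugoniot_sign hp hc hg hθm hθp gm gp hm' hp' with ⟨hlt, hsign⟩ | ⟨hlt, hsign⟩
  · obtain ⟨hE, anti₁, anti₂, lip₁, lip₂⟩ := nullclines hp hc (b := θp) hq₀ hθm hEm
    -- Both graphs decrease, so in the lens `Tp ≤ T ≤ Tm`: velocities stay away from that of light,
    -- where the field is singular.
    have hdom : lens f₁ f₂ θm θp ⊆ Ioi (0 : ℝ) ×ˢ Ioo (-1 : ℝ) 1 := by
      intro z hz
      have k1 := anti₂ hz.1 (right_mem_Icc.2 hlt.le) hz.1.2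
      have k2 := anti₁ (left_mem_Icc.2 hlt.le) hz.1 hz.1.1
      change f₂ θp ≤ f₂ z.1 at k1
      change f₁ z.1 ≤ f₁ θm at k2
      rw [e2p] at k1
      rw [e1m] at k2
      have k3 := hz.2
      exact ⟨hθm.trans_le hz.1.1, by linarith [hTp.1, k3.1], by linarith [hTm.2, k3.2]⟩
    have hle : ∀ θ ∈ Icc θm θp, f₂ θ ≤ f₁ θ := by
      intro θ hθ
      rcases hθ.1.eq_or_lt with h | h
      · rw [← h, e1m, e2m]
      rcases hθ.2.eq_or_lt with h' | h'
      · rw [h', e1p, e2p]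
      rw [← sub_nonneg, diff θ (hE θ hθ)]
      exact (div_pos (hsign θ ⟨h, h'⟩) (mul_pos hq₀ (hE θ hθ))).le
    have hcompact : IsCompact (lens f₁ f₂ θm θp) := by
      obtain ⟨K₁, l₁⟩ := lip₁
      obtain ⟨K₂, l₂⟩ := lip₂
      exact isCompact_lens hlt.le l₁ l₂ anti₁ anti₂ hle
    have hL : LensField (planarField p κ₁ κ₂ q₀ q₁) f₁ f₂ θm θp := by
      refine ⟨hlt, exists_lipschitzOnWith_of_contDiffOn hopen hsmooth hcompact hdom, lip₁, lip₂,
        anti₁, anti₂, hle, by rw [e1m, e2m], by rw [e1p, e2p], fun z hz => ?_, fun z hz => ?_,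
        fun θ hθ => fst_zero θ (hE θ hθ), fun θ _ => snd_zero θ, fun z hz h0 => ?_⟩
      · have h2 := hz.2.1
        simp only [hf₂] at h2
        rw [div_le_iff₀ (hE _ hz.1)] at h2
        exact div_nonneg (by linarith) (mul_pos (sq z (hdom hz)) (hκ₁ _ (hdom hz).1)).le
      · have h2 := hz.2.2
        simp only [hf₁] at h2
        rw [le_div_iff₀ hq₀] at h2
        exact div_nonpos_of_nonpos_of_nonneg
          (mul_nonpos_of_nonneg_of_nonpos (sq z (hdom hz)).le (by linarith)) (hκ₂ _ (hdom hz).1).le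
      · by_contra hne
        rw [not_or] at hne
        have := hsign z.1 ⟨lt_of_le_of_ne hz.1.1 (Ne.symm hne.1), lt_of_le_of_ne hz.1.2 hne.2⟩
        exact this.ne' (zeros z (hdom hz) (hE _ hz.1) h0)
    obtain ⟨γ, g1, g2, g3, g4⟩ := hL.exists_heteroclinic
    rw [e1m] at g3
    rw [e1p] at g4
    exact ⟨γ, g1, fun t => hdom (g2 t), g3, g4⟩
  · obtain ⟨hE, anti₁, anti₂, lip₁, lip₂⟩ := nullclines hp hc (b := θm) hq₀ hθp hEp
    have hdom : lens f₂ f₁ θp θm ⊆ Ioi (0 : ℝ) ×ˢ Ioo (-1 : ℝ) 1 := by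
      intro z hz
      have k1 := anti₁ hz.1 (right_mem_Icc.2 hlt.le) hz.1.2
      have k2 := anti₂ (left_mem_Icc.2 hlt.le) hz.1 hz.1.1
      change f₁ θm ≤ f₁ z.1 at k1
      change f₂ z.1 ≤ f₂ θp at k2
      rw [e1m] at k1
      rw [e2p] at k2
      have k3 := hz.2
      exact ⟨hθp.trans_le hz.1.1, by linarith [hTm.1, k3.1], by linarith [hTp.2, k3.2]⟩
    have hle : ∀ θ ∈ Icc θp θm, f₁ θ ≤ f₂ θ := by
      intro θ hθ
      rcases hθ.1.eq_or_lt with h | h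
      · rw [← h, e1p, e2p]
      rcases hθ.2.eq_or_lt with h' | h'
      · rw [h', e1m, e2m]
      rw [← sub_nonpos, diff θ (hE θ hθ)]
      exact (div_neg_of_neg_of_pos (hsign θ ⟨h, h'⟩) (mul_pos hq₀ (hE θ hθ))).le
    have hcompact : IsCompact (lens f₂ f₁ θp θm) := by
      obtain ⟨K₁, l₁⟩ := lip₁
      obtain ⟨K₂, l₂⟩ := lip₂
      exact isCompact_lens hlt.le l₂ l₁ anti₂ anti₁ hle
    -- With the temperatures in the opposite order the field points left and up. The reflection `z ↦
    -- -z` restores the standard form, and `-θm` becomes the left corner.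
    have hL := lensField_reflect hlt
      (exists_lipschitzOnWith_of_contDiffOn hopen hsmooth hcompact hdom) lip₁ lip₂ anti₁ anti₂ hle
      (e2p.trans e1p.symm) (e2m.trans e1m.symm)
      (fun z hz => by
        have h2 := hz.2.2
        simp only [hf₂] at h2
        rw [le_div_iff₀ (hE _ hz.1)] at h2
        exact div_nonpos_of_nonpos_of_nonneg (by linarith)
          (mul_pos (sq z (hdom hz)) (hκ₁ _ (hdom hz).1)).le)
      (fun z hz => by
        have h2 := hz.2.1
        simp only [hf₁] at h2
        rw [div_le_iff₀ hq₀] at h2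
        exact div_nonneg (mul_nonneg (sq z (hdom hz)).le (by linarith)) (hκ₂ _ (hdom hz).1).le)
      (fun θ hθ => fst_zero θ (hE θ hθ)) (fun θ _ => snd_zero θ)
      (fun z hz h0 => by
        by_contra hne
        rw [not_or] at hne
        have := hsign z.1 ⟨lt_of_le_of_ne hz.1.1 (Ne.symm hne.1), lt_of_le_of_ne hz.1.2 hne.2⟩
        exact this.ne (zeros z (hdom hz) (hE _ hz.1) h0))
    obtain ⟨γ, g1, g2, g3, g4⟩ := hL.exists_heteroclinic
    refine ⟨fun t => -γ t, fun t => ?_, fun t => hdom ?_, ?_, ?_⟩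
    · have := (g1 t).neg
      rwa [neg_neg] at this
    · obtain ⟨k1, k2, k3⟩ := g2 t
      exact ⟨⟨by simpa using le_neg_of_le_neg k1.2, by simpa using neg_le_of_neg_le k1.1⟩,
        by simpa using le_neg_of_le_neg k3, by simpa using neg_le_of_neg_le k2⟩
    · have := g3.neg
      simpa [e1m] using this
    · have := g4.neg
      simpa [e1p] using this

/-! ### The dissipation tensor on plane waves -/

variable {η ζ χ : ℝ → ℝ}

theorem sum_proj_flipIndex {U W : Vec4} (h : lorentz U W = 0) (α : Fin 4) :
    ∑ γ, proj U α γ * flipIndex W γ = W α := by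
  have e : ∑ γ, metric α γ * flipIndex W γ = W α := by
    rw [Finset.sum_eq_single α]
    · rw [flipIndex_apply, ← mul_assoc, metric_mul_self, one_mul]
    · intro β _ hβ; simp [metric, hβ.symm]
    · simp
  have e2 : ∑ γ, U γ * flipIndex W γ = 0 := h
  simp only [proj, add_mul, Finset.sum_add_distrib, e, mul_assoc, ← Finset.mul_sum, e2]
  ring

theorem sum_proj_covector (U ξ : Vec4) (α : Fin 4) :
    ∑ γ, proj U α γ * ξ γ = flipIndex ξ α + (ξ ⬝ᵥ U) * U α := by
  have e : ∑ γ, metric α γ * ξ γ = flipIndex ξ α := by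
    rw [flipIndex_apply, Finset.sum_eq_single α]
    · intro β _ hβ; simp [metric, hβ.symm]
    · simp
  have e2 : ∑ γ, U γ * ξ γ = ξ ⬝ᵥ U := dotProduct_comm U ξ
  simp only [proj, add_mul, Finset.sum_add_distrib, e, mul_assoc, ← Finset.mul_sum, e2]
  ring

/-- Idempotence of the projector, whose rows are orthogonal to `U` because `U` is a unit timelike
vector. -/
theorem sum_proj_metric {U : Vec4} (h : lorentz U U = -1) (α β : Fin 4) :
    ∑ γ, ∑ δ, proj U α γ * proj U β δ * metric γ δ = proj U α β := by
  have e : ∀ γ, ∑ δ, proj U α γ * proj U β δ * metric γ δ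
      = proj U α γ * flipIndex (fun γ => proj U β γ) γ := by
    intro γ
    rw [flipIndex_apply, Finset.sum_eq_single γ]
    · ring
    · intro δ _ hδ; simp [metric, hδ.symm]
    · simp
  have h0 : lorentz U (fun γ => proj U β γ) = 0 := by
    have e3 : ∑ γ, proj U β γ * flipIndex U γ = 0 := by
      have e4 : ∑ γ, metric β γ * flipIndex U γ = U β := by
        rw [Finset.sum_eq_single β]
        · rw [flipIndex_apply, ← mul_assoc, metric_mul_self, one_mul]
        · intro γ _ hγ; simp [metric, hγ.symm]
        · simp
      have e5 : ∑ γ, U γ * flipIndex U γ = -1 := h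
      simp only [proj, add_mul, Finset.sum_add_distrib, e4, mul_assoc, ← Finset.mul_sum, e5]
      ring
    rw [← e3, lorentz_eq]
    simp only [Fin.sum_univ_four, flipIndex_zero, flipIndex_one, flipIndex_two, flipIndex_three]
    ring
  simp only [e, sum_proj_flipIndex h0]
  simp [proj, metric, Matrix.diagonal_apply, eq_comm, mul_comm]
  split_ifs with hαβ
  · rw [hαβ]
  · rfl

/-- The dissipation of a plane wave, contracted with its covector `ξ`; `W` is the derivative of the
four-velocity and `τ` that of the temperature. -/
theorem sum_negDeltaT {ψ ξ W : Vec4} (τ : ℝ) (hU : lorentz (velocity ψ) (velocity ψ) = -1)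
    (hW : lorentz (velocity ψ) W = 0) (α : Fin 4) :
    ∑ β, ξ β * negDeltaT p η ζ χ ψ (fun γ δ => ξ δ * flipIndex W γ) (fun δ => ξ δ * τ) α β =
      η (temperature ψ) * ((lorentz ξ ξ + (ξ ⬝ᵥ velocity ψ) ^ 2) * W α
        + 1 / 3 * (ξ ⬝ᵥ W) * (flipIndex ξ α + (ξ ⬝ᵥ velocity ψ) * velocity ψ α))
      + zetaCheck p η ζ χ (temperature ψ) * (ξ ⬝ᵥ W)
        * (flipIndex ξ α + (ξ ⬝ᵥ velocity ψ) * velocity ψ α)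
      - sigmaCoeff p η ζ χ (temperature ψ) * (ξ ⬝ᵥ velocity ψ) ^ 2 * W α
      + χ (temperature ψ) * lorentz ξ ξ * τ * velocity ψ α := by
  set U := velocity ψ with hUd
  set s := ξ ⬝ᵥ U with hs
  set w := ξ ⬝ᵥ W with hw
  have hdiv : ∑ γ, ∑ δ, metric γ δ * (ξ δ * flipIndex W γ) = w := by
    have m00 : metric 0 0 = -1 := by simp [metric]
    have m11 : metric 1 1 = 1 := by simp [metric]
    have m22 : metric 2 2 = 1 := by simp [metric]
    have m33 : metric 3 3 = 1 := by simp [metric]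
    have mo : ∀ i j : Fin 4, i ≠ j → metric i j = 0 := fun i j hij => by simp [metric, hij]
    rw [hw, dotProduct_eq]
    simp [Fin.sum_univ_four, m00, m11, m22, m33, mo, flipIndex_zero, flipIndex_one, flipIndex_two,
      flipIndex_three]
  have pw : ∀ β, ∑ γ, proj U β γ * flipIndex W γ = W β := sum_proj_flipIndex hW
  have pξ : ∀ β, ∑ γ, proj U β γ * ξ γ = flipIndex ξ β + s * U β := sum_proj_covector U ξ
  have shear : ∀ β, ∑ γ, ∑ δ, proj U α γ * proj U β δ *
      (ξ δ * flipIndex W γ + ξ γ * flipIndex W δ - 2 / 3 * metric γ δ * w)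
      = W α * (flipIndex ξ β + s * U β) + (flipIndex ξ α + s * U α) * W β
        - 2 / 3 * w * proj U α β := by
    intro β
    rw [← sum_proj_metric hU α β, ← pw α, ← pw β, ← pξ α, ← pξ β]
    simp only [Fin.sum_univ_four]
    ring
  have accel : ∀ β, ∑ γ, ∑ δ, (proj U α γ * U β + proj U β γ * U α) * U δ * (ξ δ * flipIndex W γ)
      = (W α * U β + W β * U α) * s := by
    intro β
    rw [← pw α, ← pw β, hs]
    simp only [Fin.sum_univ_four, dotProduct]
    ring
  have heat : ∑ γ, U γ * (ξ γ * τ) = s * τ := by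
    rw [hs]; simp only [Fin.sum_univ_four, dotProduct]; ring
  have hflip : ∀ β, flipIndex (fun δ => ξ δ * τ) β = flipIndex ξ β * τ := by
    intro β; rw [flipIndex_apply, flipIndex_apply, mul_assoc]
  have c1 : ∑ β, ξ β * flipIndex ξ β = lorentz ξ ξ := rfl
  have c2 : ∑ β, ξ β * U β = s := rfl
  have c3 : ∑ β, ξ β * W β = w := rfl
  have c4 : ∑ β, ξ β * proj U α β = flipIndex ξ α + s * U α := by
    rw [← pξ α]; exact Finset.sum_congr rfl fun _ _ => mul_comm _ _
  have c5 : ∑ β, ξ β * metric α β = flipIndex ξ α := by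
    rw [flipIndex_apply, Finset.sum_eq_single α]
    · ring
    · intro β _ hβ; simp [metric, hβ.symm]
    · simp
  have expand : ∀ β, negDeltaT p η ζ χ ψ (fun γ δ => ξ δ * flipIndex W γ) (fun δ => ξ δ * τ) α β =
      η (temperature ψ) * (W α * (flipIndex ξ β + s * U β) + (flipIndex ξ α + s * U α) * W β
        - 2 / 3 * w * proj U α β)
      + zetaCheck p η ζ χ (temperature ψ) * proj U α β * w
      + sigmaCoeff p η ζ χ (temperature ψ) * (U α * U β * w - (W α * U β + W β * U α) * s)
      + χ (temperature ψ) * ((U α * (flipIndex ξ β * τ) + U β * (flipIndex ξ α * τ))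
        - metric α β * (s * τ)) := by
    intro β
    unfold negDeltaT
    simp only [← hUd, hdiv, shear, accel, heat, hflip]
  simp only [expand]
  generalize η (temperature ψ) = η'
  generalize zetaCheck p η ζ χ (temperature ψ) = ζ'
  generalize sigmaCoeff p η ζ χ (temperature ψ) = σ'
  generalize χ (temperature ψ) = χ'
  have lin : ∑ β, ξ β * (η' * (W α * (flipIndex ξ β + s * U β) + (flipIndex ξ α + s * U α) * W β
        - 2 / 3 * w * proj U α β) + ζ' * proj U α β * w
      + σ' * (U α * U β * w - (W α * U β + W β * U α) * s)
      + χ' * ((U α * (flipIndex ξ β * τ) + U β * (flipIndex ξ α * τ)) - metric α β * (s * τ)))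
      = η' * (W α * ((∑ β, ξ β * flipIndex ξ β) + s * ∑ β, ξ β * U β)
          + (flipIndex ξ α + s * U α) * (∑ β, ξ β * W β) - 2 / 3 * w * ∑ β, ξ β * proj U α β)
        + ζ' * (∑ β, ξ β * proj U α β) * w
        + σ' * (U α * (∑ β, ξ β * U β) * w
          - (W α * (∑ β, ξ β * U β) + (∑ β, ξ β * W β) * U α) * s)
        + χ' * ((U α * ((∑ β, ξ β * flipIndex ξ β) * τ)
          + (∑ β, ξ β * U β) * (flipIndex ξ α * τ)) - (∑ β, ξ β * metric α β) * (s * τ)) := by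
    simp only [Fin.sum_univ_four]
    ring
  -- Two cancellations shape the result: the heat terms along `ξ` drop out, so that `τ` enters only
  -- along `U`, and so do the `σ`-terms along `U`, which leaves the acceleration.
  rw [lin, c1, c2, c3, c4, c5]
  ring

theorem idealFlux_eq (p : ℝ → ℝ) (ξ ψ : Vec4) (α : Fin 4) :
    idealFlux p ξ ψ α = temperature ψ ^ 3 * deriv p (temperature ψ) * (ξ ⬝ᵥ ψ) * ψ α
      + p (temperature ψ) * flipIndex ξ α := by
  have c5 : ∑ β, ξ β * metric α β = flipIndex ξ α := by
    rw [flipIndex_apply, Finset.sum_eq_single α]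
    · ring
    · intro β _ hβ; simp [metric, hβ.symm]
    · simp
  rw [← c5]
  simp only [idealFlux, idealT, dotProduct, Fin.sum_univ_four]
  ring

/-- With `σ` as in `sigmaCoeff`, the effective longitudinal viscosity equals `σ`. -/
theorem longitudinal_viscosity {θ : ℝ} (h : soundSq p θ < 1) :
    4 / 3 * η θ + zetaCheck p η ζ χ θ = sigmaCoeff p η ζ χ θ := by
  have : (1 - soundSq p θ) ≠ 0 := by linarith
  unfold zetaCheck sigmaCoeff
  field_simp
  ring

/-! ### Frames adapted to the front -/

/-- An orthonormal frame of a timelike plane: `e` is future-directed and timelike, `x` is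
spacelike. -/
structure IsFrame (e x : Vec4) : Prop where
  timelike : lorentz e e = -1
  spacelike : lorentz x x = 1
  orthogonal : lorentz e x = 0
  future : 0 < e 0

theorem lorentz_comb (a b c d : ℝ) (e x : Vec4) :
    lorentz (a • e + b • x) (c • e + d • x) =
      a * c * lorentz e e + (a * d + b * c) * lorentz e x + b * d * lorentz x x := by
  simp only [lorentz_eq, Pi.add_apply, Pi.smul_apply, smul_eq_mul]
  ring

/-- Cauchy-Schwarz for the spatial parts gives `x₀² + 1 ≤ e₀²`. This keeps `e + T x` future-directed
for all `|T| < 1`. -/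
theorem abs_time_lt {e x : Vec4} (ht : lorentz e e = -1) (hs : lorentz x x = 1)
    (ho : lorentz e x = 0) : |x 0| < |e 0| := by
  rw [← sq_lt_sq]
  rw [lorentz_eq] at ht hs ho
  have hcs := Finset.sum_mul_sq_le_sq_mul_sq Finset.univ (fun j : Fin 3 => e j.succ)
    (fun j => x j.succ)
  have e1 : (Fin.succ 0 : Fin 4) = 1 := rfl
  have e2 : (Fin.succ 1 : Fin 4) = 2 := rfl
  have e3 : (Fin.succ 2 : Fin 4) = 3 := rfl
  simp only [Fin.sum_univ_three, e1, e2, e3] at hcs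
  have h1 : e 1 * x 1 + e 2 * x 2 + e 3 * x 3 = e 0 * x 0 := by linarith
  have h2 : e 1 ^ 2 + e 2 ^ 2 + e 3 ^ 2 = e 0 ^ 2 - 1 := by linarith
  have h3 : x 1 ^ 2 + x 2 ^ 2 + x 3 ^ 2 = x 0 ^ 2 + 1 := by linarith
  rw [h1, h2, h3] at hcs
  nlinarith

/-- The Lorentz factor of the velocity `T`. -/
def lorentzFactor (T : ℝ) : ℝ := (Real.sqrt (1 - T ^ 2))⁻¹

theorem one_sub_sq_pos {T : ℝ} (hT : T ∈ Ioo (-1) 1) : 0 < 1 - T ^ 2 := by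
  nlinarith [hT.1, hT.2]

theorem lorentzFactor_pos {T : ℝ} (hT : T ∈ Ioo (-1) 1) : 0 < lorentzFactor T :=
  inv_pos.2 (Real.sqrt_pos.2 (one_sub_sq_pos hT))

theorem lorentzFactor_sq {T : ℝ} (hT : T ∈ Ioo (-1) 1) : lorentzFactor T ^ 2 * (1 - T ^ 2) = 1 := by
  have := one_sub_sq_pos hT
  unfold lorentzFactor
  rw [inv_pow, Real.sq_sqrt this.le, inv_mul_cancel₀ this.ne']

theorem contDiffOn_lorentzFactor : ContDiffOn ℝ ∞ lorentzFactor (Ioo (-1) 1) :=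
  ((contDiffOn_const.sub (contDiffOn_id.pow 2)).sqrt fun _ hT => (one_sub_sq_pos hT).ne').inv
    fun _ hT => (Real.sqrt_pos.2 (one_sub_sq_pos hT)).ne'

theorem hasDerivAt_lorentzFactor {T : ℝ} (hT : T ∈ Ioo (-1) 1) :
    HasDerivAt lorentzFactor (T * lorentzFactor T ^ 3) T := by
  have h1 := one_sub_sq_pos hT
  have h2 : HasDerivAt (fun T : ℝ => 1 - T ^ 2) (-(2 * T)) T := by
    simpa using (hasDerivAt_pow 2 T).const_sub 1
  have h3 := (h2.sqrt h1.ne').fun_inv (Real.sqrt_pos.2 h1).ne'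
  refine h3.congr_deriv ?_
  have h4 := (Real.sqrt_pos.2 h1).ne'
  unfold lorentzFactor
  field_simp

/-- The four-velocity with velocity `T` in the plane of the frame. -/
def frameVelocity (e x : Vec4) (T : ℝ) : Vec4 :=
  lorentzFactor T • e + (T * lorentzFactor T) • x

/-- The unit vector orthogonal to `frameVelocity` in the plane of the frame. -/
def frameNormal (e x : Vec4) (T : ℝ) : Vec4 :=
  (T * lorentzFactor T) • e + lorentzFactor T • x

/-- The state of temperature `θ` and four-velocity `frameVelocity e x T`. -/
def frameState (e x : Vec4) (θ T : ℝ) : Vec4 := θ⁻¹ • frameVelocity e x T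

/-- `frameNormal` is the derivative with respect to the rapidity `artanh T`, whose own derivative is
`lorentzFactor T ^ 2`. -/
theorem hasDerivAt_frameVelocity (e x : Vec4) {T : ℝ} (hT : T ∈ Ioo (-1) 1) :
    HasDerivAt (frameVelocity e x) (lorentzFactor T ^ 2 • frameNormal e x T) T := by
  have h1 := hasDerivAt_lorentzFactor hT
  have h2 := (h1.smul_const e).add (((hasDerivAt_id T).mul h1).smul_const x)
  refine h2.congr_deriv ?_
  have h3 := lorentzFactor_sq hT
  unfold frameNormal
  rw [smul_add, smul_smul, smul_smul]
  congr 2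
  · ring
  · simp only [id]
    linear_combination (-lorentzFactor T) * h3

namespace IsFrame

variable {e x : Vec4}

theorem velocity_unit (h : IsFrame e x) {T : ℝ} (hT : T ∈ Ioo (-1) 1) :
    lorentz (frameVelocity e x T) (frameVelocity e x T) = -1 := by
  unfold frameVelocity
  rw [lorentz_comb, h.timelike, h.spacelike, h.orthogonal]
  linear_combination -lorentzFactor_sq hT

theorem velocity_normal (h : IsFrame e x) (T : ℝ) :
    lorentz (frameVelocity e x T) (frameNormal e x T) = 0 := by
  unfold frameVelocity frameNormal
  rw [lorentz_comb, h.timelike, h.spacelike, h.orthogonal]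
  ring

theorem velocity_future (h : IsFrame e x) {T : ℝ} (hT : T ∈ Ioo (-1) 1) :
    0 < frameVelocity e x T 0 := by
  have h1 := abs_time_lt h.timelike h.spacelike h.orthogonal
  rw [abs_of_pos h.future] at h1
  have h2 : |T * x 0| < e 0 := by
    rw [abs_mul]
    have := abs_lt.2 hT
    have h3 := abs_nonneg (x 0)
    nlinarith [abs_nonneg T]
  have h4 := neg_abs_le (T * x 0)
  have h5 : frameVelocity e x T 0 = lorentzFactor T * (e 0 + T * x 0) := by
    simp only [frameVelocity, Pi.add_apply, Pi.smul_apply, smul_eq_mul]; ring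
  rw [h5]
  exact mul_pos (lorentzFactor_pos hT) (by linarith)

theorem lorentz_state (h : IsFrame e x) {θ T : ℝ} (hT : T ∈ Ioo (-1) 1) :
    lorentz (frameState e x θ T) (frameState e x θ T) = -(θ⁻¹ * θ⁻¹) := by
  have h1 := h.velocity_unit hT
  rw [lorentz_eq] at h1 ⊢
  simp only [frameState, Pi.smul_apply, smul_eq_mul]
  linear_combination (θ⁻¹ * θ⁻¹) * h1

theorem state_mem (h : IsFrame e x) {θ T : ℝ} (hθ : 0 < θ) (hT : T ∈ Ioo (-1) 1) :
    frameState e x θ T ∈ stateSpace := by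
  have := inv_pos.2 hθ
  refine ⟨?_, mul_pos this (h.velocity_future hT)⟩
  rw [h.lorentz_state hT]
  exact neg_neg_of_pos (mul_pos this this)

theorem temperature_state (h : IsFrame e x) {θ T : ℝ} (hθ : 0 < θ) (hT : T ∈ Ioo (-1) 1) :
    temperature (frameState e x θ T) = θ := by
  unfold temperature
  rw [h.lorentz_state hT, neg_neg, Real.sqrt_mul_self (inv_pos.2 hθ).le, inv_inv]

theorem velocity_state (h : IsFrame e x) {θ T : ℝ} (hθ : 0 < θ) (hT : T ∈ Ioo (-1) 1) :
    velocity (frameState e x θ T) = frameVelocity e x T := by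
  unfold velocity
  rw [h.temperature_state hθ hT, frameState, smul_smul, mul_inv_cancel₀ hθ.ne', one_smul]

end IsFrame

theorem dotProduct_flipIndex_comb (l a b : ℝ) (e x : Vec4) :
    (l • flipIndex x) ⬝ᵥ (a • e + b • x) = l * (a * lorentz e x + b * lorentz x x) := by
  rw [dotProduct_eq, lorentz_eq, lorentz_eq]
  simp only [Pi.add_apply, Pi.smul_apply, smul_eq_mul, flipIndex_zero, flipIndex_one,
    flipIndex_two, flipIndex_three]
  ring

theorem flipIndex_flipIndex (v : Vec4) : flipIndex (flipIndex v) = v := by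
  ext α
  rw [flipIndex_apply, flipIndex_apply, ← mul_assoc, metric_mul_self, one_mul]

theorem flipIndex_smul (l : ℝ) (v : Vec4) : flipIndex (l • v) = l • flipIndex v := by
  ext α
  simp only [flipIndex_apply, Pi.smul_apply, smul_eq_mul]
  ring

namespace IsFrame

variable {e x : Vec4}

/-- The flux through a front which is orthogonal to `x`. -/
theorem flux_state (h : IsFrame e x) {l θ T : ℝ} (hθ : 0 < θ) (hT : T ∈ Ioo (-1) 1) (α : Fin 4) :
    idealFlux p (l • flipIndex x) (frameState e x θ T) α =
      l * (θ * deriv p θ * T * lorentzFactor T ^ 2 * e α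
        + (θ * deriv p θ * T ^ 2 * lorentzFactor T ^ 2 + p θ) * x α) := by
  rw [idealFlux_eq, h.temperature_state hθ hT, flipIndex_smul, flipIndex_flipIndex]
  have : (l • flipIndex x) ⬝ᵥ frameState e x θ T = θ⁻¹ * (l * (T * lorentzFactor T)) := by
    rw [frameState, dotProduct_smul, frameVelocity, dotProduct_flipIndex_comb, h.spacelike,
      h.orthogonal, smul_eq_mul]
    ring
  rw [this]
  simp only [frameState, frameVelocity, Pi.add_apply, Pi.smul_apply, smul_eq_mul]
  field_simp
  ring

/-- For `l ≠ 0` the sign is that of `T² - c_s²`: a positive form means that the fluid crosses the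
front at supersonic speed. -/
theorem acousticForm_state (h : IsFrame e x) {l θ T : ℝ} (hθ : 0 < θ) (hT : T ∈ Ioo (-1) 1) :
    acousticForm p (l • flipIndex x) (frameState e x θ T) =
      l ^ 2 * lorentzFactor T ^ 2 * (θ * deriv (deriv p) θ * T ^ 2 - deriv p θ) := by
  have h1 : (l • flipIndex x) ⬝ᵥ frameState e x θ T = θ⁻¹ * (l * (T * lorentzFactor T)) := by
    rw [frameState, dotProduct_smul, frameVelocity, dotProduct_flipIndex_comb, h.spacelike,
      h.orthogonal, smul_eq_mul]
    ring
  have h2 : lorentz (l • flipIndex x) (l • flipIndex x) = l ^ 2 := by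
    have := lorentz_flipIndex_self x
    rw [h.spacelike, lorentz_eq] at this
    rw [lorentz_eq]
    simp only [Pi.smul_apply, smul_eq_mul]
    linear_combination l ^ 2 * this
  rw [acousticForm, h.temperature_state hθ hT, h1, h2]
  field_simp
  linear_combination (l ^ 2 * deriv p θ) * lorentzFactor_sq hT

end IsFrame

/-- Each state which crosses the front in the positive direction is a frame state. -/
theorem exists_frame {ψ x : Vec4} {l : ℝ} (hψ : ψ ∈ stateSpace) (hx : lorentz x x = 1) (hl : 0 < l)
    (hpos : 0 < (l • flipIndex x) ⬝ᵥ ψ) :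
    ∃ e, IsFrame e x ∧ ∃ T ∈ Ioo (0 : ℝ) 1, ψ = frameState e x (temperature ψ) T := by
  have hθ := temperature_pos hψ
  have hsq := temperature_sq hψ
  set θ := temperature ψ
  -- `S` and `C` are the hyperbolic sine and cosine of the rapidity of `U` along `x`, and `T` is its
  -- hyperbolic tangent; `e` is the normalized part of `U` orthogonal to `x`.
  set S := θ * lorentz ψ x with hS
  have hxψ : (l • flipIndex x) ⬝ᵥ ψ = l * lorentz ψ x := by
    rw [dotProduct_eq, lorentz_eq]
    simp only [Pi.smul_apply, smul_eq_mul, flipIndex_zero, flipIndex_one,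
      flipIndex_two, flipIndex_three]
    ring
  rw [hxψ] at hpos
  have hSpos : 0 < S := mul_pos hθ (pos_of_mul_pos_right hpos hl.le)
  set C := Real.sqrt (1 + S ^ 2) with hC
  have hCsq : C ^ 2 = 1 + S ^ 2 := Real.sq_sqrt (by positivity)
  have hCpos : 0 < C := Real.sqrt_pos.2 (by positivity)
  have hSC : S < C := lt_of_pow_lt_pow_left₀ 2 hCpos.le (by linarith)
  set T := S / C with hTd
  have hT : T ∈ Ioo (0 : ℝ) 1 := ⟨div_pos hSpos hCpos, (div_lt_one hCpos).2 hSC⟩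
  have hTC : T * C = S := div_mul_cancel₀ _ hCpos.ne'
  have hfac : lorentzFactor T = C := by
    have hpos' := one_sub_sq_pos (T := T) ⟨by linarith [hT.1], hT.2⟩
    have h1 : 1 - T ^ 2 = (C⁻¹) ^ 2 := by
      rw [hTd]; field_simp; linarith
    unfold lorentzFactor
    rw [h1, Real.sqrt_sq (inv_pos.2 hCpos).le, inv_inv]
  set e : Vec4 := C⁻¹ • (θ • ψ + (-S) • x) with he
  have hdec : θ • ψ = C • e + S • x := by
    rw [he, smul_smul, mul_inv_cancel₀ hCpos.ne', one_smul, neg_smul, neg_add_cancel_right]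
  have hψψ : lorentz (θ • ψ) (θ • ψ) = -1 := by
    rw [lorentz_eq] at hsq ⊢
    simp only [Pi.smul_apply, smul_eq_mul]
    linarith
  have hψx : lorentz (θ • ψ) x = S := by
    rw [hS, lorentz_eq, lorentz_eq]
    simp only [Pi.smul_apply, smul_eq_mul]
    ring
  have hee : lorentz e e = -1 := by
    have h1 : lorentz e e = C⁻¹ ^ 2 * (lorentz (θ • ψ) (θ • ψ) - 2 * S * lorentz (θ • ψ) x
        + S ^ 2 * lorentz x x) := by
      simp only [he, lorentz_eq, Pi.add_apply, Pi.smul_apply, smul_eq_mul]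
      ring
    rw [h1, hψψ, hψx, hx]
    field_simp
    linarith
  have hex : lorentz e x = 0 := by
    have h1 : lorentz e x = C⁻¹ * (lorentz (θ • ψ) x - S * lorentz x x) := by
      simp only [he, lorentz_eq, Pi.add_apply, Pi.smul_apply, smul_eq_mul]
      ring
    rw [h1, hψx, hx]
    ring
  have hfut : 0 < e 0 := by
    by_contra hneg
    have h1 := abs_time_lt hee hx hex
    rw [abs_of_nonpos (not_lt.1 hneg)] at h1
    have h2 : 0 < (θ • ψ) 0 := mul_pos hθ hψ.2
    rw [hdec] at h2
    simp only [Pi.add_apply, Pi.smul_apply, smul_eq_mul] at h2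
    have h3 := le_abs_self (x 0)
    have h4 : S * x 0 ≤ S * |x 0| := mul_le_mul_of_nonneg_left h3 hSpos.le
    have h5 : S * |x 0| ≤ C * |x 0| := mul_le_mul_of_nonneg_right hSC.le (abs_nonneg _)
    have h6 : C * |x 0| < C * -e 0 := mul_lt_mul_of_pos_left h1 hCpos
    linarith
  refine ⟨e, ⟨hee, hx, hex, hfut⟩, T, hT, ?_⟩
  rw [frameState, frameVelocity, hfac, hTC, ← hdec, smul_smul, inv_mul_cancel₀ hθ.ne', one_smul]

/-- The profile equation in the components of a frame, given the planar system. -/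
theorem profile_equation_components {l T k h z σ c T' θ' P R q₀ q₁ E X : ℝ}
    (hk : k ^ 2 * (1 - T ^ 2) = 1) (hσ : 4 / 3 * h + z = σ)
    (hT : l * σ * k * T' = P + q₀ * T - q₁) (hθ : l * c * θ' = k * (T * (q₁ + R) - q₀)) :
    h * ((l ^ 2 + (l * (T * k)) ^ 2) * (T' * (k ^ 2 * (T * k * E + k * X)))
        + 1 / 3 * (T' * (k ^ 2 * (l * k))) * (l * X + l * (T * k) * (k * E + T * k * X)))
      + z * (T' * (k ^ 2 * (l * k))) * (l * X + l * (T * k) * (k * E + T * k * X))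
      - σ * (l * (T * k)) ^ 2 * (T' * (k ^ 2 * (T * k * E + k * X)))
      + c * l ^ 2 * θ' * (k * E + T * k * X) =
    l * ((P + R) * T * k ^ 2 * E + ((P + R) * T ^ 2 * k ^ 2 + P) * X) - l * (q₀ * E + q₁ * X) := by
  -- The part of `ξ` orthogonal to `U` is `l k` times `frameNormal`, and the next identity is its
  -- Lorentz square.
  have e1 : l * X + l * (T * k) * (k * E + T * k * X) = l * k * (T * k * E + k * X) := by
    linear_combination (-l * X) * hk
  have e2 : l ^ 2 + (l * (T * k)) ^ 2 = l ^ 2 * k ^ 2 := by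
    linear_combination (-l ^ 2) * hk
  rw [e1, e2]
  -- Viscosity contributes `σ k²` and acceleration `-σ T² k²`, which add up to `σ`; the total is
  -- purely along the normal to `U`.
  have e3 : h * (l ^ 2 * k ^ 2 * (T' * (k ^ 2 * (T * k * E + k * X)))
        + 1 / 3 * (T' * (k ^ 2 * (l * k))) * (l * k * (T * k * E + k * X)))
      + z * (T' * (k ^ 2 * (l * k))) * (l * k * (T * k * E + k * X))
      - σ * (l * (T * k)) ^ 2 * (T' * (k ^ 2 * (T * k * E + k * X)))
      = l * k * (l * σ * k * T') * (T * k * E + k * X) := by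
    linear_combination (l ^ 2 * k ^ 4 * T' * (T * k * E + k * X)) * hσ
      + (σ * l ^ 2 * k ^ 2 * T' * (T * k * E + k * X)) * hk
  have e4 : c * l ^ 2 * θ' * (k * E + T * k * X) = l * (l * c * θ') * (k * E + T * k * X) := by ring
  rw [e3, e4, hT, hθ]
  linear_combination (-l * q₀ * E - l * (q₁ - P) * X) * hk

/-- Since `θ p'' > p' > 0`, the form is nonnegative on covectors that are not spacelike; a subsonic
state thus forces the front to be slower than light. -/
theorem lorentz_self_pos_of_acousticForm_neg (hp : ContDiffOn ℝ ∞ p (Ioi 0))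
    (hc : StrictlyCausal p) {ξ ψ : Vec4} (h : ψ ∈ stateSpace) (hneg : acousticForm p ξ ψ < 0) :
    0 < lorentz ξ ξ := by
  have hθ := temperature_pos h
  obtain ⟨b1, b2⟩ := hc.deriv_bounds hp hθ
  have e : acousticForm p ξ ψ = temperature ψ ^ 2 * (ξ ⬝ᵥ ψ) ^ 2
      * (temperature ψ * deriv (deriv p) (temperature ψ) - deriv p (temperature ψ))
      - deriv p (temperature ψ) * lorentz ξ ξ := by
    unfold acousticForm; ring
  have h1 : 0 ≤ temperature ψ ^ 2 * (ξ ⬝ᵥ ψ) ^ 2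
      * (temperature ψ * deriv (deriv p) (temperature ψ) - deriv p (temperature ψ)) :=
    mul_nonneg (by positivity) (by linarith)
  exact pos_of_mul_pos_right (by linarith) b1.le

/-- The flux determines the frame and the flux constants. -/
theorem frame_flux_unique {e e' x : Vec4} (h : IsFrame e x) (h' : IsFrame e' x) {a a' b b' : ℝ}
    (ha : 0 < a) (ha' : 0 < a') (heq : ∀ α, a * e α + b * x α = a' * e' α + b' * x α) :
    e = e' ∧ a = a' ∧ b = b' := by
  have hvec : a • e + b • x = a' • e' + b' • x := by
    ext α; simpa using heq α
  have hb : b = b' := by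
    have h1 := lorentz_comb a b 0 1 e x
    have h2 := lorentz_comb a' b' 0 1 e' x
    rw [h.timelike, h.spacelike, h.orthogonal] at h1
    rw [h'.timelike, h'.spacelike, h'.orthogonal] at h2
    have h3 : ∀ v w : Vec4, (0 : ℝ) • v + (1 : ℝ) • w = w := fun v w => by simp
    rw [h3] at h1 h2
    rw [hvec, h2] at h1
    linarith
  have haa : a = a' := by
    have h1 := lorentz_comb a b a b e x
    have h2 := lorentz_comb a' b' a' b' e' x
    rw [h.timelike, h.spacelike, h.orthogonal] at h1
    rw [h'.timelike, h'.spacelike, h'.orthogonal, ← hvec, h1, hb] at h2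
    have h3 : a ^ 2 = a' ^ 2 := by linarith
    exact (pow_left_inj₀ ha.le ha'.le two_ne_zero).1 h3
  refine ⟨?_, haa, hb⟩
  ext α
  have := heq α
  rw [← haa, ← hb] at this
  exact mul_left_cancel₀ ha.ne' (add_right_cancel this)

theorem contDiffOn_sigmaCoeff (hp : ContDiffOn ℝ ∞ p (Ioi 0)) (hc : StrictlyCausal p)
    (hη : ContDiffOn ℝ ∞ η (Ioi 0)) (hζ : ContDiffOn ℝ ∞ ζ (Ioi 0))
    (hχ : ContDiffOn ℝ ∞ χ (Ioi 0)) : ContDiffOn ℝ ∞ (sigmaCoeff p η ζ χ) (Ioi 0) := by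
  have hs := contDiffOn_soundSq hp hc
  exact (((contDiffOn_const.mul hη).add hζ).div (contDiffOn_const.sub hs) fun θ hθ =>
    (sub_pos.2 (soundSq_bounds hp hc hθ).2).ne').sub ((hs.mul hχ).mul contDiffOn_id)

theorem contDiffOn_frameState (e x : Vec4) :
    ContDiffOn ℝ ∞ (fun z : ℝ × ℝ => frameState e x z.1 z.2) (Ioi 0 ×ˢ Ioo (-1) 1) := by
  have h1 : ContDiffOn ℝ ∞ (fun z : ℝ × ℝ => lorentzFactor z.2) (Ioi 0 ×ˢ Ioo (-1) 1) :=
    contDiffOn_lorentzFactor.comp contDiffOn_snd fun z hz => hz.2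
  have h2 : ContDiffOn ℝ ∞ (fun z : ℝ × ℝ => z.1⁻¹) (Ioi 0 ×ˢ Ioo (-1) 1) :=
    contDiffOn_fst.inv fun z hz => (ne_of_gt hz.1)
  exact h2.smul ((h1.smul contDiffOn_const).add ((contDiffOn_snd.mul h1).smul contDiffOn_const))

/-- Along a solution of the planar system, the frame states solve the profile equation. -/
theorem IsFrame.profile_equation {e x : Vec4} (h : IsFrame e x) {l q₀ q₁ : ℝ} (hl : 0 < l)
    (hs : ∀ θ, 0 < θ → soundSq p θ < 1) (hχ : ∀ θ, 0 < θ → 0 < χ θ)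
    (hσ : ∀ θ, 0 < θ → 0 < sigmaCoeff p η ζ χ θ) {γ : ℝ → ℝ × ℝ}
    (hγ : ∀ t, HasDerivAt γ (planarField p (fun θ => l * χ θ)
      (fun θ => l * sigmaCoeff p η ζ χ θ) q₀ q₁ (γ t)) t)
    (hmem : ∀ t, γ t ∈ Ioi (0 : ℝ) ×ˢ Ioo (-1 : ℝ) 1) (y : ℝ) (α : Fin 4) :
    ∑ β, (l • flipIndex x) β * waveNegDeltaT p η ζ χ (l • flipIndex x)
        (fun t => frameState e x (γ t).1 (γ t).2) y α β =
      idealFlux p (l • flipIndex x) (frameState e x (γ y).1 (γ y).2) α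
        - l * (q₀ * e α + q₁ * x α) := by
  have hvel : ∀ t, velocity (frameState e x (γ t).1 (γ t).2) = frameVelocity e x (γ t).2 :=
    fun t => h.velocity_state (hmem t).1 (hmem t).2
  have htemp : ∀ t, temperature (frameState e x (γ t).1 (γ t).2) = (γ t).1 :=
    fun t => h.temperature_state (hmem t).1 (hmem t).2
  have hθ' := PlanarFlow.hasDerivAt_fst_comp (hγ y)
  have hT' := PlanarFlow.hasDerivAt_snd_comp (hγ y)
  obtain ⟨hθ, hT⟩ := hmem y
  set F := planarField p (fun θ => l * χ θ) (fun θ => l * sigmaCoeff p η ζ χ θ) q₀ q₁ (γ y) with hF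
  set W : Vec4 := F.2 • (lorentzFactor (γ y).2 ^ 2 • frameNormal e x (γ y).2) with hW
  have hU' : HasDerivAt (fun t => frameVelocity e x (γ t).2) W y :=
    HasDerivAt.scomp y (hasDerivAt_frameVelocity e x hT) hT'
  have hdU : ∀ i, deriv (fun t => flipIndex (velocity (frameState e x (γ t).1 (γ t).2)) i) y
      = flipIndex W i := by
    intro i
    have h1 : HasDerivAt (fun t => frameVelocity e x (γ t).2 i) (W i) y := hasDerivAt_pi.1 hU' i
    have h2 : (fun t => flipIndex (velocity (frameState e x (γ t).1 (γ t).2)) i)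
        = fun t => metric i i * frameVelocity e x (γ t).2 i := by
      funext t; rw [hvel, flipIndex_apply]
    rw [h2, (h1.const_mul (metric i i)).deriv, flipIndex_apply]
  have hdθ : deriv (fun t => temperature (frameState e x (γ t).1 (γ t).2)) y = F.1 := by
    simp only [htemp]; exact hθ'.deriv
  unfold waveNegDeltaT
  simp only [hdU, hdθ]
  have hWU : lorentz (frameVelocity e x (γ y).2) W = 0 := by
    have h1 := h.velocity_normal (γ y).2
    rw [lorentz_eq] at h1 ⊢
    simp only [hW, Pi.smul_apply, smul_eq_mul]
    linear_combination (F.2 * lorentzFactor (γ y).2 ^ 2) * h1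
  rw [sum_negDeltaT F.1 (by rw [hvel]; exact h.velocity_unit hT) (by rw [hvel]; exact hWU),
    hvel, htemp, h.flux_state hθ hT]
  have d1 : (l • flipIndex x) ⬝ᵥ frameVelocity e x (γ y).2
      = l * ((γ y).2 * lorentzFactor (γ y).2) := by
    rw [frameVelocity, dotProduct_flipIndex_comb, h.spacelike, h.orthogonal]; ring
  have d2 : (l • flipIndex x) ⬝ᵥ W
      = F.2 * (lorentzFactor (γ y).2 ^ 2 * (l * lorentzFactor (γ y).2)) := by
    rw [hW, dotProduct_smul, dotProduct_smul, frameNormal, dotProduct_flipIndex_comb, h.spacelike,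
      h.orthogonal, smul_eq_mul, smul_eq_mul]
    ring
  have d3 : lorentz (l • flipIndex x) (l • flipIndex x) = l ^ 2 := by
    have := lorentz_flipIndex_self x
    rw [h.spacelike, lorentz_eq] at this
    rw [lorentz_eq]
    simp only [Pi.smul_apply, smul_eq_mul]
    linear_combination l ^ 2 * this
  have d4 : flipIndex (l • flipIndex x) α = l * x α := by
    rw [flipIndex_smul, flipIndex_flipIndex, Pi.smul_apply, smul_eq_mul]
  have d5 : W α = F.2 * (lorentzFactor (γ y).2 ^ 2 * ((γ y).2 * lorentzFactor (γ y).2 * e α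
      + lorentzFactor (γ y).2 * x α)) := by
    simp only [hW, frameNormal, Pi.add_apply, Pi.smul_apply, smul_eq_mul]
  have d6 : frameVelocity e x (γ y).2 α = lorentzFactor (γ y).2 * e α
      + (γ y).2 * lorentzFactor (γ y).2 * x α := by
    simp only [frameVelocity, Pi.add_apply, Pi.smul_apply, smul_eq_mul]
  have hk := lorentzFactor_sq hT
  have hsqrt : Real.sqrt (1 - (γ y).2 ^ 2) = (lorentzFactor (γ y).2)⁻¹ := by
    unfold lorentzFactor; rw [inv_inv]
  have hkpos := lorentzFactor_pos hT
  have hχ0 := hχ _ hθ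
  have hσ0 := hσ _ hθ
  have hPR : (γ y).1 * deriv p (γ y).1 = p (γ y).1 + energy p (γ y).1 := by
    unfold energy; ring
  have eT : l * sigmaCoeff p η ζ χ (γ y).1 * lorentzFactor (γ y).2 * F.2
      = p (γ y).1 + q₀ * (γ y).2 - q₁ := by
    rw [hF]; simp only [planarField, hsqrt]; field_simp
  have eθ : l * χ (γ y).1 * F.1
      = lorentzFactor (γ y).2 * ((γ y).2 * (q₁ + energy p (γ y).1) - q₀) := by
    rw [hF]; simp only [planarField, hsqrt]; field_simp
  rw [d1, d2, d3, d4, d5, d6, hPR]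
  exact profile_equation_components hk (longitudinal_viscosity (hs _ hθ)) eT eθ

/-! ### From shocks to profiles -/

/-- A shock which the fluid crosses in the direction of `ξ`, from a supersonic to a subsonic state,
has a dissipation profile. -/
theorem exists_profile_of_supersonic_subsonic (hp : ContDiffOn ℝ ∞ p (Ioi 0))
    (hη : ContDiffOn ℝ ∞ η (Ioi 0)) (hζ : ContDiffOn ℝ ∞ ζ (Ioi 0)) (hχ : ContDiffOn ℝ ∞ χ (Ioi 0))
    (hc : StrictlyCausal p) (hχ_pos : ∀ θ, 0 < θ → 0 < χ θ)
    (hσ_pos : ∀ θ, 0 < θ → 0 < sigmaCoeff p η ζ χ θ) (hg : AcousticGenuinelyNonlinear p)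
    {ξ ψm ψp : Vec4} (hm : ψm ∈ stateSpace) (hp' : ψp ∈ stateSpace)
    (hRH : ∀ α, idealFlux p ξ ψm α = idealFlux p ξ ψp α) (hξm : 0 < ξ ⬝ᵥ ψm)
    (hsup : 0 < acousticForm p ξ ψm) (hξp : 0 < ξ ⬝ᵥ ψp) (hsub : acousticForm p ξ ψp < 0) :
    ∃ Ψ : ℝ → Vec4, IsDissipationProfile p η ζ χ ξ ψm ψp Ψ := by
  have hL := lorentz_self_pos_of_acousticForm_neg hp hc hp' hsub
  obtain ⟨l, hl, hlL⟩ : ∃ l : ℝ, 0 < l ∧ l ^ 2 = lorentz ξ ξ :=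
    ⟨_, Real.sqrt_pos.2 hL, Real.sq_sqrt hL.le⟩
  obtain ⟨x, hx, rfl⟩ : ∃ x : Vec4, lorentz x x = 1 ∧ ξ = l • flipIndex x := by
    refine ⟨l⁻¹ • flipIndex ξ, ?_, ?_⟩
    · have := lorentz_flipIndex_self ξ
      rw [← hlL, lorentz_eq] at this
      rw [lorentz_eq]
      simp only [Pi.smul_apply, smul_eq_mul]
      field_simp
      linear_combination this
    · rw [flipIndex_smul, flipIndex_flipIndex, smul_smul, mul_inv_cancel₀ hl.ne', one_smul]
  obtain ⟨e, he, Tm, hTm, hψm⟩ := exists_frame hm hx hl hξm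
  obtain ⟨e', he', Tp, hTp, hψp⟩ := exists_frame hp' hx hl hξp
  have hθm := temperature_pos hm
  have hθp := temperature_pos hp'
  generalize temperature ψm = θm at hψm hθm
  generalize temperature ψp = θp at hψp hθp
  have hTm' : Tm ∈ Ioo (-1 : ℝ) 1 := ⟨by linarith [hTm.1], hTm.2⟩
  have hTp' : Tp ∈ Ioo (-1 : ℝ) 1 := ⟨by linarith [hTp.1], hTp.2⟩
  subst hψm hψp
  obtain ⟨bm, -⟩ := hc.deriv_bounds hp hθm
  obtain ⟨bp, -⟩ := hc.deriv_bounds hp hθp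
  have hkm := lorentzFactor_sq hTm'
  have hkp := lorentzFactor_sq hTp'
  have hkm0 := lorentzFactor_pos hTm'
  have hkp0 := lorentzFactor_pos hTp'
  have hTm0 := hTm.1
  have hTp0 := hTp.1
  rw [he.acousticForm_state hθm hTm'] at hsup
  rw [he'.acousticForm_state hθp hTp'] at hsub
  have hfm := fun α => he.flux_state (p := p) (l := l) hθm hTm' α
  -- The Rankine-Hugoniot conditions put both states into the same plane, with common flux
  -- constants.
  obtain ⟨hee, hq₀, hq₁⟩ := frame_flux_unique he he' (a := θm * deriv p θm * Tm * lorentzFactor Tm ^ 2)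
    (a' := θp * deriv p θp * Tp * lorentzFactor Tp ^ 2)
    (b := θm * deriv p θm * Tm ^ 2 * lorentzFactor Tm ^ 2 + p θm)
    (b' := θp * deriv p θp * Tp ^ 2 * lorentzFactor Tp ^ 2 + p θp)
    (by positivity) (by positivity) (fun α => by
      have := hRH α
      rw [hfm, he'.flux_state hθp hTp'] at this
      exact mul_left_cancel₀ hl.ne' this)
  subst hee
  set q₀ := θm * deriv p θm * Tm * lorentzFactor Tm ^ 2 with hq₀m
  set q₁ := θm * deriv p θm * Tm ^ 2 * lorentzFactor Tm ^ 2 + p θm with hq₁m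
  have hσ := contDiffOn_sigmaCoeff hp hc hη hζ hχ
  obtain ⟨γ, g1, g2, g3, g4⟩ := exists_planar_profile (κ₁ := fun θ => l * χ θ)
    (κ₂ := fun θ => l * sigmaCoeff p η ζ χ θ) (q₀ := q₀) (q₁ := q₁) (Tm := Tm) (Tp := Tp) hp hc hg
    (contDiffOn_const.mul hχ) (contDiffOn_const.mul hσ)
    (fun θ hθ => mul_pos hl (hχ_pos θ hθ)) (fun θ hθ => mul_pos hl (hσ_pos θ hθ))
    (by positivity) hθm hθp hTm hTp
    (by rw [hq₀m, hq₁m]; ring)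
    (by rw [hq₀m, hq₁m, energy]; linear_combination (-θm * deriv p θm * Tm) * hkm)
    (by rw [hq₀, hq₁]; ring)
    (by rw [hq₀, hq₁, energy]; linear_combination (-θp * deriv p θp * Tp) * hkp)
    (by
      -- The derivative of the Hugoniot function at an end state is a positive multiple of the
      -- acoustic form there, so its sign is given by the Lax condition.
      have e1 : hugoniotDeriv p q₁ θm = θm * deriv p θm * lorentzFactor Tm ^ 2
          * (θm * deriv (deriv p) θm * Tm ^ 2 - deriv p θm) := by
        rw [hugoniotDeriv, hq₁m, energy]
        linear_combination (θm * deriv p θm ^ 2) * hkm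
      rw [e1]
      exact mul_pos (by positivity) (pos_of_mul_pos_right hsup (by positivity)))
    (by
      have e1 : hugoniotDeriv p q₁ θp = θp * deriv p θp * lorentzFactor Tp ^ 2
          * (θp * deriv (deriv p) θp * Tp ^ 2 - deriv p θp) := by
        rw [hugoniotDeriv, hq₁, energy]
        linear_combination (θp * deriv p θp ^ 2) * hkp
      rw [e1]
      exact mul_neg_of_pos_of_neg (by positivity) (neg_of_mul_neg_right hsub (by positivity)))
  have hsmooth : ContDiff ℝ ∞ γ := PlanarFlow.contDiff_of_hasDerivAt
    (contDiffOn_planarField hp (contDiffOn_const.mul hχ) (contDiffOn_const.mul hσ)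
      (fun θ hθ => mul_pos hl (hχ_pos θ hθ)) (fun θ hθ => mul_pos hl (hσ_pos θ hθ)) q₀ q₁) g1 g2
  have hopen : IsOpen (Ioi (0 : ℝ) ×ˢ Ioo (-1 : ℝ) 1) := isOpen_Ioi.prod isOpen_Ioo
  have hst := contDiffOn_frameState e x
  have hlim : ∀ {φ : Filter ℝ} {θ T : ℝ}, 0 < θ → T ∈ Ioo (-1 : ℝ) 1 → Tendsto γ φ (𝓝 (θ, T)) →
      Tendsto (fun t => frameState e x (γ t).1 (γ t).2) φ (𝓝 (frameState e x θ T)) :=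
    fun {φ θ T} hθ hT hγ =>
      ((hst.continuousOn.continuousAt (hopen.mem_nhds (show (θ, T) ∈ _ from ⟨hθ, hT⟩))).tendsto).comp hγ
  refine ⟨fun t => frameState e x (γ t).1 (γ t).2, contDiffOn_univ.1
    (hst.comp hsmooth.contDiffOn fun t _ => g2 t), fun t => he.state_mem (g2 t).1 (g2 t).2,
    fun y α => ?_, hlim hθm hTm' g3, hlim hθp hTp' g4⟩
  rw [he.profile_equation hl (fun θ hθ => (soundSq_bounds hp hc hθ).2) hχ_pos hσ_pos g1 g2, hfm]

theorem idealFlux_neg (p : ℝ → ℝ) (ξ ψ : Vec4) (α : Fin 4) :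
    idealFlux p (-ξ) ψ α = -idealFlux p ξ ψ α := by
  simp [idealFlux]

/-- Reversing the normal interchanges the two sides of a shock. -/
theorem IsDissipationProfile.reverse {ξ ψm ψp : Vec4} {Ψ : ℝ → Vec4}
    (hRH : ∀ α, idealFlux p ξ ψm α = idealFlux p ξ ψp α)
    (h : IsDissipationProfile p η ζ χ (-ξ) ψp ψm Ψ) :
    IsDissipationProfile p η ζ χ ξ ψm ψp (fun y => Ψ (-y)) := by
  obtain ⟨h1, h2, h3, h4, h5⟩ := h
  refine ⟨h1.comp contDiff_neg, fun y => h2 _, fun y α => ?_, h5.comp tendsto_neg_atBot_atTop,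
    h4.comp tendsto_neg_atTop_atBot⟩
  have e := h3 (-y) α
  rw [idealFlux_neg, idealFlux_neg, ← hRH α] at e
  -- Reversing both `ξ` and `y` leaves the gradients of the wave unchanged; the outer contraction
  -- with `ξ` changes sign together with the flux.
  have e1 : ∀ β, waveNegDeltaT p η ζ χ ξ (fun y => Ψ (-y)) y α β
      = waveNegDeltaT p η ζ χ (-ξ) Ψ (-y) α β := by
    intro β
    unfold waveNegDeltaT
    have d1 : ∀ i, deriv (fun z => flipIndex (velocity (Ψ (-z))) i) y
        = -deriv (fun z => flipIndex (velocity (Ψ z)) i) (-y) := fun i =>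
      deriv_comp_neg (fun z => flipIndex (velocity (Ψ z)) i) y
    have d2 : deriv (fun z => temperature (Ψ (-z))) y = -deriv (fun z => temperature (Ψ z)) (-y) :=
      deriv_comp_neg (fun z => temperature (Ψ z)) y
    simp only [d1, d2, Pi.neg_apply, mul_neg, neg_mul]
  simp only [e1]
  simp only [Pi.neg_apply, neg_mul, Finset.sum_neg_distrib] at e
  linarith

end RelFluid

end

theorem theorem2 (p η ζ χ : ℝ → ℝ)
    (hp : ContDiffOn ℝ ∞ p (Set.Ioi 0)) (hη : ContDiffOn ℝ ∞ η (Set.Ioi 0))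
    (hζ : ContDiffOn ℝ ∞ ζ (Set.Ioi 0)) (hχ : ContDiffOn ℝ ∞ χ (Set.Ioi 0))
    (hcausal : RelFluid.StrictlyCausal p)
    (hη_pos : ∀ θ, 0 < θ → 0 < η θ) (hζ_nonneg : ∀ θ, 0 < θ → 0 ≤ ζ θ)
    (hχ_pos : ∀ θ, 0 < θ → 0 < χ θ)
    (hσ_pos : ∀ θ, 0 < θ → 0 < RelFluid.sigmaCoeff p η ζ χ θ)
    (hgnl : RelFluid.AcousticGenuinelyNonlinear p)
    (ξ ψm ψp : RelFluid.Vec4) (hshock : RelFluid.IsLaxShock p ξ ψm ψp) :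
    ∃ Ψ : ℝ → RelFluid.Vec4, RelFluid.IsDissipationProfile p η ζ χ ξ ψm ψp Ψ := by
  have hRH := hshock.2.2.1
  rcases hshock.acoustic hp hcausal with ⟨h1, h2, h3, h4⟩ | ⟨h1, h2, h3, h4⟩
  · exact RelFluid.exists_profile_of_supersonic_subsonic hp hη hζ hχ hcausal hχ_pos hσ_pos hgnl
      hshock.1 hshock.2.1 hRH h1 h2 h3 h4
  -- Under `ξ ↦ -ξ` the sides are exchanged while the acoustic form, being quadratic, is not
  -- affected, so the fluid again passes from the supersonic to the subsonic state.
  · have even : ∀ ψ, RelFluid.acousticForm p (-ξ) ψ = RelFluid.acousticForm p ξ ψ := by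
      intro ψ
      unfold RelFluid.acousticForm
      rw [neg_dotProduct, neg_sq, RelFluid.lorentz_eq, RelFluid.lorentz_eq]
      simp
    obtain ⟨Ψ, hΨ⟩ := RelFluid.exists_profile_of_supersonic_subsonic (ξ := -ξ) hp hη hζ hχ hcausal
      hχ_pos hσ_pos hgnl hshock.2.1 hshock.1
      (fun α => by rw [RelFluid.idealFlux_neg, RelFluid.idealFlux_neg, hRH α])
      (by rw [neg_dotProduct]; linarith) (by rwa [even])
      (by rw [neg_dotProduct]; linarith) (by rwa [even])
    exact ⟨_, hΨ.reverse hRH⟩
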